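/- Let $\mathfrak A_0,\mathfrak A_1$ be complex Hilbert spaces, $\mathfrak A_1\neq\{0\}$, let $A_0$ be a (possibly unbounded) self-adjoint operator in $\mathfrak A_0$ with spectral measure $\mathsf E_0$, $A_1$ a bounded self-adjoint operator on $\mathfrak A_1$, and $B$ a bounded operator from $\mathfrak A_1$ to $\mathfrak A_0$. Let $\Delta_0=(\mu^{(1)},\mu^{(2)})$ with $-\infty\le\mu^{(1)}<\mu^{(2)}\le\infty$. Assume that the spectrum of $A_0$ is absolutely continuous and equals $\overline{\Delta_0}$, and that $\sigma_1:=\operatorname{spec}(A_1)\subset\Delta_0$. Assume that $K_B(\mu)=B^*\mathsf E_0((-\infty,\mu))B$ is differentiable in operator norm on $\Delta_0$ and that $K_B'$ continues analytically from $\Delta_0$ to a simply connected domain $D^-$ in the open lower half-plane whose boundary contains $\Delta_0$. Let $D^+=\{\bar z: z\in D^-\}$ and continue $K_B'$ to $D^+$ by $K_B'(\mu)=[K_B'(\bar\mu)]^*$. If an end point $c$ of $\Delta_0$ is finite, assume that $\|K_B'(\mu)\|\le C|\mu-c|^{p}$ for the points $\mu\in D^\pm$ near $c$, with some $C>0$ and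 $p\in(-1,0]$. Fix $l\in\{+1,-1\}$. An admissible contour $\Gamma\subset D^l$ is a (locally) rectifiable Jordan arc obtained from $\Delta_0$ by a continuous deformation inside $D^l\cup\Delta_0$ with the finite end points fixed, such that $\mathcal V:=\int_\Gamma\|K_B'(\mu)\|\,|d\mu|<\infty$. At an infinite end of $\Delta_0$ the deformed curves are required to tend to infinity uniformly, and the deformation is required to possess, arbitrarily far out, Lipschitz transversals (each the path of one point of $\Delta_0$ under the deformation) along which $\int\|K_B'(\mu)\|\,|\mu|^{-1}|d\mu|$ is arbitrarily small. Let $\Gamma\subset D^l$ be an admissible contour with $\mathcal V<\frac14d^2$, where $d=\operatorname{dist}(\sigma_1,\Gamma)$. Let $Z^{(l)}=A_1+X$, where $X$ is the bounded operator on $\mathfrak A_1$ that solves $$X=-\int_\Gamma d\mu\,K_B'(\mu)\,(A_1+X-\mu)^{-1}$$ with $\|X\|\le r$ for some $r$ such that $\frac d2-\sqrt{\frac{d^2}4-\mathcal V}\le r<d-\sqrt{\mathcal V}$. Assume finally that $\operatorname{dist}(\operatorname{spec}(Z^{(l)}),D^l)>0$. Then the integral $$Y^{(l)}=\int_{\Delta_0}\mathsf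 E_0(d\mu)\,B\,(Z^{(l)}-\mu)^{-1}$$ exists as a strong (improper) Riemann-Stieltjes integral, defines a bounded operator from $\mathfrak A_1$ to $\mathfrak A_0$, and satisfies $$\|Y^{(l)*}\|=\|Y^{(l)}\|\ge 1 .$$ In particular, $Y^{(l)}$ and $Y^{(l)*}$ are not strict contractions. -/

import Mathlib

open Filter Topology MeasureTheory Set
open scoped ComplexConjugate InnerProduct

noncomputable section

/-- A projection-valued (spectral) measure on the Borel sets of `ℝ`, acting in `H`. -/
structure SpectralMeasure (H : Type*) [NormedAddCommGroup H] [InnerProductSpace ℂ H]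
    [CompleteSpace H] where
  toFun : Set ℝ → (H →L[ℂ] H)
  isProj : ∀ s, MeasurableSet s → IsStarProjection (toFun s)
  map_univ : toFun univ = 1
  map_inter : ∀ s t, MeasurableSet s → MeasurableSet t → toFun (s ∩ t) = toFun s * toFun t
  sigmaAdd : ∀ f : ℕ → Set ℝ, (∀ n, MeasurableSet (f n)) → Pairwise (Function.onFun Disjoint f) →
    ∀ x : H, HasSum (fun n => toFun (f n) x) (toFun (⋃ n, f n) x)

namespace SpectralMeasure

variable {H : Type*} [NormedAddCommGroup H] [InnerProductSpace ℂ H] [CompleteSpace H]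

theorem inner_apply (E : SpectralMeasure H) {s : Set ℝ} (hs : MeasurableSet s) (x : H) :
    inner ℂ x (E.toFun s x) = ((‖E.toFun s x‖ ^ 2 : ℝ) : ℂ) := by
  have h := E.isProj s hs
  have hi : E.toFun s (E.toFun s x) = E.toFun s x := by
    have := congrArg (fun T : H →L[ℂ] H => T x) h.isIdempotentElem.eq
    simpa using this
  have ha : ContinuousLinearMap.adjoint (E.toFun s) = E.toFun s := h.isSelfAdjoint
  have h2 : inner ℂ x (E.toFun s (E.toFun s x)) = inner ℂ (E.toFun s x) (E.toFun s x) := by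
    conv_lhs => rw [← ContinuousLinearMap.adjoint_inner_left, ha]
  rw [hi] at h2
  rw [h2, inner_self_eq_norm_sq_to_K]
  norm_cast

theorem empty (E : SpectralMeasure H) : E.toFun ∅ = 0 := by
  ext x
  have h := E.sigmaAdd (fun _ => ∅) (fun _ => MeasurableSet.empty)
    (fun _ _ _ => by simp [Function.onFun]) x
  have h0 := h.summable.tendsto_atTop_zero
  simpa using tendsto_nhds_unique tendsto_const_nhds h0

/-- The scalar measure `s ↦ ⟨E(s) x, x⟩ = ‖E(s) x‖²`. -/
def scalar (E : SpectralMeasure H) (x : H) : Measure ℝ :=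
  Measure.ofMeasurable (fun s _ => ENNReal.ofReal (‖E.toFun s x‖ ^ 2)) (by simp [E.empty])
    (by
      intro f hf hd
      have h := (E.sigmaAdd f hf hd x).mapL (innerSL ℂ x)
      simp only [innerSL_apply_apply] at h
      simp only [E.inner_apply (hf _), E.inner_apply (MeasurableSet.iUnion hf)] at h
      have h' := Complex.hasSum_ofReal.mp h
      rw [← h'.tsum_eq, ENNReal.ofReal_tsum_of_nonneg (fun _ => by positivity) h'.summable])

theorem scalar_apply (E : SpectralMeasure H) (x : H) {s : Set ℝ} (hs : MeasurableSet s) :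
    E.scalar x s = ENNReal.ofReal (‖E.toFun s x‖ ^ 2) :=
  Measure.ofMeasurable_apply s hs

/-- `E` is the spectral measure of the (possibly unbounded) operator `A`, that is,
`A = ∫ λ E(dλ)` with its natural domain. -/
structure IsSpectralMeasureOf (E : SpectralMeasure H) (A : H →ₗ.[ℂ] H) : Prop where
  mem_domain : ∀ x : H, x ∈ A.domain ↔ Integrable (fun t : ℝ => t ^ 2) (E.scalar x)
  inner_eq : ∀ x : A.domain, inner ℂ (x : H) (A x) = ((∫ t : ℝ, t ∂(E.scalar x) : ℝ) : ℂ)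

/-- The spectrum is purely absolutely continuous: all the measures `⟨E(·) x, x⟩` are
absolutely continuous with respect to Lebesgue measure. -/
def IsAbsCont (E : SpectralMeasure H) : Prop := ∀ x : H, E.scalar x ≪ volume

end SpectralMeasure

/-- The spectrum of a possibly unbounded operator: the complement of the set of those `z` for
which `A - z` is a bijection of the domain onto `H` with a bounded inverse. -/
def unboundedSpectrum {H : Type*} [NormedAddCommGroup H] [InnerProductSpace ℂ H]
    (A : H →ₗ.[ℂ] H) : Set ℂ :=
  {z | ∃ R : H →L[ℂ] H,
      (∀ y : H, ∃ h : R y ∈ A.domain, A ⟨R y, h⟩ - z • R y = y) ∧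
      (∀ x : A.domain, R (A x - z • (x : H)) = x)}ᶜ

/-- The open interval `(a, b)` of the real line, with possibly infinite ends. -/
def openIv (a b : EReal) : Set ℝ := {t | a < (t : EReal) ∧ (t : EReal) < b}

/-- The same interval as a subset of `ℂ`. -/
def openIvC (a b : EReal) : Set ℂ := (fun t : ℝ => (t : ℂ)) '' openIv a b

/-- `t → a` from the right (`t → -∞` if `a = -∞`). -/
def leftEnd (a : EReal) : Filter ℝ := comap (fun t : ℝ => (t : EReal)) (𝓝[>] a)

/-- `t → b` from the left (`t → +∞` if `b = +∞`). -/
def rightEnd (b : EReal) : Filter ℝ := comap (fun t : ℝ => (t : EReal)) (𝓝[<] b)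

/-- The distance between two (nonempty) sets. -/
def setDist (S T : Set ℂ) : ℝ := sInf {r | ∃ z ∈ S, ∃ w ∈ T, r = dist z w}

/-- `D` is a simply connected domain in the open lower half-plane whose boundary contains the
interval `(a, b)`. -/
structure IsLowerDomain (a b : EReal) (D : Set ℂ) : Prop where
  isOpen : IsOpen D
  simplyConnected : IsSimplyConnected D
  lower : ∀ z ∈ D, z.im < 0
  boundary : openIvC a b ⊆ frontier D

/-- `D^l`: the given lower domain for `l = -1`, its mirror image for `l = +1`. -/
def domainOf (D : Set ℂ) (l : ℤˣ) : Set ℂ := {z | (if l = 1 then conj z else z) ∈ D}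

section Operators

variable {H₀ H₁ : Type*} [NormedAddCommGroup H₀] [InnerProductSpace ℂ H₀] [CompleteSpace H₀]
  [NormedAddCommGroup H₁] [InnerProductSpace ℂ H₁] [CompleteSpace H₁]

/-- `K_B(μ) = B* E((-∞, μ)) B`. -/
def KB (E : SpectralMeasure H₀) (B : H₁ →L[ℂ] H₀) (μ : ℝ) : H₁ →L[ℂ] H₁ :=
  (ContinuousLinearMap.adjoint B).comp ((E.toFun (Iio μ)).comp B)

/-- `k` represents the derivative of `K_B` (in the operator norm) on the interval `(a, b)` and its
analytic continuation from `(a, b)` to the domain `D`. -/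
structure IsContinuedDerivative (E : SpectralMeasure H₀) (B : H₁ →L[ℂ] H₀) (a b : EReal)
    (D : Set ℂ) (k : ℂ → (H₁ →L[ℂ] H₁)) : Prop where
  hasDeriv : ∀ μ ∈ openIv a b, HasDerivAt (KB E B) (k μ) μ
  analytic : AnalyticOnNhd ℂ k (D ∪ openIvC a b)

/-- Near the finite end `c` of the interval one has `‖k(μ)‖ ≤ C |μ - c|^p` in `D`, for some
`C > 0` and some exponent `p ∈ (-1, 0]`. -/
def EndBound (D : Set ℂ) (k : ℂ → (H₁ →L[ℂ] H₁)) (c : ℝ) : Prop :=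
  ∃ C > (0 : ℝ), ∃ p ∈ Ioc (-1 : ℝ) 0, ∃ ρ > (0 : ℝ),
    ∀ μ ∈ D, dist μ (c : ℂ) < ρ → ‖k μ‖ ≤ C * ‖μ - c‖ ^ p

/-- The continuation of `K_B'` to `D^l`; for `l = +1` it is obtained by the reflection
`K_B'(μ) = [K_B'(conj μ)]*`. -/
def contOf (k : ℂ → (H₁ →L[ℂ] H₁)) (l : ℤˣ) (μ : ℂ) : H₁ →L[ℂ] H₁ :=
  if l = 1 then ContinuousLinearMap.adjoint (k (conj μ)) else k μ

/-- The transversal `s ↦ H(t, s)` is Lipschitz and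
`∫ ‖k(μ)‖ |μ|⁻¹ |dμ| < ε` along it. -/
def SmallTransversal (k : ℂ → (H₁ →L[ℂ] H₁)) (H : ℝ → ℝ → ℂ) (t ε : ℝ) : Prop :=
  (∃ C, LipschitzOnWith C (H t) (Icc 0 1)) ∧
    ∫ s in Icc (0 : ℝ) 1, ‖k (H t s)‖ * ‖deriv (H t) s‖ / ‖H t s‖ < ε

/-- `H(t, s)`, `t ∈ (a, b)`, `s ∈ [0, 1]`, is a continuous deformation within `D ∪ (a, b)` of the
interval `(a, b)` into the curve `γ`, keeping the finite end points fixed. If an end is infinite,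
then the deformed curves go to infinity there, and there are transversals of the deformation, as
far out as one likes, along which the integral of `‖k(μ)‖ |μ|⁻¹ |dμ|` is as small as one likes. -/
structure IsDeformation (a b : EReal) (D : Set ℂ) (k : ℂ → (H₁ →L[ℂ] H₁)) (γ : ℝ → ℂ)
    (H : ℝ → ℝ → ℂ) : Prop where
  cont : ContinuousOn (fun p : ℝ × ℝ => H p.1 p.2) (openIv a b ×ˢ Icc 0 1)
  start : ∀ t ∈ openIv a b, H t 0 = t
  final : ∀ t ∈ openIv a b, H t 1 = γ t
  mem : ∀ t ∈ openIv a b, ∀ s ∈ Icc (0 : ℝ) 1, H t s ∈ D ∪ openIvC a b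
  left_finite : ∀ c : ℝ, a = c → ∀ ε > 0, ∀ᶠ t in leftEnd a, ∀ s ∈ Icc (0 : ℝ) 1,
    dist (H t s) (c : ℂ) < ε
  right_finite : ∀ c : ℝ, b = c → ∀ ε > 0, ∀ᶠ t in rightEnd b, ∀ s ∈ Icc (0 : ℝ) 1,
    dist (H t s) (c : ℂ) < ε
  left_infinite : a = ⊥ → ∀ R : ℝ, ∀ᶠ t in leftEnd a, ∀ s ∈ Icc (0 : ℝ) 1, R < ‖H t s‖
  right_infinite : b = ⊤ → ∀ R : ℝ, ∀ᶠ t in rightEnd b, ∀ s ∈ Icc (0 : ℝ) 1, R < ‖H t s‖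
  left_small : a = ⊥ → ∀ ε > 0, ∃ᶠ t in leftEnd a, SmallTransversal k H t ε
  right_small : b = ⊤ → ∀ ε > 0, ∃ᶠ t in rightEnd b, SmallTransversal k H t ε

/-- The contour `Γ`, the range of the parametrization `γ` over `(a, b)`. -/
def contour (a b : EReal) (γ : ℝ → ℂ) : Set ℂ := γ '' openIv a b

/-- The variation `∫_Γ ‖K_B'(μ)‖ |dμ|`. -/
def variation (a b : EReal) (k : ℂ → (H₁ →L[ℂ] H₁)) (γ : ℝ → ℂ) : ℝ :=
  ∫ t in openIv a b, ‖k (γ t)‖ * ‖deriv γ t‖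

/-- `γ` parametrizes an admissible contour: a (locally) rectifiable Jordan arc in `D`, obtained
from `(a, b)` by a continuous deformation, along which the variation is finite. A locally
rectifiable arc always has a locally Lipschitz parametrization. -/
structure IsAdmissible (a b : EReal) (D : Set ℂ) (k : ℂ → (H₁ →L[ℂ] H₁)) (γ : ℝ → ℂ) :
    Prop where
  mapsTo : MapsTo γ (openIv a b) D
  injOn : InjOn γ (openIv a b)
  lipschitz : LocallyLipschitzOn (openIv a b) γ
  deformation : ∃ H, IsDeformation a b D k γ H
  finiteVariation : IntegrableOn (fun t => ‖k (γ t)‖ * ‖deriv γ t‖) (openIv a b)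

/-- `W₁(Z, Γ) = -∫_Γ dμ K_B'(μ) (Z - μ)⁻¹`. -/
def W1 (a b : EReal) (k : ℂ → (H₁ →L[ℂ] H₁)) (γ : ℝ → ℂ) (Z : H₁ →L[ℂ] H₁) : H₁ →L[ℂ] H₁ :=
  -∫ t in openIv a b, deriv γ t • (k (γ t) * Ring.inverse (Z - (γ t) • (1 : H₁ →L[ℂ] H₁)))

/-- `r_min = d/2 - √(d²/4 - V)`. -/
def rMin (d V : ℝ) : ℝ := d / 2 - √(d ^ 2 / 4 - V)

/-- `r_max = d - √V`. -/
def rMax (d V : ℝ) : ℝ := d - √V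

/-- `v` is the limit of the Riemann-Stieltjes sums `∑ E([τᵢ, τᵢ₊₁)) F(ξᵢ) x` over tagged partitions
of `[α, β)`, as the mesh tends to zero. -/
def HasStieltjes (E : SpectralMeasure H₀) (F : ℝ → (H₁ →L[ℂ] H₀)) (x : H₁) (α β : ℝ) (v : H₀) :
    Prop :=
  ∀ ε > 0, ∃ δ > 0, ∀ (n : ℕ) (τ ξ : ℕ → ℝ), τ 0 = α → τ n = β →
    (∀ i < n, τ i ≤ τ (i + 1) ∧ τ (i + 1) - τ i < δ ∧ ξ i ∈ Icc (τ i) (τ (i + 1))) →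
    ‖∑ i ∈ Finset.range n, E.toFun (Ico (τ i) (τ (i + 1))) (F (ξ i) x) - v‖ < ε

/-- `Y = ∫_{(a,b)} E(dμ) F(μ)` in the strong sense: for every `x`, the Riemann-Stieltjes integrals
over `[α, β)` exist and tend to `Y x` as `α → a` and `β → b`. -/
def IsStrongIntegral (E : SpectralMeasure H₀) (F : ℝ → (H₁ →L[ℂ] H₀)) (a b : EReal)
    (Y : H₁ →L[ℂ] H₀) : Prop :=
  ∀ x : H₁, ∃ S : ℝ × ℝ → H₀,
    (∀ α ∈ openIv a b, ∀ β ∈ openIv a b, α < β → HasStieltjes E F x α β (S (α, β))) ∧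
    Tendsto S (leftEnd a ×ˢ rightEnd b) (𝓝 (Y x))

/-- `Y` is the angular operator `∫_{(a,b)} E(dμ) B (Z - μ)⁻¹`. -/
def IsAngularOperator (E : SpectralMeasure H₀) (B : H₁ →L[ℂ] H₀) (a b : EReal)
    (Z : H₁ →L[ℂ] H₁) (Y : H₁ →L[ℂ] H₀) : Prop :=
  IsStrongIntegral E
    (fun μ => B.comp (Ring.inverse (Z - (μ : ℂ) • (1 : H₁ →L[ℂ] H₁)))) a b Y

end Operators

end

open Filter Topology MeasureTheory Set
open scoped ComplexConjugate InnerProduct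

noncomputable section

/-! ### Separation in a rectangle by a winding argument -/

section PlanarSeparation

/-! Write Z = A₁ + X and suppose ‖Y‖ < 1. Two facts about Y lead to a contradiction. First, B*Y =
-X. Integration by parts turns ⟨By, Yx⟩ into the improper integral of ⟨y, K_B'(t)(Z - t)⁻¹x⟩ over Δ₀
(`inner_angularIntegral`). Moving it to Γ gives -⟨y, W₁(Z, Γ)x⟩ = -⟨y, Xx⟩
(`inner_angularOperator_eq`). Second, ⟨YZx, Yy⟩ - ⟨Bx, Yy⟩ is a symmetric form
(`inner_angularIntegral_symm`), because formally YZ - B = ∫ t E(dt) B(Z - t)⁻¹ and t is real. This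
replaces the Riccati equation and avoids the domain of A₀.

Together they make Z symmetric for the form ⟨(1 - Y*Y)x, y⟩, which is strictly positive when ‖Y‖ <
1, so the spectrum of Z is real (`im_eq_zero_of_mem_spectrum`). It is nonempty and lies within ‖X‖ <
d of σ₁ ⊂ Δ₀. The finite end points of Δ₀ are limits of points of Γ, hence at distance at least d
from σ₁, so a spectral point of Z falls into Δ₀. But Δ₀ lies in the closure of D^l, from which the
spectrum of Z is separated.

The integral exists because absolute continuity makes t ↦ E((-∞, t)) strongly continuous. Its
integrated-by-parts form then converges, the derivative of the resolvent decaying like (1 + t²)⁻¹.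
The Riemann-Stieltjes sums converge to that form because the errors on different cells are
orthogonal.

The contour shift is the hard part, since the deformation is only continuous. A primitive G of the
integrand is continued along the deformation, and both integrals become increments of G
(`IsDeformation.eq_of_tendsto`). It remains to make the increments of G between the two curves small
near each end. At an infinite end the given transversals do this. At a finite end no rectifiable
transversal is available, and a small circular arc about the end point replaces it. That some
crossing of the final curve is joined to Δ₀ by an arc compatible with G is a planar separation
statement (`not_separated_zero_set`, `exists_norm_eq_and_norm_sub_le`). -/

theorem im_sub_arg_eq_of_exp_eq {X : Type*} [TopologicalSpace X] {S : Set X}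
    (hS : IsPreconnected S) {L u : X → ℂ} (hL : ContinuousOn L S) (hu : ContinuousOn u S)
    (hu' : ∀ x ∈ S, u x ∈ Complex.slitPlane) {c : ℂ}
    (hexp : ∀ x ∈ S, Complex.exp (L x) = c * u x) {x y : X} (hx : x ∈ S) (hy : y ∈ S) :
    (L x).im - (u x).arg = (L y).im - (u y).arg := by
  set D : X → ℂ := fun z => L z - Complex.log (u z)
  have hD : ContinuousOn D S := hL.sub (hu.clog hu')
  have hexpD : ∀ z ∈ S, Complex.exp (D z) = c := by
    intro z hz
    have h0 : u z ≠ 0 := Complex.slitPlane_ne_zero (hu' z hz)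
    rw [Complex.exp_sub, hexp z hz, Complex.exp_log h0, mul_div_cancel_right₀ _ h0]
  set f : X → ℝ := fun z => ((D z).im - (D y).im) / (2 * Real.pi)
  have hf : ContinuousOn f S :=
    ((Complex.continuous_im.comp_continuousOn hD).sub continuousOn_const).div_const _
  have hmaps : MapsTo f S (range ((↑) : ℤ → ℝ)) := by
    intro z hz
    obtain ⟨n, hn⟩ := Complex.exp_eq_exp_iff_exists_int.mp ((hexpD z hz).trans (hexpD y hy).symm)
    refine ⟨n, ?_⟩
    have : (D z).im = (D y).im + n * (2 * Real.pi) := by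
      rw [hn]; simp
    simp only [f, this]
    have := Real.pi_pos
    field_simp
    ring
  have hdisc : IsDiscrete (range ((↑) : ℤ → ℝ)) :=
    ⟨Int.isClosedEmbedding_coe_real.isEmbedding.toHomeomorph.symm.isEmbedding.discreteTopology⟩
  have h1 := hS.constant_of_mapsTo hdisc hf hmaps hx hy
  have h2 : f y = 0 := by simp [f]
  rw [h2] at h1
  have h3 : (D x).im - (D y).im = 0 := by
    have := Real.pi_pos
    simpa [f, this.ne'] using h1
  simp only [D, Complex.sub_im, Complex.log_im] at h3
  linarith

/-- A continuous function on a rectangle which is negative on the left side and positive on the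
right side has a zero set that cannot be separated between the bottom and the top. -/
theorem not_separated_zero_set {t₁ t₂ : ℝ} (ht : t₁ ≤ t₂) {h : ℝ × ℝ → ℝ}
    (hc : ContinuousOn h (Icc t₁ t₂ ×ˢ Icc 0 1)) (hl : ∀ s ∈ Icc (0 : ℝ) 1, h (t₁, s) < 0)
    (hr : ∀ s ∈ Icc (0 : ℝ) 1, 0 < h (t₂, s)) {K₀ K₁ : Set (ℝ × ℝ)} (hK₀ : IsClosed K₀)
    (hK₁ : IsClosed K₁) (hd : Disjoint K₀ K₁)
    (hz : ∀ q ∈ Icc t₁ t₂ ×ˢ Icc (0 : ℝ) 1, h q = 0 → q ∈ K₀ ∪ K₁)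
    (hb : ∀ t ∈ Icc t₁ t₂, h (t, 0) = 0 → (t, (0 : ℝ)) ∈ K₀)
    (htop : ∀ t ∈ Icc t₁ t₂, h (t, 1) = 0 → (t, (1 : ℝ)) ∈ K₁) : False := by
  obtain ⟨φ, hφ0, hφ1, -⟩ := exists_continuous_zero_one_of_isClosed hK₀ hK₁ hd
  set pr : ℝ × ℝ → ℝ × ℝ :=
    fun q => ((projIcc t₁ t₂ ht q.1 : ℝ), (projIcc (0 : ℝ) 1 zero_le_one q.2 : ℝ)) with hpr
  have hprc : Continuous pr := by
    apply Continuous.prodMk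
    · exact continuous_subtype_val.comp (continuous_projIcc.comp continuous_fst)
    · exact continuous_subtype_val.comp (continuous_projIcc.comp continuous_snd)
  have hprm : ∀ q, pr q ∈ Icc t₁ t₂ ×ˢ Icc (0 : ℝ) 1 := fun q =>
    ⟨(projIcc t₁ t₂ ht q.1).2, (projIcc (0 : ℝ) 1 zero_le_one q.2).2⟩
  have hpre : ∀ q ∈ Icc t₁ t₂ ×ˢ Icc (0 : ℝ) 1, pr q = q := by
    rintro ⟨t, s⟩ ⟨h1, h2⟩
    simp [hpr, projIcc_of_mem ht h1, projIcc_of_mem zero_le_one h2]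
  have hhc : Continuous fun q => h (pr q) := hc.comp_continuous hprc hprm
  -- `g` could vanish only where h = 0 and φ = 1/2, but φ is 0 or 1 on the zero set of h. So `g` has
  -- a continuous logarithm, although it winds once around 0 along the boundary of the rectangle.
  set g : ℝ × ℝ → ℂ := fun q => (h (pr q) : ℂ) + ((φ (pr q) - 1 / 2 : ℝ) : ℂ) * Complex.I with hg
  have hgc : Continuous g :=
    (Complex.continuous_ofReal.comp hhc).add ((Complex.continuous_ofReal.comp
      ((φ.continuous.comp hprc).sub continuous_const)).mul continuous_const)
  have hgre : ∀ q, (g q).re = h (pr q) := by intro q; simp [hg]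
  have hgim : ∀ q, (g q).im = φ (pr q) - 1 / 2 := by intro q; simp [hg]
  have hg0 : ∀ q, g q ≠ 0 := by
    intro q hq
    have h1 : h (pr q) = 0 := by rw [← hgre, hq]; rfl
    have h2 : φ (pr q) - 1 / 2 = 0 := by rw [← hgim, hq]; rfl
    rcases hz _ (hprm q) h1 with hK | hK
    · rw [hφ0 hK] at h2; norm_num at h2
    · rw [hφ1 hK] at h2; norm_num at h2
  have huniv : IsSimplyConnected (univ : Set (ℝ × ℝ)) := by
    have := (convex_univ (𝕜 := ℝ) (E := ℝ × ℝ)).contractibleSpace univ_nonempty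
    exact SimplyConnectedSpace.ofContractible _
  obtain ⟨L, hLc, hLe⟩ := Complex.exists_continuousOn_eqOn_exp_comp (U := (univ : Set (ℝ × ℝ)))
    huniv isOpen_univ hgc.continuousOn
    (by rintro ⟨q, -, hq⟩; exact hg0 q hq)
  have hLc : Continuous L := continuousOn_univ.mp hLc
  have hLe : ∀ q, Complex.exp (L q) = g q := fun q => hLe (mem_univ q)
  -- On the bottom, top, left and right sides the factors I, -I, -1, 1 rotate `g` into the slit
  -- plane, so Im L follows the argument there. Comparing at the four corners yields 2π = 0.
  have key : ∀ (S : Set (ℝ × ℝ)) (c : ℂ), c ≠ 0 → IsPreconnected S →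
      (∀ q ∈ S, c * g q ∈ Complex.slitPlane) → ∀ q ∈ S, ∀ q' ∈ S,
      (L q).im - (c * g q).arg = (L q').im - (c * g q').arg := by
    intro S c hc0 hS hm q hq q' hq'
    refine im_sub_arg_eq_of_exp_eq (c := c⁻¹) hS hLc.continuousOn
      (hgc.const_mul c).continuousOn hm ?_ hq hq'
    intro x _
    rw [hLe, inv_mul_cancel_left₀ hc0]
  have hseg : ∀ s : ℝ, IsPreconnected (Icc t₁ t₂ ×ˢ {s}) := fun s =>
    isPreconnected_Icc.prod isPreconnected_singleton
  have hseg' : ∀ t : ℝ, IsPreconnected ({t} ×ˢ Icc (0 : ℝ) 1) := fun t =>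
    isPreconnected_singleton.prod isPreconnected_Icc
  have m0 : (0 : ℝ) ∈ Icc (0 : ℝ) 1 := by simp
  have m1 : (1 : ℝ) ∈ Icc (0 : ℝ) 1 := by simp
  have mt₁ : t₁ ∈ Icc t₁ t₂ := left_mem_Icc.mpr ht
  have mt₂ : t₂ ∈ Icc t₁ t₂ := right_mem_Icc.mpr ht
  have hL : ∀ s ∈ Icc (0 : ℝ) 1, (g (t₁, s)).re < 0 := by
    intro s hs; rw [hgre, hpre _ ⟨mt₁, hs⟩]; exact hl s hs
  have hR : ∀ s ∈ Icc (0 : ℝ) 1, 0 < (g (t₂, s)).re := by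
    intro s hs; rw [hgre, hpre _ ⟨mt₂, hs⟩]; exact hr s hs
  have eB := key (Icc t₁ t₂ ×ˢ {0}) Complex.I Complex.I_ne_zero (hseg 0) (by
    rintro ⟨t, s⟩ ⟨h1, rfl : s = 0⟩
    rw [Complex.mem_slitPlane_iff]
    by_cases h0 : h (t, 0) = 0
    · left
      have := hφ0 (hb t h1 h0)
      simp [hgim, hpre (t, 0) ⟨h1, m0⟩, this]
    · right; simpa [hgre, hpre (t, 0) ⟨h1, m0⟩] using h0) (t₁, 0) ⟨mt₁, rfl⟩ (t₂, 0) ⟨mt₂, rfl⟩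
  have eT := key (Icc t₁ t₂ ×ˢ {1}) (-Complex.I) (by simp) (hseg 1) (by
    rintro ⟨t, s⟩ ⟨h1, rfl : s = 1⟩
    rw [Complex.mem_slitPlane_iff]
    by_cases h0 : h (t, 1) = 0
    · left
      have := hφ1 (htop t h1 h0)
      simp [hgim, hpre (t, 1) ⟨h1, m1⟩, this]
      norm_num
    · right; simpa [hgre, hpre (t, 1) ⟨h1, m1⟩] using h0) (t₁, 1) ⟨mt₁, rfl⟩ (t₂, 1) ⟨mt₂, rfl⟩
  have eL := key ({t₁} ×ˢ Icc 0 1) (-1) (by simp) (hseg' t₁) (by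
    rintro ⟨t, s⟩ ⟨rfl : t = t₁, h1⟩
    rw [Complex.mem_slitPlane_iff]
    left
    have := hL s h1
    simpa using this) (t₁, 0) ⟨rfl, m0⟩ (t₁, 1) ⟨rfl, m1⟩
  have eR := key ({t₂} ×ˢ Icc 0 1) 1 (by simp) (hseg' t₂) (by
    rintro ⟨t, s⟩ ⟨rfl : t = t₂, h1⟩
    rw [Complex.mem_slitPlane_iff]
    left
    have := hR s h1
    simpa using this) (t₂, 0) ⟨rfl, m0⟩ (t₂, 1) ⟨rfl, m1⟩
  have argI : ∀ z : ℂ, 0 < z.re → (Complex.I * z).arg = z.arg + Real.pi / 2 := by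
    intro z hz
    have := abs_lt.mp (Complex.abs_arg_lt_pi_div_two_iff.mpr (Or.inl hz))
    rw [Complex.arg_mul Complex.I_ne_zero (by rintro rfl; simp at hz), Complex.arg_I]
    · ring
    · rw [Complex.arg_I]; constructor <;> linarith [this.1, this.2]
  have argnI : ∀ z : ℂ, 0 < z.re → (-Complex.I * z).arg = z.arg - Real.pi / 2 := by
    intro z hz
    have := abs_lt.mp (Complex.abs_arg_lt_pi_div_two_iff.mpr (Or.inl hz))
    rw [Complex.arg_mul (by simp) (by rintro rfl; simp at hz), Complex.arg_neg_I]
    · ring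
    · rw [Complex.arg_neg_I]; constructor <;> linarith [this.1, this.2]
  have a1 := argI _ (hR 0 m0)
  have a2 := argnI _ (hR 1 m1)
  have a3 := argnI (-1 * g (t₁, 0)) (by have := hL 0 m0; simpa using this)
  have a4 := argI (-1 * g (t₁, 1)) (by have := hL 1 m1; simpa using this)
  rw [show -Complex.I * (-1 * g (t₁, 0)) = Complex.I * g (t₁, 0) by ring] at a3
  rw [show Complex.I * (-1 * g (t₁, 1)) = -Complex.I * g (t₁, 1) by ring] at a4
  simp only [one_mul] at eR
  have := Real.pi_pos
  linarith

end PlanarSeparation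

/-! ### Calculus along Lipschitz curves -/

section LipschitzCurve

theorem LipschitzOnWith.norm_deriv_le_of_mem_Ioo {E : Type*} [NormedAddCommGroup E]
    [NormedSpace ℝ E] {C : NNReal} {c : ℝ → E} {u v t : ℝ} (hc : LipschitzOnWith C c (Icc u v))
    (ht : t ∈ Ioo u v) : ‖deriv c t‖ ≤ C :=
  norm_deriv_le_of_lipschitzOn (Icc_mem_nhds ht.1 ht.2) hc

theorem LipschitzOnWith.intervalIntegrable_mul_deriv {C : NNReal} {c f : ℝ → ℂ} {u v : ℝ}
    (huv : u ≤ v) (hc : LipschitzOnWith C c (Icc u v)) (hf : ContinuousOn f (Icc u v)) :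
    IntervalIntegrable (fun t => f t * deriv c t) volume u v := by
  obtain ⟨M, hM⟩ := isCompact_Icc.exists_bound_of_continuousOn hf
  rw [intervalIntegrable_iff_integrableOn_Ioo_of_le huv]
  refine IntegrableOn.of_bound (C := M * C) (by simp) ?_ ?_
  · exact ((hf.mono Ioo_subset_Icc_self).aestronglyMeasurable measurableSet_Ioo).mul
      (aestronglyMeasurable_deriv _ _)
  · filter_upwards [ae_restrict_mem measurableSet_Ioo] with t ht
    rw [norm_mul]
    exact mul_le_mul (hM t (Ioo_subset_Icc_self ht)) (hc.norm_deriv_le_of_mem_Ioo ht)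
      (norm_nonneg _) ((norm_nonneg _).trans (hM t (Ioo_subset_Icc_self ht)))

/-- The fundamental theorem of calculus along a Lipschitz curve, for a function which is locally a
primitive of `f`. -/
theorem LipschitzOnWith.integral_mul_deriv_eq_sub {C : NNReal} {c g : ℝ → ℂ} {f : ℂ → ℂ} {u v : ℝ}
    (huv : u ≤ v) (hc : LipschitzOnWith C c (Icc u v))
    (hf : ContinuousOn (fun t => f (c t)) (Icc u v))
    (hg : ∀ t ∈ Icc u v, ∃ F : ℂ → ℂ, (∀ᶠ z in 𝓝 (c t), HasDerivAt F (f z) z) ∧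
      ∀ᶠ t' in 𝓝[Icc u v] t, g t' = F (c t')) :
    ∫ t in u..v, f (c t) * deriv c t = g v - g u := by
  set J : ℝ → ℂ := fun x => ∫ t in u..x, f (c t) * deriv c t
  have hint := hc.intervalIntegrable_mul_deriv huv hf
  obtain ⟨M, hM⟩ := isCompact_Icc.exists_bound_of_continuousOn hf
  have hgL : LocallyLipschitzOn (Icc u v) g := by
    intro t ht
    obtain ⟨F, hF, hgF⟩ := hg t ht
    obtain ⟨K, s, hs, hK⟩ : ∃ K, ∃ s ∈ 𝓝 (c t), LipschitzOnWith K F s := by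
      have hdiff : ∀ᶠ z in 𝓝 (c t), DifferentiableAt ℂ F z := hF.mono fun z hz => hz.differentiableAt
      have han : AnalyticAt ℂ F (c t) := Complex.analyticAt_iff_eventually_differentiableAt.mpr hdiff
      exact (han.contDiffAt (n := 1)).exists_lipschitzOnWith
    have hcs : ∀ᶠ t' in 𝓝[Icc u v] t, c t' ∈ s := (hc.continuousOn t ht) hs
    refine ⟨K * C, {t' | t' ∈ Icc u v ∧ c t' ∈ s ∧ g t' = F (c t')}, ?_, ?_⟩
    · filter_upwards [hcs, hgF, self_mem_nhdsWithin] with t' h1 h2 h3 using ⟨h3, h1, h2⟩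
    · rintro x ⟨hx, hx', hxe⟩ y ⟨hy, hy', hye⟩
      rw [hxe, hye, ENNReal.coe_mul, mul_assoc]
      exact (hK hx' hy').trans (by gcongr; exact hc hx hy)
  obtain ⟨K, hK⟩ := hgL.exists_lipschitzOnWith_of_compact isCompact_Icc
  have hJL : LipschitzOnWith (M * C).toNNReal J (Icc u v) := by
    refine LipschitzOnWith.of_dist_le_mul fun x hx y hy => ?_
    have hsub : ∀ z ∈ Icc u v, IntervalIntegrable (fun t => f (c t) * deriv c t) volume u z := by
      intro z hz
      refine hint.mono_set ?_
      rw [uIcc_of_le huv, uIcc_of_le hz.1]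
      exact Icc_subset_Icc_right hz.2
    rw [dist_eq_norm, intervalIntegral.integral_interval_sub_left (hsub x hx) (hsub y hy),
      Real.dist_eq]
    have h0 : 0 ≤ M * C := by
      have := (norm_nonneg _).trans (hM u (left_mem_Icc.mpr huv)); positivity
    rw [Real.coe_toNNReal _ h0]
    refine intervalIntegral.norm_integral_le_of_norm_le_const_ae ?_
    have hne : ∀ᵐ t : ℝ, t ≠ v := by simp [ae_iff]
    have hne' : ∀ᵐ t : ℝ, t ≠ u := by simp [ae_iff]
    filter_upwards [hne, hne'] with t h1 h2 h3
    have ht : t ∈ Icc u v := by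
      have := uIoc_subset_uIcc h3
      exact (uIcc_subset_Icc hy hx) this
    have ht' : t ∈ Ioo u v := ⟨lt_of_le_of_ne ht.1 (Ne.symm h2), lt_of_le_of_ne ht.2 h1⟩
    rw [norm_mul]
    exact mul_le_mul (hM t ht) (hc.norm_deriv_le_of_mem_Ioo ht')
      (norm_nonneg _) ((norm_nonneg _).trans (hM t ht))
  -- The curve is differentiable only almost everywhere, so a vanishing derivative of g - J is known
  -- only almost everywhere. Absolute continuity, from the Lipschitz bounds on both, is what makes g
  -- - J constant.
  have hAC : AbsolutelyContinuousOnInterval (fun x => g x - J x) u v := by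
    rw [← uIcc_of_le huv] at hK hJL
    exact hK.absolutelyContinuousOnInterval.sub hJL.absolutelyContinuousOnInterval
  have hzero : ∀ᵐ x : ℝ, x ∈ uIcc u v → HasDerivAt (fun x => g x - J x) 0 x := by
    have hne : ∀ᵐ t : ℝ, t ≠ v := by simp [ae_iff]
    have hne' : ∀ᵐ t : ℝ, t ≠ u := by simp [ae_iff]
    filter_upwards [hc.ae_differentiableWithinAt_of_mem_real, hint.ae_hasDerivAt_integral, hne,
      hne'] with x h1 h2 h3 h4 hx
    have hx' : x ∈ Icc u v := by rwa [uIcc_of_le huv] at hx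
    have hxo : x ∈ Ioo u v := ⟨lt_of_le_of_ne hx'.1 (Ne.symm h4), lt_of_le_of_ne hx'.2 h3⟩
    have hN : Icc u v ∈ 𝓝 x := Icc_mem_nhds hxo.1 hxo.2
    have hcd : HasDerivAt c (deriv c x) x := ((h1 hx').differentiableAt hN).hasDerivAt
    obtain ⟨F, hF, hgF⟩ := hg x hx'
    rw [nhdsWithin_eq_nhds.mpr hN] at hgF
    have hgd : HasDerivAt g (f (c x) * deriv c x) x :=
      (hF.self_of_nhds.comp x hcd).congr_of_eventuallyEq hgF
    have h5 := hgd.sub (h2 hx u left_mem_uIcc)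
    rw [sub_self] at h5
    exact h5
  obtain ⟨K', hK'⟩ := hAC.const_of_ae_hasDerivAt_zero hzero
  have e1 := hK' u left_mem_uIcc
  have e2 := hK' v right_mem_uIcc
  have e3 : J u = 0 := by simp [J]
  simp only [e3, sub_zero] at e1
  rw [← e1] at e2
  change J v = _
  linear_combination -e2

end LipschitzCurve

/-! ### Primitives along a continuous map of a rectangle -/

section PrimitiveAlong

/-- `G` is locally, on `S`, the composition of `H` with a primitive of `f`. -/
def IsPrimitiveAlong (f : ℂ → ℂ) (H : ℝ × ℝ → ℂ) (S : Set (ℝ × ℝ)) (G : ℝ × ℝ → ℂ) : Prop :=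
  ∀ p ∈ S, ∃ F : ℂ → ℂ, (∀ᶠ z in 𝓝 (H p), HasDerivAt F (f z) z) ∧ ∀ᶠ q in 𝓝[S] p, G q = F (H q)

/-- The intersection of the two balls is convex, so two primitives of the same function differ there
by a constant. -/
theorem sub_eq_sub_of_hasDerivAt_balls {f F₁ F₂ : ℂ → ℂ} {a b : ℂ} {δ : ℝ}
    (h₁ : ∀ z ∈ Metric.ball a δ, HasDerivAt F₁ (f z) z)
    (h₂ : ∀ z ∈ Metric.ball b δ, HasDerivAt F₂ (f z) z) {z w : ℂ}
    (hza : z ∈ Metric.ball a δ) (hzb : z ∈ Metric.ball b δ)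
    (hwa : w ∈ Metric.ball a δ) (hwb : w ∈ Metric.ball b δ) :
    F₁ w - F₁ z = F₂ w - F₂ z := by
  have hconv : Convex ℝ (Metric.ball a δ ∩ Metric.ball b δ) :=
    (convex_ball a δ).inter (convex_ball b δ)
  have hder : ∀ x ∈ Metric.ball a δ ∩ Metric.ball b δ,
      HasDerivWithinAt (fun x => F₁ x - F₂ x) 0 (Metric.ball a δ ∩ Metric.ball b δ) x := by
    intro x hx
    have := ((h₁ x hx.1).sub (h₂ x hx.2)).hasDerivWithinAt (s := Metric.ball a δ ∩ Metric.ball b δ)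
    rwa [sub_self] at this
  have := hconv.norm_image_sub_le_of_norm_hasDerivWithin_le (C := 0) hder (by simp)
    ⟨hza, hzb⟩ ⟨hwa, hwb⟩
  rw [zero_mul] at this
  have h3 := norm_le_zero_iff.mp this
  linear_combination h3

/-- Monodromy made explicit: G(q) adds up increments of local primitives along the segment from 0 to
q, cut into N equal steps. Each step moves H by less than δ/3, so the points compared in two
neighbouring chains stay within 2δ/3 of a common centre, inside its ball of radius δ. -/
theorem exists_primitive_along_of_uniformContinuous {f : ℂ → ℂ} {H : ℝ × ℝ → ℂ}
    (hH : UniformContinuous H) {δ : ℝ} (hδ : 0 < δ)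
    (hf : ∀ p, DifferentiableOn ℂ f (Metric.ball (H p) δ)) (R : ℝ) :
    ∃ G : ℝ × ℝ → ℂ, IsPrimitiveAlong f H (Metric.ball 0 R) G := by
  choose F hF using fun p => (hf p).isExactOn_ball
  obtain ⟨η, hη, hH⟩ := Metric.uniformContinuous_iff.mp hH (δ / 3) (by positivity)
  obtain ⟨N, hN⟩ := exists_nat_gt (R / η)
  rcases le_or_gt R 0 with hR | hR
  · exact ⟨0, by simp [IsPrimitiveAlong, Metric.ball_eq_empty.mpr hR]⟩
  have hN0 : (0 : ℝ) < N := (div_pos hR hη).trans hN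
  set c : ℕ → ℝ × ℝ → ℝ × ℝ := fun n q => ((n : ℝ) / N) • q
  have hstep : ∀ q ∈ Metric.ball (0 : ℝ × ℝ) R, ∀ n, dist (H (c (n + 1) q)) (H (c n q)) < δ / 3 := by
    intro q hq n
    apply hH
    rw [dist_eq_norm, ← sub_smul, norm_smul]
    have : ((n + 1 : ℕ) : ℝ) / N - n / N = 1 / N := by push_cast; ring
    rw [this, Real.norm_of_nonneg (by positivity)]
    have hq' : ‖q‖ < R := by simpa using hq
    rw [div_lt_iff₀ hη] at hN
    rw [one_div, inv_mul_lt_iff₀ hN0]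
    linarith
  set T : ℕ → ℝ × ℝ → ℂ := fun n q => F (c n q) (H (c (n + 1) q)) - F (c n q) (H (c n q))
  refine ⟨fun q => ∑ n ∈ Finset.range N, T n q, fun q hq => ?_⟩
  refine ⟨fun z => F q z + (∑ n ∈ Finset.range N, T n q - F q (H q)), ?_, ?_⟩
  · filter_upwards [Metric.ball_mem_nhds (H q) hδ] with z hz
    exact (hF q z hz).add_const _
  · have hev : ∀ᶠ q' in 𝓝[Metric.ball 0 R] q, dist q' q < η :=
      nhdsWithin_le_nhds (Metric.ball_mem_nhds q hη)
    filter_upwards [hev, self_mem_nhdsWithin] with q' hq' hq'R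
    have hcl : ∀ n ≤ N, dist (H (c n q')) (H (c n q)) < δ / 3 := by
      intro n hn
      apply hH
      rw [dist_eq_norm, ← smul_sub, norm_smul, Real.norm_of_nonneg (by positivity)]
      have h1 : (n : ℝ) / N ≤ 1 := by
        rw [div_le_one hN0]; exact_mod_cast hn
      rw [dist_eq_norm] at hq'
      calc (n : ℝ) / N * ‖q' - q‖ ≤ 1 * ‖q' - q‖ := by gcongr
        _ < η := by rwa [one_mul]
    -- Differences of corresponding terms of the two chains telescope through `A`, leaving only the
    -- increment of the last local primitive.
    set A : ℕ → ℂ := fun n => F (c n q) (H (c n q')) - F (c n q) (H (c n q))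
    have hT : ∀ n < N, T n q' - T n q = A (n + 1) - A n := by
      intro n hn
      have d1 := hstep q hq n
      have d2 := hstep q' hq'R n
      have d3 := hcl n hn.le
      have d4 := hcl (n + 1) hn
      have e1 : T n q' = F (c n q) (H (c (n + 1) q')) - F (c n q) (H (c n q')) := by
        refine sub_eq_sub_of_hasDerivAt_balls (hF _) (hF _) (by simpa using hδ) ?_ ?_ ?_ <;>
          rw [Metric.mem_ball]
        · linarith
        · linarith
        · linarith [dist_triangle (H (c (n + 1) q')) (H (c (n + 1) q)) (H (c n q))]
      have e2 : A (n + 1) = F (c n q) (H (c (n + 1) q')) - F (c n q) (H (c (n + 1) q)) := by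
        refine sub_eq_sub_of_hasDerivAt_balls (hF _) (hF _) (by simpa using hδ) ?_ ?_ ?_ <;>
          rw [Metric.mem_ball]
        · linarith
        · linarith
        · linarith [dist_triangle (H (c (n + 1) q')) (H (c (n + 1) q)) (H (c n q))]
      rw [e1, e2]
      simp only [T, A]
      ring
    have hsum : ∑ n ∈ Finset.range N, T n q' - ∑ n ∈ Finset.range N, T n q = A N - A 0 := by
      rw [← Finset.sum_sub_distrib, ← Finset.sum_range_sub]
      exact Finset.sum_congr rfl fun n hn => hT n (Finset.mem_range.mp hn)
    have hA0 : A 0 = 0 := by simp [A, c]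
    have hcN : ∀ p : ℝ × ℝ, c N p = p := by intro p; simp [c, hN0.ne']
    have hAN : A N = F q (H q') - F q (H q) := by simp only [A, hcN]
    rw [hA0, hAN] at hsum
    linear_combination hsum

/-- Precomposition with the retraction onto the rectangle extends H to a uniformly continuous map of
the plane. Compactness of the image gives one radius δ for all the discs in U. -/
theorem exists_primitive_along {f : ℂ → ℂ} {H : ℝ × ℝ → ℂ} {t₁ t₂ : ℝ} (ht : t₁ ≤ t₂)
    (hH : ContinuousOn H (Icc t₁ t₂ ×ˢ Icc 0 1)) {U : Set ℂ} (hU : IsOpen U)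
    (hf : DifferentiableOn ℂ f U) (hHU : MapsTo H (Icc t₁ t₂ ×ˢ Icc 0 1) U) :
    ∃ G, IsPrimitiveAlong f H (Icc t₁ t₂ ×ˢ Icc 0 1) G := by
  set Q := Icc t₁ t₂ ×ˢ Icc (0 : ℝ) 1
  set pr : ℝ × ℝ → ℝ × ℝ :=
    fun q => ((projIcc t₁ t₂ ht q.1 : ℝ), (projIcc (0 : ℝ) 1 zero_le_one q.2 : ℝ)) with hpr
  have hprl : LipschitzWith 1 pr := by
    have h1 : LipschitzWith 1 fun q : ℝ × ℝ => (projIcc t₁ t₂ ht q.1 : ℝ) := by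
      simpa [Function.comp_def] using LipschitzWith.subtype_val _ |>.comp ((LipschitzWith.projIcc ht).comp LipschitzWith.prod_fst)
    have h2 : LipschitzWith 1 fun q : ℝ × ℝ => (projIcc (0 : ℝ) 1 zero_le_one q.2 : ℝ) := by
      simpa [Function.comp_def] using
        LipschitzWith.subtype_val _ |>.comp ((LipschitzWith.projIcc zero_le_one).comp LipschitzWith.prod_snd)
    simpa using h1.prodMk h2
  have hprm : ∀ q, pr q ∈ Q := fun q =>
    ⟨(projIcc t₁ t₂ ht q.1).2, (projIcc (0 : ℝ) 1 zero_le_one q.2).2⟩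
  have hpre : ∀ q ∈ Q, pr q = q := by
    rintro ⟨t, s⟩ ⟨h1, h2⟩
    simp [hpr, projIcc_of_mem ht h1, projIcc_of_mem zero_le_one h2]
  have hQ : IsCompact Q := isCompact_Icc.prod isCompact_Icc
  have huc : UniformContinuous (H ∘ pr) := by
    have h1 := hQ.uniformContinuousOn_of_continuous hH
    rw [Metric.uniformContinuousOn_iff] at h1
    rw [Metric.uniformContinuous_iff]
    intro ε hε
    obtain ⟨δ, hδ, h⟩ := h1 ε hε
    refine ⟨δ, hδ, fun x y hxy => h _ (hprm x) _ (hprm y) ?_⟩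
    have := hprl.dist_le_mul x y
    simp only [NNReal.coe_one, one_mul] at this
    exact this.trans_lt hxy
  obtain ⟨δ, hδ, hδU⟩ := (hQ.image_of_continuousOn hH).exists_thickening_subset_open hU
    hHU.image_subset
  obtain ⟨R, hR⟩ := hQ.isBounded.subset_ball 0
  obtain ⟨G, hG⟩ := exists_primitive_along_of_uniformContinuous huc hδ (f := f) (fun p =>
    hf.mono ((Metric.ball_subset_thickening (mem_image_of_mem H (hprm p)) δ).trans hδU)) R
  refine ⟨G, fun p hp => ?_⟩
  obtain ⟨F, hF, hGF⟩ := hG p (hR hp)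
  refine ⟨F, by simpa [hpre p hp] using hF, ?_⟩
  filter_upwards [nhdsWithin_mono p hR hGF, self_mem_nhdsWithin] with q hq hqQ
  simpa [hpre q hqQ] using hq

end PrimitiveAlong

/-! ### Crossing a small circle -/

section LevelSet

/-- Applied to a locally constant property and to its negation, this cuts a closed set into two
closed pieces, as the separation argument requires. -/
theorem isClosed_sep_of_eventually {X : Type*} [TopologicalSpace X] {K : Set X} (hK : IsClosed K)
    {P : X → Prop} (hP : ∀ q ∈ K, ∀ᶠ q' in 𝓝[K] q, P q' → P q) : IsClosed {q ∈ K | P q} := by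
  rw [← closure_subset_iff_isClosed]
  intro x hx
  have hxK : x ∈ K := hK.closure_subset (closure_mono (sep_subset K P) hx)
  have hne : (𝓝[{q ∈ K | P q}] x).NeBot := mem_closure_iff_nhdsWithin_neBot.mp hx
  have h1 := nhdsWithin_mono x (sep_subset K P) (hP x hxK)
  obtain ⟨y, hy, hyP⟩ := (Filter.Eventually.and h1 self_mem_nhdsWithin).exists
  exact ⟨hxK, hy hyP.2⟩

/-- If the curves `H(·, s)` cross the circle of radius `ρ`, then two crossing points, on the first
and on the last curve, are joined by an arc of the circle on which the primitive along `H` is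
controlled. -/
theorem exists_norm_eq_and_norm_sub_le {f : ℂ → ℂ} {H G : ℝ × ℝ → ℂ} {t₁ t₂ ρ M : ℝ} {U : Set ℂ}
    (ht₁ : 0 < t₁) (h₁ : t₁ < ρ) (h₂ : ρ < t₂) (hH : ContinuousOn H (Icc t₁ t₂ ×ˢ Icc 0 1))
    (hslit : ∀ q ∈ Icc t₁ t₂ ×ˢ Icc (0 : ℝ) 1, H q ∈ Complex.slitPlane)
    (hstart : ∀ t ∈ Icc t₁ t₂, H (t, 0) = t)
    (hl : ∀ s ∈ Icc (0 : ℝ) 1, ‖H (t₁, s)‖ < ρ) (hr : ∀ s ∈ Icc (0 : ℝ) 1, ρ < ‖H (t₂, s)‖)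
    (hU : IsOpen U) (hf : DifferentiableOn ℂ f U) (hM : ∀ z ∈ U, ‖f z‖ ≤ M)
    (hKU : ∀ q ∈ Icc t₁ t₂ ×ˢ Icc (0 : ℝ) 1, ‖H q‖ = ρ → H q ∈ U)
    (hG : IsPrimitiveAlong f H (Icc t₁ t₂ ×ˢ Icc 0 1) G) :
    ∃ t ∈ Icc t₁ t₂, ‖H (t, 1)‖ = ρ ∧ ‖G (t, 1) - G (ρ, 0)‖ ≤ Real.pi * ρ * M := by
  set Q := Icc t₁ t₂ ×ˢ Icc (0 : ℝ) 1
  have hρ : 0 < ρ := ht₁.trans h₁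
  have hQ : IsCompact Q := isCompact_Icc.prod isCompact_Icc
  set arc : ℝ → ℂ := fun θ => ρ * Complex.exp (θ * Complex.I)
  have harcd : ∀ θ : ℝ, HasDerivAt arc (arc θ * Complex.I) θ := by
    intro θ
    have h1 : HasDerivAt (fun θ : ℝ => (θ : ℂ) * Complex.I) Complex.I θ := by
      simpa using (Complex.ofRealCLM.hasDerivAt (x := θ)).mul_const Complex.I
    have := (h1.cexp).const_mul (ρ : ℂ)
    simpa [arc, mul_assoc] using this
  have harcc : Continuous arc := continuous_iff_continuousAt.mpr fun θ => (harcd θ).continuousAt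
  have harcn : ∀ θ, ‖arc θ‖ = ρ := by
    intro θ; simp [arc, Complex.norm_exp_ofReal_mul_I, abs_of_pos hρ]
  set K : Set (ℝ × ℝ) := {q ∈ Q | ‖H q‖ = ρ}
  have hKQ : K ⊆ Q := sep_subset _ _
  have hKc : IsClosed K := by
    have : K = Q ∩ (fun q => ‖H q‖) ⁻¹' {ρ} := rfl
    rw [this]
    exact hH.norm.preimage_isClosed_of_isClosed hQ.isClosed isClosed_singleton
  have harcarg : ∀ q ∈ K, arc (H q).arg = H q := by
    intro q hq
    have := Complex.norm_mul_exp_arg_mul_I (H q)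
    rwa [hq.2] at this
  set w : ℝ → ℂ := fun θ => f (arc θ) * (arc θ * Complex.I)
  have hwc : ∀ x y : ℝ, (∀ θ ∈ uIcc x y, arc θ ∈ U) → IntervalIntegrable w volume x y := by
    intro x y hxy
    apply ContinuousOn.intervalIntegrable
    exact (hf.continuousOn.comp harcc.continuousOn hxy).mul
      (harcc.mul continuous_const).continuousOn
  -- `P` says that the arc from angle 0 to H q stays in U and that integrating f over it accounts
  -- for the change of G. It is locally constant on the crossing set, because arg is continuous on
  -- the slit plane and both sides change by the same local primitive.
  set P : ℝ × ℝ → Prop := fun q => (∀ θ ∈ uIcc 0 (H q).arg, arc θ ∈ U) ∧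
    G q - G (ρ, 0) = ∫ θ in 0..(H q).arg, w θ
  have step : ∀ q q' : ℝ × ℝ, (∀ θ ∈ uIcc (H q).arg (H q').arg, arc θ ∈ U) →
      G q' - G q = ∫ θ in (H q).arg..(H q').arg, w θ → P q → P q' := by
    rintro q q' harc hGq ⟨hP1, hP2⟩
    refine ⟨fun θ hθ => ?_, ?_⟩
    · rcases uIcc_subset_uIcc_union_uIcc (b := (H q).arg) hθ with h | h
      · exact hP1 θ h
      · exact harc θ h
    · rw [← intervalIntegral.integral_add_adjacent_intervals (hwc _ _ hP1) (hwc _ _ harc), ← hP2,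
        ← hGq]
      ring
  have hloc : ∀ q ∈ K, ∀ᶠ q' in 𝓝[K] q, (P q' ↔ P q) := by
    intro q hq
    obtain ⟨F, hF, hGF⟩ := hG q hq.1
    have hV : ∀ᶠ z in 𝓝 (H q), HasDerivAt F (f z) z ∧ z ∈ U :=
      hF.and (hU.mem_nhds (hKU q hq.1 hq.2))
    have hV' : ∀ᶠ θ in 𝓝 (H q).arg, HasDerivAt F (f (arc θ)) (arc θ) ∧ arc θ ∈ U := by
      have := harcc.continuousAt (x := (H q).arg)
      rw [ContinuousAt, harcarg q hq] at this
      exact this hV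
    obtain ⟨ε, hε, hball⟩ := Metric.eventually_nhds_iff_ball.mp hV'
    have hargc : ContinuousWithinAt (fun q => (H q).arg) K q :=
      ((Complex.continuousAt_arg (hslit q hq.1)).comp_continuousWithinAt (hH q hq.1)).mono hKQ
    have hev : ∀ᶠ q' in 𝓝[K] q, (H q').arg ∈ Metric.ball (H q).arg ε :=
      hargc (Metric.ball_mem_nhds _ hε)
    filter_upwards [hev, nhdsWithin_mono q hKQ hGF, self_mem_nhdsWithin] with q' h1 h2 hq'K
    have hsub : uIcc (H q).arg (H q').arg ⊆ Metric.ball (H q).arg ε :=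
      (convex_ball (H q).arg ε).ordConnected.uIcc_subset (Metric.mem_ball_self hε) h1
    have harcU : ∀ θ ∈ uIcc (H q).arg (H q').arg, arc θ ∈ U := fun θ hθ => (hball θ (hsub hθ)).2
    have hint : G q' - G q = ∫ θ in (H q).arg..(H q').arg, w θ := by
      have := intervalIntegral.integral_eq_sub_of_hasDerivAt (f := fun θ => F (arc θ))
        (fun θ hθ => (hball θ (hsub hθ)).1.comp θ (harcd θ)) (hwc _ _ harcU)
      rw [this, h2, hGF.self_of_nhdsWithin hq.1, harcarg q hq, harcarg q' hq'K]
    refine ⟨step q' q (by rwa [uIcc_comm]) ?_, step q q' harcU hint⟩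
    rw [intervalIntegral.integral_symm, ← hint]
    ring
  have hK₀ : IsClosed {q ∈ K | P q} :=
    isClosed_sep_of_eventually hKc fun q hq => (hloc q hq).mono fun _ h => h.mp
  have hK₁ : IsClosed {q ∈ K | ¬ P q} :=
    isClosed_sep_of_eventually hKc fun q hq => (hloc q hq).mono fun _ h hn hP => hn (h.mpr hP)
  -- A top crossing with `P` would satisfy the asserted bound, the arc having length at most πρ. If
  -- there is none, `P` separates the bottom crossing, which occurs only at t = ρ, from all top
  -- crossings.
  by_contra! hcon
  refine not_separated_zero_set (h := fun q => ‖H q‖ - ρ) (h₁.trans h₂).le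
    (hH.norm.sub continuousOn_const) (fun s hs => by have := hl s hs; linarith)
    (fun s hs => by have := hr s hs; linarith) hK₀ hK₁ ?_ ?_ ?_ ?_
  · rw [Set.disjoint_left]
    exact fun q h1 h2 => h2.2 h1.2
  · intro q hq h0
    have hqK : q ∈ K := ⟨hq, by linarith⟩
    by_cases h : P q
    · exact Or.inl ⟨hqK, h⟩
    · exact Or.inr ⟨hqK, h⟩
  · intro t ht h0
    have htQ : (t, (0 : ℝ)) ∈ Q := ⟨ht, by simp⟩
    have ht0 : 0 < t := ht₁.trans_le ht.1
    have hn : ‖H (t, 0)‖ = t := by rw [hstart t ht]; simp [abs_of_pos ht0]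
    have htρ : t = ρ := by linarith
    have harg : (H (t, 0)).arg = 0 := by
      rw [hstart t ht]; exact Complex.arg_ofReal_of_nonneg ht0.le
    have hK : (t, (0 : ℝ)) ∈ K := ⟨htQ, by linarith⟩
    refine ⟨hK, fun θ hθ => ?_, ?_⟩
    · rw [harg, uIcc_self, mem_singleton_iff] at hθ
      rw [hθ, ← harg, harcarg _ hK]
      exact hKU _ htQ (by linarith)
    · rw [harg, intervalIntegral.integral_same, htρ, sub_self]
  · intro t ht h0
    have htQ : (t, (1 : ℝ)) ∈ Q := ⟨ht, by simp⟩
    have hn : ‖H (t, 1)‖ = ρ := by linarith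
    refine ⟨⟨htQ, hn⟩, fun hP => ?_⟩
    have hlt := hcon t ht hn
    rw [hP.2] at hlt
    have hM0 : 0 ≤ M := (norm_nonneg _).trans (hM _ (hKU _ htQ hn))
    have hle : ‖∫ θ in 0..(H (t, 1)).arg, w θ‖ ≤ M * ρ * |(H (t, 1)).arg - 0| := by
      apply intervalIntegral.norm_integral_le_of_norm_le_const
      intro θ hθ
      simp only [w, norm_mul, harcn, Complex.norm_I, mul_one]
      gcongr
      exact hM _ (hP.1 θ (uIoc_subset_uIcc hθ))
    have harg : |(H (t, 1)).arg - 0| ≤ Real.pi := by rw [sub_zero]; exact Complex.abs_arg_le_pi _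
    have : M * ρ * |(H (t, 1)).arg - 0| ≤ M * ρ * Real.pi := by gcongr
    linarith [hle.trans this]

end LevelSet

/-! ### The interval and its end filters -/

section Ends

theorem isOpen_openIv (a b : EReal) : IsOpen (openIv a b) :=
  (isOpen_Ioi.preimage continuous_coe_real_ereal).inter
    (isOpen_Iio.preimage continuous_coe_real_ereal)

theorem ordConnected_openIv (a b : EReal) : (openIv a b).OrdConnected :=
  ⟨fun _ hx _ hy _ hz => ⟨hx.1.trans_le (EReal.coe_le_coe_iff.mpr hz.1),
    (EReal.coe_le_coe_iff.mpr hz.2).trans_lt hy.2⟩⟩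

theorem Icc_subset_openIv {a b : EReal} {u v : ℝ} (hu : u ∈ openIv a b) (hv : v ∈ openIv a b) :
    Icc u v ⊆ openIv a b :=
  (ordConnected_openIv a b).out hu hv

theorem openIv_nonempty {a b : EReal} (hab : a < b) : (openIv a b).Nonempty := by
  obtain ⟨q, h1, h2⟩ := EReal.lt_iff_exists_real_btwn.mp hab
  exact ⟨q, h1, h2⟩

theorem leftEnd_coe (c : ℝ) : leftEnd (c : EReal) = 𝓝[>] c := by
  rw [leftEnd, nhdsWithin, comap_inf, comap_principal, nhdsWithin,
    EReal.isEmbedding_coe.nhds_eq_comap]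
  congr 2
  ext x; simp

theorem rightEnd_coe (c : ℝ) : rightEnd (c : EReal) = 𝓝[<] c := by
  rw [rightEnd, nhdsWithin, comap_inf, comap_principal, nhdsWithin,
    EReal.isEmbedding_coe.nhds_eq_comap]
  congr 2
  ext x; simp

theorem leftEnd_bot : leftEnd ⊥ = atBot := by
  have : (Ioi (⊥ : EReal)) = {⊥}ᶜ := by ext x; simp [bot_lt_iff_ne_bot]
  rw [leftEnd, this, EReal.nhdsWithin_bot, comap_map EReal.coe_injective]

theorem rightEnd_top : rightEnd ⊤ = atTop := by
  have : (Iio (⊤ : EReal)) = {⊤}ᶜ := by ext x; simp [lt_top_iff_ne_top]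
  rw [rightEnd, this, EReal.nhdsWithin_top, comap_map EReal.coe_injective]

instance (a : EReal) : (leftEnd a).IsCountablyGenerated := by unfold leftEnd; infer_instance

instance (b : EReal) : (rightEnd b).IsCountablyGenerated := by unfold rightEnd; infer_instance

theorem leftEnd_neBot {a b : EReal} (hab : a < b) : (leftEnd a).NeBot := by
  induction a with
  | bot => rw [leftEnd_bot]; infer_instance
  | coe c => rw [leftEnd_coe]; infer_instance
  | top => exact absurd hab not_top_lt

theorem rightEnd_neBot {a b : EReal} (hab : a < b) : (rightEnd b).NeBot := by
  induction b with
  | bot => exact absurd hab not_lt_bot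
  | coe c => rw [rightEnd_coe]; infer_instance
  | top => rw [rightEnd_top]; infer_instance

theorem eventually_leftEnd_lt {a b : EReal} {m : ℝ} (hm : m ∈ openIv a b) :
    ∀ᶠ t in leftEnd a, t ∈ openIv a b ∧ t < m := by
  have h1 : ∀ᶠ x in 𝓝[>] a, a < x ∧ x < m :=
    (eventually_mem_nhdsWithin (a := a) (s := Ioi a)).and
      (nhdsWithin_le_nhds (Iio_mem_nhds hm.1))
  filter_upwards [tendsto_comap.eventually h1] with t ht
  exact ⟨⟨ht.1, ht.2.trans hm.2⟩, EReal.coe_lt_coe_iff.mp ht.2⟩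

theorem eventually_rightEnd_gt {a b : EReal} {m : ℝ} (hm : m ∈ openIv a b) :
    ∀ᶠ t in rightEnd b, t ∈ openIv a b ∧ m < t := by
  have h1 : ∀ᶠ x in 𝓝[<] b, x < b ∧ (m : EReal) < x :=
    (eventually_mem_nhdsWithin (a := b) (s := Iio b)).and
      (nhdsWithin_le_nhds (Ioi_mem_nhds hm.2))
  filter_upwards [tendsto_comap.eventually h1] with t ht
  exact ⟨⟨hm.1.trans ht.2, ht.1⟩, EReal.coe_lt_coe_iff.mp ht.2⟩

end Ends

/-! ### Small increments near a finite end -/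

section EndIncrements

theorem IsPrimitiveAlong.mono {f : ℂ → ℂ} {H G : ℝ × ℝ → ℂ} {S T : Set (ℝ × ℝ)}
    (hG : IsPrimitiveAlong f H T G) (h : S ⊆ T) : IsPrimitiveAlong f H S G := by
  intro p hp
  obtain ⟨F, hF, hGF⟩ := hG p (h hp)
  exact ⟨F, hF, nhdsWithin_mono p h hGF⟩

/-- With σ = ±1, the substitution z = c + σw moves either finite end to 0 with the interval on its
positive side. The factor σ in front of f is dz/dw. -/
theorem IsPrimitiveAlong.comp_affine {f : ℂ → ℂ} {H G : ℝ × ℝ → ℂ} {S S' : Set (ℝ × ℝ)}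
    (hG : IsPrimitiveAlong f H S G) (c : ℝ) {σ : ℝ} (hσ : σ * σ = 1)
    (hS : MapsTo (fun q : ℝ × ℝ => (c + σ * q.1, q.2)) S' S) :
    IsPrimitiveAlong (fun w => σ * f (c + σ * w))
      (fun q => σ * (H (c + σ * q.1, q.2) - c)) S' (fun q => G (c + σ * q.1, q.2)) := by
  intro p hp
  obtain ⟨F, hF, hGF⟩ := hG _ (hS hp)
  have hσ' : (σ : ℂ) * σ = 1 := by exact_mod_cast hσ
  have hinv : ∀ z : ℂ, (c : ℂ) + σ * (σ * (z - c)) = z := by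
    intro z; linear_combination (z - c) * hσ'
  refine ⟨fun w => F (c + σ * w), ?_, ?_⟩
  · have hcont : ContinuousAt (fun w : ℂ => (c : ℂ) + σ * w) (σ * (H (c + σ * p.1, p.2) - c)) := by
      fun_prop
    rw [ContinuousAt, hinv] at hcont
    filter_upwards [hcont hF] with w hw
    have h1 : HasDerivAt (fun w : ℂ => (c : ℂ) + σ * w) σ w := by
      simpa using ((hasDerivAt_id w).const_mul (σ : ℂ)).const_add (c : ℂ)
    have h2 : HasDerivAt F (f (c + σ * w)) (c + σ * w) := hw
    have := h2.comp w h1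
    rwa [mul_comm] at this
  · have hcont : ContinuousWithinAt (fun q : ℝ × ℝ => (c + σ * q.1, q.2)) S' p := by
      fun_prop
    filter_upwards [hcont.tendsto_nhdsWithin hS hGF] with q hq
    simpa [hinv] using hq.out

/-- Near a finite end, the primitive along the deformation has arbitrarily small increments between
the first and the last curve. -/
theorem exists_small_increment_of_end_bound {f : ℂ → ℂ} {H : ℝ × ℝ → ℂ} {T : ℝ} {U : Set ℂ}
    (hH : ContinuousOn H (Ioc 0 T ×ˢ Icc 0 1))
    (hslit : ∀ q ∈ Ioc 0 T ×ˢ Icc (0 : ℝ) 1, H q ∈ Complex.slitPlane)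
    (hstart : ∀ t ∈ Ioc 0 T, H (t, 0) = t)
    (hlim : ∀ ε > 0, ∃ η > 0, ∀ t ∈ Ioo 0 η, ∀ s ∈ Icc (0 : ℝ) 1, ‖H (t, s)‖ < ε)
    (hU : IsOpen U) (hf : DifferentiableOn ℂ f U) (hHU : MapsTo H (Ioc 0 T ×ˢ Icc 0 1) U)
    {C p ρ₀ : ℝ} (hp : -1 < p) (hρ₀ : 0 < ρ₀)
    (hbound : ∀ q ∈ Ioc 0 T ×ˢ Icc (0 : ℝ) 1, ‖H q‖ < ρ₀ → ‖f (H q)‖ ≤ C * ‖H q‖ ^ p)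
    {ε : ℝ} (hε : 0 < ε) {η : ℝ} (hη : 0 < η) (hηT : η < T) :
    ∃ t₁ ∈ Ioo 0 η, ∀ G, IsPrimitiveAlong f H (Icc t₁ T ×ˢ Icc 0 1) G →
      ∃ α₀ ∈ Ico t₁ η, ∃ α₁ ∈ Ico t₁ η, ‖G (α₁, 1) - G (α₀, 0)‖ < ε := by
  have hη' : η ∈ Ioc 0 T := ⟨hη, hηT.le⟩
  have hsub : Icc η T ×ˢ Icc (0 : ℝ) 1 ⊆ Ioc 0 T ×ˢ Icc (0 : ℝ) 1 :=
    prod_mono (fun t ht => ⟨hη.trans_le ht.1, ht.2⟩) subset_rfl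
  obtain ⟨q₀, hq₀, hmin⟩ := (isCompact_Icc.prod isCompact_Icc).exists_isMinOn
    (s := Icc η T ×ˢ Icc (0 : ℝ) 1) ⟨(η, 0), ⟨le_rfl, hηT.le⟩, by simp⟩ (hH.norm.mono hsub)
  have hm0 : 0 < ‖H q₀‖ := norm_pos_iff.mpr (Complex.slitPlane_ne_zero (hslit _ (hsub hq₀)))
  -- The arc contributes at most πρ · (C + 1)ρ^p, which tends to 0 because p > -1.
  have hsmall : ∀ᶠ ρ : ℝ in 𝓝[>] 0, Real.pi * (C + 1) * ρ ^ (p + 1) < ε := by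
    have h1 : Tendsto (fun ρ : ℝ => Real.pi * (C + 1) * ρ ^ (p + 1)) (𝓝 0)
        (𝓝 (Real.pi * (C + 1) * 0 ^ (p + 1))) :=
      ((Real.continuousAt_rpow_const 0 (p + 1) (Or.inr (by linarith))).tendsto).const_mul _
    rw [Real.zero_rpow (by linarith), mul_zero] at h1
    exact nhdsWithin_le_nhds (h1 (Iio_mem_nhds hε))
  have hlt : ∀ x : ℝ, 0 < x → ∀ᶠ ρ : ℝ in 𝓝[>] 0, ρ < x := fun x hx =>
    nhdsWithin_le_nhds (Iio_mem_nhds hx)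
  obtain ⟨ρ, hρε, hρm, hρρ, hρη, hρ⟩ := (hsmall.and ((hlt _ hm0).and ((hlt _ hρ₀).and
    ((hlt _ hη).and self_mem_nhdsWithin)))).exists
  have hρ : 0 < ρ := hρ
  obtain ⟨δ, hδ, hlimδ⟩ := hlim ρ hρ
  set t₁ := min δ ρ / 2
  have ht₁ : 0 < t₁ := by positivity
  have ht₁δ : t₁ < δ := by have := min_le_left δ ρ; simp only [t₁]; linarith
  have ht₁ρ : t₁ < ρ := by have := min_le_right δ ρ; simp only [t₁]; linarith
  refine ⟨t₁, ⟨ht₁, ht₁ρ.trans hρη⟩, fun G hG => ?_⟩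
  have hsub₁ : Icc t₁ T ×ˢ Icc (0 : ℝ) 1 ⊆ Ioc 0 T ×ˢ Icc (0 : ℝ) 1 :=
    prod_mono (fun t ht => ⟨ht₁.trans_le ht.1, ht.2⟩) subset_rfl
  -- ρ lies below the minimum of ‖H‖ over η ≤ t ≤ T, so every crossing of the circle has parameter
  -- less than η.
  have hTη : ∀ t ∈ Icc t₁ T, ∀ s ∈ Icc (0 : ℝ) 1, ‖H (t, s)‖ ≤ ρ → t < η := by
    intro t ht s hs hn
    by_contra! hcon
    have := hmin (show (t, s) ∈ Icc η T ×ˢ Icc (0 : ℝ) 1 from ⟨⟨hcon, ht.2⟩, hs⟩)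
    simp only [mem_ofPred_eq] at this
    linarith
  -- C + 1 instead of C makes the bound strict, so all crossing points lie in the open set ‖f‖ < M.
  set M := (C + 1) * ρ ^ p
  have hV : IsOpen (U ∩ (fun z => ‖f z‖) ⁻¹' Iio M) :=
    hf.continuousOn.norm.isOpen_inter_preimage hU isOpen_Iio
  obtain ⟨t, ht, htn, htG⟩ := exists_norm_eq_and_norm_sub_le (f := f) (H := H) (G := G) (M := M)
    ht₁ ht₁ρ (hρη.trans hηT) (hH.mono hsub₁) (fun q hq => hslit q (hsub₁ hq))
    (fun t ht => hstart t ⟨ht₁.trans_le ht.1, ht.2⟩) (fun s hs => hlimδ t₁ ⟨ht₁, ht₁δ⟩ s hs)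
    (fun s hs => hρm.trans_le (hmin (show (T, s) ∈ Icc η T ×ˢ Icc (0 : ℝ) 1 from
      ⟨⟨hηT.le, le_rfl⟩, hs⟩))) hV (hf.mono inter_subset_left) (fun z hz => (hz.2.out).le)
    (fun q hq hqn => ⟨hHU (hsub₁ hq), by
      have h1 := hbound q (hsub₁ hq) (by linarith)
      have h2 : 0 < ρ ^ p := Real.rpow_pos_of_pos hρ p
      rw [hqn] at h1
      simp only [mem_preimage, mem_Iio, M]
      linarith⟩) hG
  refine ⟨ρ, ⟨ht₁ρ.le, hρη⟩, t, ⟨ht.1, hTη t ht 1 (by simp) htn.le⟩, htG.trans_lt ?_⟩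
  have : Real.pi * ρ * M = Real.pi * (C + 1) * ρ ^ (p + 1) := by
    rw [Real.rpow_add hρ, Real.rpow_one]; simp only [M]; ring
  rwa [this]

end EndIncrements

/-! ### Moving the integral from the interval to the contour -/

section ContourShift

/-- The resolvent supplies the factor |z|⁻¹: the bound |f||z| ≤ C‖k‖ turns the increment of the
primitive into the transversal integral of ‖k‖|z|⁻¹. -/
theorem norm_sub_le_of_lipschitz_transversal {V : Type*} [NormedAddCommGroup V] {f : ℂ → ℂ}
    {k : ℂ → V} {c g : ℝ → ℂ} {L : NNReal} {C ε : ℝ} (hC : 0 ≤ C)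
    (hc : LipschitzOnWith L c (Icc 0 1)) (hc0 : ∀ s ∈ Icc (0 : ℝ) 1, c s ≠ 0)
    (hk : ContinuousOn (fun s => k (c s)) (Icc 0 1)) (hf : ContinuousOn (fun s => f (c s)) (Icc 0 1))
    (hfk : ∀ s ∈ Icc (0 : ℝ) 1, ‖f (c s)‖ * ‖c s‖ ≤ C * ‖k (c s)‖)
    (hg : ∀ t ∈ Icc (0 : ℝ) 1, ∃ F : ℂ → ℂ, (∀ᶠ z in 𝓝 (c t), HasDerivAt F (f z) z) ∧
      ∀ᶠ t' in 𝓝[Icc 0 1] t, g t' = F (c t'))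
    (hint : ∫ s in Icc (0 : ℝ) 1, ‖k (c s)‖ * ‖deriv c s‖ / ‖c s‖ < ε) :
    ‖g 1 - g 0‖ ≤ C * ε := by
  rw [← hc.integral_mul_deriv_eq_sub zero_le_one hf hg]
  -- Integrability has to be proved: the Bochner integral of a non-integrable function is 0, so
  -- smallness of the integral alone controls nothing.
  have hi : IntegrableOn (fun s => ‖k (c s)‖ * ‖deriv c s‖ / ‖c s‖) (Icc 0 1) := by
    have h1 : ContinuousOn (fun s => ((‖k (c s)‖ / ‖c s‖ : ℝ) : ℂ)) (Icc 0 1) :=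
      Complex.continuous_ofReal.comp_continuousOn
        (hk.norm.div hc.continuousOn.norm fun s hs => norm_ne_zero_iff.mpr (hc0 s hs))
    have h2 := (hc.intervalIntegrable_mul_deriv zero_le_one h1).norm
    rw [intervalIntegrable_iff_integrableOn_Icc_of_le zero_le_one] at h2
    refine h2.congr_fun (fun s _ => ?_) measurableSet_Icc
    simp only [norm_mul, Complex.norm_real, norm_div, norm_norm]
    ring
  have hle : ‖∫ t in (0 : ℝ)..1, f (c t) * deriv c t‖ ≤
      ∫ t in (0 : ℝ)..1, C * (‖k (c t)‖ * ‖deriv c t‖ / ‖c t‖) := by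
    apply intervalIntegral.norm_integral_le_of_norm_le zero_le_one
    · refine ae_of_all _ fun t ht => ?_
      have ht' := Ioc_subset_Icc_self ht
      have hpos : 0 < ‖c t‖ := norm_pos_iff.mpr (hc0 t ht')
      have := hfk t ht'
      rw [norm_mul, mul_div_assoc', le_div_iff₀ hpos]
      calc ‖f (c t)‖ * ‖deriv c t‖ * ‖c t‖ = (‖f (c t)‖ * ‖c t‖) * ‖deriv c t‖ := by ring
        _ ≤ (C * ‖k (c t)‖) * ‖deriv c t‖ := by gcongr
        _ = _ := by ring
    · rw [intervalIntegrable_iff_integrableOn_Icc_of_le zero_le_one]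
      exact hi.const_mul C
  refine hle.trans ?_
  rw [intervalIntegral.integral_const_mul, intervalIntegral.integral_of_le zero_le_one,
    ← integral_Icc_eq_integral_Ioc]
  gcongr

variable {H₁ : Type*} [NormedAddCommGroup H₁] [InnerProductSpace ℂ H₁]
  {a b : EReal} {W U : Set ℂ} {k : ℂ → (H₁ →L[ℂ] H₁)} {γ : ℝ → ℂ} {H : ℝ → ℝ → ℂ} {f : ℂ → ℂ}

theorem IsDeformation.mapsTo (hH : IsDeformation a b W k γ H) (hWU : W ∪ openIvC a b ⊆ U) :
    MapsTo (fun q : ℝ × ℝ => H q.1 q.2) (openIv a b ×ˢ Icc 0 1) U :=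
  fun q hq => hWU (hH.mem q.1 hq.1 q.2 hq.2)

theorem IsDeformation.norm_transversal_increment_le (hH : IsDeformation a b W k γ H)
    (hWU : W ∪ openIvC a b ⊆ U) (hf : DifferentiableOn ℂ f U)
    (hk : ContinuousOn k (W ∪ openIvC a b)) {C : ℝ} (hC : 0 ≤ C)
    (hfk : ∀ z ∈ W ∪ openIvC a b, ‖f z‖ * (1 + ‖z‖) ≤ C * ‖k z‖) {S : Set (ℝ × ℝ)} {G : ℝ × ℝ → ℂ}
    (hG : IsPrimitiveAlong f (fun q => H q.1 q.2) S G) {t ε : ℝ} (ht : t ∈ openIv a b)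
    (htS : {t} ×ˢ Icc 0 1 ⊆ S) (hne : ∀ s ∈ Icc (0 : ℝ) 1, 0 < ‖H t s‖)
    (hs : SmallTransversal k H t ε) : ‖G (t, 1) - G (t, 0)‖ ≤ C * ε := by
  obtain ⟨⟨L, hL⟩, hint⟩ := hs
  have hm : MapsTo (H t) (Icc 0 1) (W ∪ openIvC a b) := fun s hs => hH.mem t ht s hs
  refine norm_sub_le_of_lipschitz_transversal (g := fun s => G (t, s)) hC hL
    (fun s hs => norm_pos_iff.mp (hne s hs)) (hk.comp hL.continuousOn hm)
    (hf.continuousOn.comp hL.continuousOn fun s hs => hWU (hm hs)) (fun s hs => ?_) (fun s hs => ?_)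
    hint
  · refine le_trans ?_ (hfk _ (hm hs))
    gcongr
    linarith
  · obtain ⟨F, hF, hGF⟩ := hG (t, s) (htS ⟨rfl, hs⟩)
    refine ⟨F, hF, ?_⟩
    have hcont : ContinuousWithinAt (fun s' : ℝ => (t, s')) (Icc 0 1) s := by fun_prop
    exact hcont.tendsto_nhdsWithin (fun s' hs' => htS ⟨rfl, hs'⟩) hGF

/-- The bound near the finite end `c`, in the form needed for the contour shift. -/
def EndBoundOn (S : Set ℂ) (k : ℂ → (H₁ →L[ℂ] H₁)) (c : ℝ) : Prop :=
  ∃ C p ρ : ℝ, -1 < p ∧ 0 < ρ ∧ ∀ μ ∈ S, dist μ (c : ℂ) < ρ → ‖k μ‖ ≤ C * ‖μ - c‖ ^ p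

/-- Common form of the increments near a finite end `c` of the interval; `σ = 1` for the left end
and `σ = -1` for the right one. -/
theorem IsDeformation.exists_small_increment_finite (hH : IsDeformation a b W k γ H)
    (hW : ∀ z ∈ W, z.im ≠ 0) (hU : IsOpen U) (hWU : W ∪ openIvC a b ⊆ U)
    (hf : DifferentiableOn ℂ f U) {C : ℝ} (hC : 0 ≤ C)
    (hfk : ∀ z ∈ W ∪ openIvC a b, ‖f z‖ * (1 + ‖z‖) ≤ C * ‖k z‖) {c σ : ℝ} (hσ : σ * σ = 1)
    (hside : ∀ t ∈ openIv a b, 0 < σ * (t - c)) {T : ℝ}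
    (hT : ∀ t ∈ Ioc 0 T, c + σ * t ∈ openIv a b)
    (hlim : ∀ ε > 0, ∃ η > 0, ∀ t ∈ Ioo 0 η, ∀ s ∈ Icc (0 : ℝ) 1, dist (H (c + σ * t) s) c < ε)
    (hend : EndBoundOn (W ∪ openIvC a b) k c) {ε η : ℝ} (hε : 0 < ε) (hη : 0 < η) (hηT : η < T) :
    ∃ t₁ ∈ Ioo 0 η, ∀ (S : Set (ℝ × ℝ)) (G : ℝ × ℝ → ℂ),
      IsPrimitiveAlong f (fun q => H q.1 q.2) S G →
      MapsTo (fun q : ℝ × ℝ => (c + σ * q.1, q.2)) (Icc t₁ T ×ˢ Icc 0 1) S →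
      ∃ α₀ ∈ Ico t₁ η, ∃ α₁ ∈ Ico t₁ η, ‖G (c + σ * α₁, 1) - G (c + σ * α₀, 0)‖ < ε := by
  obtain ⟨C', p, ρ, hp, hρ, hbd⟩ := hend
  have hσ' : (σ : ℂ) * σ = 1 := by exact_mod_cast hσ
  have hσn : |σ| = 1 := by
    have := abs_mul σ σ
    rw [hσ, abs_one] at this
    nlinarith [abs_nonneg σ]
  have hσn' : ‖(σ : ℂ)‖ = 1 := by rw [Complex.norm_real, Real.norm_eq_abs, hσn]
  have hinv : ∀ z : ℂ, (c : ℂ) + σ * (σ * (z - c)) = z := by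
    intro z; linear_combination (z - c) * hσ'
  set H' : ℝ × ℝ → ℂ := fun q => σ * (H (c + σ * q.1) q.2 - c)
  have hHn : ∀ q, ‖H' q‖ = ‖H (c + σ * q.1) q.2 - c‖ := by
    intro q; simp only [H', norm_mul, hσn', one_mul]
  have hmem : ∀ q ∈ Ioc 0 T ×ˢ Icc (0 : ℝ) 1, H (c + σ * q.1) q.2 ∈ W ∪ openIvC a b :=
    fun q hq => hH.mem _ (hT _ hq.1) _ hq.2
  have hmaps : MapsTo (fun q : ℝ × ℝ => (c + σ * q.1, q.2)) (Ioc 0 T ×ˢ Icc 0 1)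
      (openIv a b ×ˢ Icc 0 1) := fun q hq => ⟨hT _ hq.1, hq.2⟩
  -- Points of W are off the real axis, and points of the interval become positive after
  -- normalization, so the negative axis is avoided.
  have hslit : ∀ q ∈ Ioc 0 T ×ˢ Icc (0 : ℝ) 1, H' q ∈ Complex.slitPlane := by
    intro q hq
    rw [Complex.mem_slitPlane_iff]
    have hσ0 : σ ≠ 0 := by rintro rfl; simp at hσ
    rcases hmem q hq with h | ⟨t, ht, h⟩
    · right
      simpa [H', hσ0] using hW _ h
    · left
      have : H' q = ((σ * (t - c) : ℝ) : ℂ) := by simp only [H', ← h]; push_cast; ring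
      rw [this, Complex.ofReal_re]
      exact hside t ht
  obtain ⟨t₁, ht₁, hG⟩ := exists_small_increment_of_end_bound (f := fun w => σ * f (c + σ * w))
    (H := H') (T := T) (U := (fun w : ℂ => (c : ℂ) + σ * w) ⁻¹' U) (C := C * C') (p := p) (ρ₀ := ρ)
    (by
      have h1 : ContinuousOn (fun q : ℝ × ℝ => (c + σ * q.1, q.2)) (Ioc 0 T ×ˢ Icc 0 1) := by
        fun_prop
      exact ((hH.cont.comp h1 hmaps).sub continuousOn_const).const_smul (σ : ℂ)) hslit
    (fun t ht => by
      simp only [H', hH.start _ (hT t ht)]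
      push_cast
      linear_combination (t : ℂ) * hσ')
    (fun ε hε => by
      obtain ⟨η, hη, h⟩ := hlim ε hε
      refine ⟨η, hη, fun t ht s hs => ?_⟩
      rw [hHn, ← dist_eq_norm]
      exact h t ht s hs)
    (hU.preimage (by fun_prop))
    (by
      have h1 : Differentiable ℂ fun w : ℂ => (c : ℂ) + σ * w := by fun_prop
      exact (hf.comp h1.differentiableOn fun w hw => hw).const_mul (σ : ℂ))
    (fun q hq => by
      simp only [mem_preimage, H', hinv]
      exact hWU (hmem q hq)) hp hρ
    (fun q hq hn => by
      have hz := hmem q hq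
      rw [hHn] at hn
      have e1 := hbd _ hz (by rwa [dist_eq_norm])
      have e2 := hfk _ hz
      simp only [norm_mul, hσn', one_mul, hHn]
      simp only [H', hinv]
      calc ‖f (H (c + σ * q.1) q.2)‖ ≤ ‖f (H (c + σ * q.1) q.2)‖ * (1 + ‖H (c + σ * q.1) q.2‖) := by
            nlinarith [norm_nonneg (f (H (c + σ * q.1) q.2)), norm_nonneg (H (c + σ * q.1) q.2)]
        _ ≤ _ := e2
        _ ≤ C * (C' * ‖H (c + σ * q.1) q.2 - c‖ ^ p) := by gcongr
        _ = _ := by ring) hε hη hηT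
  exact ⟨t₁, ht₁, fun S G hGS hm => hG _ (hGS.comp_affine c hσ hm)⟩

theorem IsDeformation.exists_small_increment_left (hH : IsDeformation a b W k γ H) (hab : a < b)
    (hW : ∀ z ∈ W, z.im ≠ 0) (hU : IsOpen U) (hWU : W ∪ openIvC a b ⊆ U)
    (hf : DifferentiableOn ℂ f U) (hk : ContinuousOn k (W ∪ openIvC a b)) {C : ℝ} (hC : 0 ≤ C)
    (hfk : ∀ z ∈ W ∪ openIvC a b, ‖f z‖ * (1 + ‖z‖) ≤ C * ‖k z‖)
    (hend : ∀ c : ℝ, a = c → EndBoundOn (W ∪ openIvC a b) k c) {m : ℝ} (hm : m ∈ openIv a b)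
    {ε : ℝ} (hε : 0 < ε) {A : Set ℝ} (hA : A ∈ leftEnd a) :
    ∃ t₁ ∈ openIv a b, t₁ ≤ m ∧ ∀ G,
      IsPrimitiveAlong f (fun q => H q.1 q.2) (Icc t₁ m ×ˢ Icc 0 1) G →
      ∃ α₀ ∈ Icc t₁ m ∩ A, ∃ α₁ ∈ Icc t₁ m ∩ A, ‖G (α₁, 1) - G (α₀, 0)‖ < ε := by
  induction a with
  | top => exact absurd hab not_top_lt
  | bot =>
    -- The radius bound 0 is enough here: it only keeps the transversal away from the origin.
    -- Dividing ε by C + 1 allows for C = 0.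
    obtain ⟨t, ht, ⟨⟨htI, htm⟩, hR⟩, htA⟩ :=
      ((hH.left_small rfl (ε / (C + 1)) (by positivity)).and_eventually
      (((eventually_leftEnd_lt hm).and (hH.left_infinite rfl 0)).and hA)).exists
    refine ⟨t, htI, htm.le, fun G hG => ?_⟩
    refine ⟨t, ⟨⟨le_rfl, htm.le⟩, htA⟩, t, ⟨⟨le_rfl, htm.le⟩, htA⟩, ?_⟩
    refine (hH.norm_transversal_increment_le hWU hf hk hC hfk hG htI
      (prod_mono (singleton_subset_iff.mpr ⟨le_rfl, htm.le⟩) subset_rfl) hR ht).trans_lt ?_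
    rw [mul_div_assoc', div_lt_iff₀ (by positivity)]
    linarith
  | coe c =>
    rw [leftEnd_coe] at hA
    have hmc : c < m := EReal.coe_lt_coe_iff.mp hm.1
    obtain ⟨u, hu, huA⟩ := mem_nhdsGT_iff_exists_Ioo_subset.mp hA
    have hu : c < u := hu
    -- The first term puts the parameters found into `A`, and the second keeps them to the left of
    -- m.
    set η := min (u - c) ((m - c) / 2) with hηdef
    have hη : 0 < η := lt_min (by linarith) (by linarith)
    have hηm : η < m - c := (min_le_right _ _).trans_lt (by linarith)
    have hmemI : ∀ t ∈ Ioc 0 (m - c), c + 1 * t ∈ openIv c b := fun t ht =>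
      ⟨EReal.coe_lt_coe_iff.mpr (by linarith [ht.1]),
        (EReal.coe_le_coe_iff.mpr (by linarith [ht.2])).trans_lt hm.2⟩
    obtain ⟨t₁, ht₁, h⟩ := hH.exists_small_increment_finite hW hU hWU hf hC hfk (c := c) (σ := 1)
      (T := m - c) (by norm_num) (fun t ht => by
        have := EReal.coe_lt_coe_iff.mp ht.1
        linarith) hmemI (fun ε hε => by
        have h1 := hH.left_finite c rfl ε hε
        rw [leftEnd_coe] at h1
        obtain ⟨v, hv, hvs⟩ := mem_nhdsGT_iff_exists_Ioo_subset.mp h1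
        have hv : c < v := hv
        refine ⟨v - c, by linarith, fun t ht s hs => ?_⟩
        exact hvs (show c + 1 * t ∈ Ioo c v from ⟨by linarith [ht.1], by linarith [ht.2]⟩) s hs)
      (hend c rfl) hε hη hηm
    refine ⟨c + 1 * t₁, hmemI _ ⟨ht₁.1, by linarith [ht₁.2]⟩, by linarith [ht₁.2], fun G hG => ?_⟩
    obtain ⟨α₀, hα₀, α₁, hα₁, hα⟩ := h _ G hG (fun q hq =>
      ⟨⟨by linarith [hq.1.1], by linarith [hq.1.2]⟩, hq.2⟩)
    have hmem : ∀ α ∈ Ico t₁ η, c + 1 * α ∈ Icc (c + 1 * t₁) m ∩ A := fun α hα =>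
      ⟨⟨by linarith [hα.1], by linarith [hα.2]⟩, huA ⟨by linarith [hα.1, ht₁.1], by
        linarith [hα.2, min_le_left (u - c) ((m - c) / 2)]⟩⟩
    exact ⟨_, hmem _ hα₀, _, hmem _ hα₁, hα⟩

theorem IsDeformation.exists_small_increment_right (hH : IsDeformation a b W k γ H) (hab : a < b)
    (hW : ∀ z ∈ W, z.im ≠ 0) (hU : IsOpen U) (hWU : W ∪ openIvC a b ⊆ U)
    (hf : DifferentiableOn ℂ f U) (hk : ContinuousOn k (W ∪ openIvC a b)) {C : ℝ} (hC : 0 ≤ C)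
    (hfk : ∀ z ∈ W ∪ openIvC a b, ‖f z‖ * (1 + ‖z‖) ≤ C * ‖k z‖)
    (hend : ∀ c : ℝ, b = c → EndBoundOn (W ∪ openIvC a b) k c) {m : ℝ} (hm : m ∈ openIv a b)
    {ε : ℝ} (hε : 0 < ε) {A : Set ℝ} (hA : A ∈ rightEnd b) :
    ∃ t₂ ∈ openIv a b, m ≤ t₂ ∧ ∀ G,
      IsPrimitiveAlong f (fun q => H q.1 q.2) (Icc m t₂ ×ˢ Icc 0 1) G →
      ∃ β₀ ∈ Icc m t₂ ∩ A, ∃ β₁ ∈ Icc m t₂ ∩ A, ‖G (β₁, 1) - G (β₀, 0)‖ < ε := by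
  induction b with
  | bot => exact absurd hab not_lt_bot
  | top =>
    obtain ⟨t, ht, ⟨⟨htI, htm⟩, hR⟩, htA⟩ :=
      ((hH.right_small rfl (ε / (C + 1)) (by positivity)).and_eventually
      (((eventually_rightEnd_gt hm).and (hH.right_infinite rfl 0)).and hA)).exists
    refine ⟨t, htI, htm.le, fun G hG => ?_⟩
    refine ⟨t, ⟨⟨htm.le, le_rfl⟩, htA⟩, t, ⟨⟨htm.le, le_rfl⟩, htA⟩, ?_⟩
    refine (hH.norm_transversal_increment_le hWU hf hk hC hfk hG htI
      (prod_mono (singleton_subset_iff.mpr ⟨htm.le, le_rfl⟩) subset_rfl) hR ht).trans_lt ?_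
    rw [mul_div_assoc', div_lt_iff₀ (by positivity)]
    linarith
  | coe c =>
    rw [rightEnd_coe] at hA
    have hmc : m < c := EReal.coe_lt_coe_iff.mp hm.2
    obtain ⟨u, hu, huA⟩ := mem_nhdsLT_iff_exists_Ioo_subset.mp hA
    have hu : u < c := hu
    set η := min (c - u) ((c - m) / 2) with hηdef
    have hη : 0 < η := lt_min (by linarith) (by linarith)
    have hηm : η < c - m := (min_le_right _ _).trans_lt (by linarith)
    have hmemI : ∀ t ∈ Ioc 0 (c - m), c + (-1) * t ∈ openIv a c := fun t ht =>
      ⟨hm.1.trans_le (EReal.coe_le_coe_iff.mpr (by linarith [ht.2])),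
        EReal.coe_lt_coe_iff.mpr (by linarith [ht.1])⟩
    obtain ⟨t₁, ht₁, h⟩ := hH.exists_small_increment_finite hW hU hWU hf hC hfk (c := c) (σ := -1)
      (T := c - m) (by norm_num) (fun t ht => by
        have := EReal.coe_lt_coe_iff.mp ht.2
        linarith) hmemI (fun ε hε => by
        have h1 := hH.right_finite c rfl ε hε
        rw [rightEnd_coe] at h1
        obtain ⟨v, hv, hvs⟩ := mem_nhdsLT_iff_exists_Ioo_subset.mp h1
        have hv : v < c := hv
        refine ⟨c - v, by linarith, fun t ht s hs => ?_⟩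
        exact hvs (show c + (-1) * t ∈ Ioo v c from ⟨by linarith [ht.2], by linarith [ht.1]⟩) s hs)
      (hend c rfl) hε hη hηm
    refine ⟨c + (-1) * t₁, hmemI _ ⟨ht₁.1, by linarith [ht₁.2]⟩, by linarith [ht₁.2], fun G hG => ?_⟩
    obtain ⟨α₀, hα₀, α₁, hα₁, hα⟩ := h _ G hG (fun q hq =>
      ⟨⟨by linarith [hq.1.2], by linarith [hq.1.1]⟩, hq.2⟩)
    have hmem : ∀ α ∈ Ico t₁ η, c + (-1) * α ∈ Icc m (c + (-1) * t₁) ∩ A := fun α hα =>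
      ⟨⟨by linarith [hα.2], by linarith [hα.1]⟩, huA ⟨by
        linarith [hα.2, min_le_left (c - u) ((c - m) / 2)], by linarith [hα.1, ht₁.1]⟩⟩
    exact ⟨_, hmem _ hα₀, _, hmem _ hα₁, hα⟩

theorem IsDeformation.integral_start_eq {S : Set (ℝ × ℝ)} {G : ℝ × ℝ → ℂ}
    (hH : IsDeformation a b W k γ H) (hWU : W ∪ openIvC a b ⊆ U)
    (hf : DifferentiableOn ℂ f U) (hG : IsPrimitiveAlong f (fun q => H q.1 q.2) S G) {u v : ℝ}
    (hu : u ∈ openIv a b) (hv : v ∈ openIv a b) (huv : u ≤ v) (hS : Icc u v ×ˢ {0} ⊆ S) :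
    ∫ t in u..v, f t = G (v, 0) - G (u, 0) := by
  have hI := Icc_subset_openIv hu hv
  have hL : LipschitzOnWith 1 (fun t : ℝ => (t : ℂ)) (Icc u v) :=
    Complex.isometry_ofReal.lipschitz.lipschitzOnWith
  have hd : deriv (fun t : ℝ => (t : ℂ)) = fun _ => 1 := by
    ext t; exact (Complex.ofRealCLM.hasDerivAt (x := t)).deriv
  have := hL.integral_mul_deriv_eq_sub (f := f) (g := fun t => G (t, 0)) huv
    (hf.continuousOn.comp Complex.continuous_ofReal.continuousOn fun t ht =>
      hWU (Or.inr ⟨t, hI ht, rfl⟩)) (fun t ht => by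
      obtain ⟨F, hF, hGF⟩ := hG (t, 0) (hS ⟨ht, rfl⟩)
      simp only [hH.start t (hI ht)] at hF
      refine ⟨F, hF, ?_⟩
      have hcont : ContinuousWithinAt (fun s' : ℝ => (s', (0 : ℝ))) (Icc u v) t := by fun_prop
      filter_upwards [hcont.tendsto_nhdsWithin (fun s' hs' => hS ⟨hs', rfl⟩) hGF,
        self_mem_nhdsWithin] with t' h1 h2
      have h3 : G (t', 0) = F (H t' 0) := h1
      rwa [hH.start t' (hI h2)] at h3)
  simpa [hd] using this

theorem IsDeformation.integral_final_eq {S : Set (ℝ × ℝ)} {G : ℝ × ℝ → ℂ}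
    (hH : IsDeformation a b W k γ H) (hγ : LocallyLipschitzOn (openIv a b) γ)
    (hWU : W ∪ openIvC a b ⊆ U)
    (hf : DifferentiableOn ℂ f U) (hG : IsPrimitiveAlong f (fun q => H q.1 q.2) S G) {u v : ℝ}
    (hu : u ∈ openIv a b) (hv : v ∈ openIv a b) (huv : u ≤ v) (hS : Icc u v ×ˢ {1} ⊆ S) :
    ∫ t in u..v, f (γ t) * deriv γ t = G (v, 1) - G (u, 1) := by
  have hI := Icc_subset_openIv hu hv
  obtain ⟨L, hL⟩ := (hγ.mono hI).exists_lipschitzOnWith_of_compact isCompact_Icc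
  refine hL.integral_mul_deriv_eq_sub (f := f) (g := fun t => G (t, 1)) huv
    (hf.continuousOn.comp hL.continuousOn fun t ht => ?_) (fun t ht => ?_)
  · rw [← hH.final t (hI ht)]
    exact hWU (hH.mem t (hI ht) 1 (by simp))
  · obtain ⟨F, hF, hGF⟩ := hG (t, 1) (hS ⟨ht, rfl⟩)
    simp only [hH.final t (hI ht)] at hF
    refine ⟨F, hF, ?_⟩
    have hcont : ContinuousWithinAt (fun s' : ℝ => (s', (1 : ℝ))) (Icc u v) t := by fun_prop
    filter_upwards [hcont.tendsto_nhdsWithin (fun s' hs' => hS ⟨hs', rfl⟩) hGF,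
      self_mem_nhdsWithin] with t' h1 h2
    have h3 : G (t', 1) = F (H t' 1) := h1
    rwa [hH.final t' (hI h2)] at h3

/-- The improper integrals of `f` over the interval and over the contour agree. -/
theorem IsDeformation.eq_of_tendsto (hH : IsDeformation a b W k γ H) (hab : a < b)
    (hγ : LocallyLipschitzOn (openIv a b) γ)
    (hW : ∀ z ∈ W, z.im ≠ 0) (hU : IsOpen U) (hWU : W ∪ openIvC a b ⊆ U)
    (hf : DifferentiableOn ℂ f U) (hk : ContinuousOn k (W ∪ openIvC a b)) {C : ℝ} (hC : 0 ≤ C)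
    (hfk : ∀ z ∈ W ∪ openIvC a b, ‖f z‖ * (1 + ‖z‖) ≤ C * ‖k z‖)
    (hleft : ∀ c : ℝ, a = c → EndBoundOn (W ∪ openIvC a b) k c)
    (hright : ∀ c : ℝ, b = c → EndBoundOn (W ∪ openIvC a b) k c) {I₀ I₁ : ℂ}
    (h₀ : Tendsto (fun q : ℝ × ℝ => ∫ t in q.1..q.2, f t) (leftEnd a ×ˢ rightEnd b) (𝓝 I₀))
    (h₁ : Tendsto (fun q : ℝ × ℝ => ∫ t in q.1..q.2, f (γ t) * deriv γ t)
      (leftEnd a ×ˢ rightEnd b) (𝓝 I₁)) : I₀ = I₁ := by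
  by_contra hne
  have hε : 0 < dist I₀ I₁ / 4 := by have := dist_pos.mpr hne; positivity
  set ε := dist I₀ I₁ / 4 with hεdef
  obtain ⟨A, hA, B, hB, hAB⟩ := mem_prod_iff.mp
    ((h₀ (Metric.ball_mem_nhds I₀ hε)) : _ ∈ leftEnd a ×ˢ rightEnd b)
  obtain ⟨A', hA', B', hB', hAB'⟩ := mem_prod_iff.mp
    ((h₁ (Metric.ball_mem_nhds I₁ hε)) : _ ∈ leftEnd a ×ˢ rightEnd b)
  obtain ⟨m, hm⟩ := openIv_nonempty hab
  -- The outer parameters are fixed before G, which exists only over a compact rectangle, and the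
  -- increment estimates hold for every such G. The cut-offs on the two curves may differ (α₀ ≠ α₁,
  -- β₀ ≠ β₁). This is harmless because both improper integrals converge.
  obtain ⟨t₁, ht₁, ht₁m, hl⟩ := hH.exists_small_increment_left hab hW hU hWU hf hk hC hfk hleft hm hε
    (inter_mem hA hA')
  obtain ⟨t₂, ht₂, ht₂m, hr⟩ := hH.exists_small_increment_right hab hW hU hWU hf hk hC hfk hright hm
    hε (inter_mem hB hB')
  have hI := Icc_subset_openIv ht₁ ht₂
  have hsub : Icc t₁ t₂ ×ˢ Icc (0 : ℝ) 1 ⊆ openIv a b ×ˢ Icc 0 1 := prod_mono hI subset_rfl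
  obtain ⟨G, hG⟩ := exists_primitive_along (ht₁m.trans ht₂m) (hH.cont.mono hsub) hU hf
    ((hH.mapsTo hWU).mono_left hsub)
  obtain ⟨α₀, ⟨hα₀, hα₀A⟩, α₁, ⟨hα₁, hα₁A⟩, hα⟩ := hl G (hG.mono
    (prod_mono (Icc_subset_Icc_right ht₂m) subset_rfl))
  obtain ⟨β₀, ⟨hβ₀, hβ₀B⟩, β₁, ⟨hβ₁, hβ₁B⟩, hβ⟩ := hr G (hG.mono
    (prod_mono (Icc_subset_Icc_left ht₁m) subset_rfl))
  have e₀ := hH.integral_start_eq hWU hf hG (u := α₀) (v := β₀)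
    (hI ⟨hα₀.1, hα₀.2.trans ht₂m⟩) (hI ⟨ht₁m.trans hβ₀.1, hβ₀.2⟩) (hα₀.2.trans hβ₀.1)
    (prod_mono (Icc_subset_Icc hα₀.1 hβ₀.2) (by simp))
  have e₁ := hH.integral_final_eq hγ hWU hf hG (u := α₁) (v := β₁)
    (hI ⟨hα₁.1, hα₁.2.trans ht₂m⟩) (hI ⟨ht₁m.trans hβ₁.1, hβ₁.2⟩) (hα₁.2.trans hβ₁.1)
    (prod_mono (Icc_subset_Icc hα₁.1 hβ₁.2) (by simp))
  have d₀ : dist (∫ t in α₀..β₀, f t) I₀ < ε := hAB (mk_mem_prod hα₀A.1 hβ₀B.1)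
  have d₁ : dist (∫ t in α₁..β₁, f (γ t) * deriv γ t) I₁ < ε := hAB' (mk_mem_prod hα₁A.2 hβ₁B.2)
  have d₂ : dist (∫ t in α₀..β₀, f t) (∫ t in α₁..β₁, f (γ t) * deriv γ t) < 2 * ε := by
    rw [e₀, e₁, dist_eq_norm]
    calc ‖G (β₀, 0) - G (α₀, 0) - (G (β₁, 1) - G (α₁, 1))‖
        = ‖(G (α₁, 1) - G (α₀, 0)) - (G (β₁, 1) - G (β₀, 0))‖ := by congr 1; ring
      _ ≤ _ := norm_sub_le _ _
      _ < 2 * ε := by linarith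
  have := dist_triangle4 I₀ (∫ t in α₀..β₀, f t) (∫ t in α₁..β₁, f (γ t) * deriv γ t) I₁
  rw [dist_comm I₀ (∫ t in α₀..β₀, f t)] at this
  linarith

end ContourShift

/-! ### Resolvent estimates -/

section Resolvent

theorem ringInverse_neg {A : Type*} [Ring A] (x : A) : Ring.inverse (-x) = -Ring.inverse x := by
  by_cases hx : IsUnit x
  · obtain ⟨u, rfl⟩ := hx
    rw [← Units.val_neg, Ring.inverse_unit, Ring.inverse_unit, inv_neg, Units.val_neg]
  · rw [Ring.inverse_non_unit _ hx, Ring.inverse_non_unit _ (by simpa using hx), neg_zero]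

variable {A : Type*} [NormedRing A] [NormedAlgebra ℂ A] {Z : A} {μ : ℂ}

theorem isUnit_sub_smul_one (hμ : μ ∉ spectrum ℂ Z) : IsUnit (Z - μ • (1 : A)) := by
  have := spectrum.notMem_iff.mp hμ
  rw [Algebra.algebraMap_eq_smul_one] at this
  simpa using this.neg

variable [CompleteSpace A]

theorem hasDerivAt_inverse_sub_smul_one (hμ : μ ∉ spectrum ℂ Z) :
    HasDerivAt (fun μ : ℂ => Ring.inverse (Z - μ • (1 : A)))
      (Ring.inverse (Z - μ • (1 : A)) * Ring.inverse (Z - μ • (1 : A))) μ := by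
  have h1 := (spectrum.hasDerivAt_resolvent_const_left (a := Z)
    (spectrum.notMem_iff.mp hμ : μ ∈ resolventSet ℂ Z)).neg
  have h2 : ∀ ν : ℂ, Ring.inverse (Z - ν • (1 : A)) = - resolvent Z ν := by
    intro ν
    rw [resolvent, ← ringInverse_neg, neg_sub, Algebra.algebraMap_eq_smul_one]
  have h3 : (fun μ : ℂ => Ring.inverse (Z - μ • (1 : A))) = fun ν => - resolvent Z ν := funext h2
  rw [h3, h2, neg_mul_neg]
  rw [neg_neg, sq] at h1
  exact h1

/-- For |μ| ≤ 2‖Z‖ + 1 this is compactness. Beyond that, μR = ZR - 1 gives (|μ| - ‖Z‖)‖R‖ ≤ ‖1‖, and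
1 + |μ| ≤ 2(|μ| - ‖Z‖). -/
theorem exists_norm_inverse_sub_smul_one_mul_le {S : Set ℂ} (hS : IsClosed S)
    (hSZ : ∀ μ ∈ S, μ ∉ spectrum ℂ Z) :
    ∃ C, 0 ≤ C ∧ ∀ μ ∈ S, ‖Ring.inverse (Z - μ • (1 : A))‖ * (1 + ‖μ‖) ≤ C := by
  have hcomp : IsCompact (S ∩ Metric.closedBall 0 (2 * ‖Z‖ + 1)) :=
    (isCompact_closedBall _ _).inter_left hS
  have hcont : ContinuousOn (fun μ : ℂ => ‖Ring.inverse (Z - μ • (1 : A))‖ * (1 + ‖μ‖))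
      (S ∩ Metric.closedBall 0 (2 * ‖Z‖ + 1)) := by
    refine ContinuousOn.mul (ContinuousOn.norm fun μ hμ => ?_) (by fun_prop)
    exact (hasDerivAt_inverse_sub_smul_one (hSZ μ hμ.1)).continuousAt.continuousWithinAt
  obtain ⟨M, hM⟩ := hcomp.exists_bound_of_continuousOn hcont
  refine ⟨max M (2 * ‖(1 : A)‖), le_max_of_le_right (by positivity), fun μ hμ => ?_⟩
  rcases le_or_gt ‖μ‖ (2 * ‖Z‖ + 1) with h | h
  · exact le_max_of_le_left ((le_abs_self _).trans (hM μ ⟨hμ, by simpa using h⟩))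
  · refine le_max_of_le_right ?_
    set R := Ring.inverse (Z - μ • (1 : A))
    have h1 : (Z - μ • (1 : A)) * R = 1 := Ring.mul_inverse_cancel _ (isUnit_sub_smul_one (hSZ μ hμ))
    have h2 : μ • R = Z * R - 1 := by
      rw [sub_mul, smul_mul_assoc, one_mul] at h1
      rw [← h1]; abel
    have h3 : ‖μ‖ * ‖R‖ ≤ ‖Z‖ * ‖R‖ + ‖(1 : A)‖ := by
      rw [← norm_smul, h2]
      exact (norm_sub_le _ _).trans (by gcongr; exact norm_mul_le _ _)
    nlinarith [norm_nonneg R]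

end Resolvent

/-! ### Distance between sets -/

section Distance

theorem setDist_le {S T : Set ℂ} {z w : ℂ} (hz : z ∈ S) (hw : w ∈ T) : setDist S T ≤ dist z w :=
  csInf_le ⟨0, by rintro _ ⟨z, -, w, -, rfl⟩; exact dist_nonneg⟩ ⟨z, hz, w, hw, rfl⟩

theorem setDist_le_of_mem_closure {S T : Set ℂ} {z w : ℂ} (hz : z ∈ S) (hw : w ∈ closure T) :
    setDist S T ≤ dist z w := by
  refine le_of_forall_pos_le_add fun ε hε => ?_
  obtain ⟨v, hv, hwv⟩ := Metric.mem_closure_iff.mp hw ε hε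
  exact (setDist_le hz hv).trans ((dist_triangle z w v).trans (by linarith))

end Distance

/-! ### The continued derivative of K_B on D^l -/

section Continuation

variable {H₀ H₁ : Type*} [NormedAddCommGroup H₀] [InnerProductSpace ℂ H₀] [CompleteSpace H₀]
  [NormedAddCommGroup H₁] [InnerProductSpace ℂ H₁] [CompleteSpace H₁]
  {a b : EReal} {D : Set ℂ} {k : ℂ → (H₁ →L[ℂ] H₁)} {E : SpectralMeasure H₀} {B : H₁ →L[ℂ] H₀}

theorem IsLowerDomain.im_ne_zero (hD : IsLowerDomain a b D) (l : ℤˣ) {z : ℂ}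
    (hz : z ∈ domainOf D l) : z.im ≠ 0 := by
  have := hD.lower _ hz
  split_ifs at this
  · simp at this; exact this.ne'
  · exact this.ne

theorem IsLowerDomain.openIvC_subset_closure (hD : IsLowerDomain a b D) (l : ℤˣ) :
    openIvC a b ⊆ closure (domainOf D l) := by
  rintro _ ⟨t, ht, rfl⟩
  have h1 : (t : ℂ) ∈ closure D := frontier_subset_closure (hD.boundary ⟨t, ht, rfl⟩)
  by_cases hl : l = 1
  · have h2 := map_mem_closure (t := domainOf D l) Complex.continuous_conj h1
      (fun z hz => by simpa [domainOf, hl] using hz)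
    simpa using h2
  · simpa [domainOf, hl] using h1

theorem mem_closure_openIvC_left {c : ℝ} (hcb : (c : EReal) < b) :
    (c : ℂ) ∈ closure (openIvC c b) := by
  have hne := leftEnd_neBot hcb
  obtain ⟨m, hm⟩ := openIv_nonempty hcb
  have h1 := eventually_leftEnd_lt hm
  rw [leftEnd_coe] at hne h1
  have h2 : Tendsto (fun t : ℝ => (t : ℂ)) (𝓝[>] c) (𝓝 c) :=
    Complex.continuous_ofReal.continuousAt.mono_left nhdsWithin_le_nhds
  exact mem_closure_of_tendsto h2 (h1.mono fun t ht => ⟨t, ht.1, rfl⟩)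

theorem mem_closure_openIvC_right {c : ℝ} (hac : a < (c : EReal)) :
    (c : ℂ) ∈ closure (openIvC a c) := by
  have hne := rightEnd_neBot hac
  obtain ⟨m, hm⟩ := openIv_nonempty hac
  have h1 := eventually_rightEnd_gt hm
  rw [rightEnd_coe] at hne h1
  have h2 : Tendsto (fun t : ℝ => (t : ℂ)) (𝓝[<] c) (𝓝 c) :=
    Complex.continuous_ofReal.continuousAt.mono_left nhdsWithin_le_nhds
  exact mem_closure_of_tendsto h2 (h1.mono fun t ht => ⟨t, ht.1, rfl⟩)

/-- For l = 1, conjugating both argument and value preserves holomorphy. The neighbourhood matters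
at points of the interval, where the deformation starts. -/
theorem IsContinuedDerivative.eventually_differentiableAt (hk : IsContinuedDerivative E B a b D k)
    (l : ℤˣ) {z : ℂ} (hz : z ∈ domainOf D l ∪ openIvC a b) :
    ∀ᶠ w in 𝓝 z, DifferentiableAt ℂ (contOf k l) w := by
  by_cases hl : l = 1
  · have hz' : conj z ∈ D ∪ openIvC a b := by
      rcases hz with h | ⟨t, ht, rfl⟩
      · left; simpa [domainOf, hl] using h
      · right; exact ⟨t, ht, by simp⟩
    have h1 : ∀ᶠ w in 𝓝 (conj z), DifferentiableAt ℂ k w :=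
      (hk.analytic _ hz').eventually_analyticAt.mono fun w hw => hw.differentiableAt
    have h2 : ∀ᶠ w in 𝓝 z, DifferentiableAt ℂ k (conj w) :=
      (Complex.continuous_conj.tendsto z).eventually h1
    filter_upwards [h2] with w hw
    have h3 := hw.star_conj
    have h4 : contOf k l = star ∘ k ∘ conj := by
      ext1 v
      simp [contOf, hl, ContinuousLinearMap.star_eq_adjoint]
    rw [h4]
    simpa using h3
  · have hz' : z ∈ D ∪ openIvC a b := by
      rcases hz with h | h
      · left; simpa [domainOf, hl] using h
      · right; exact h
    have h4 : contOf k l = k := by ext1 v; simp [contOf, hl]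
    rw [h4]
    exact (hk.analytic _ hz').eventually_analyticAt.mono fun w hw => hw.differentiableAt

theorem isSelfAdjoint_KB (E : SpectralMeasure H₀) (B : H₁ →L[ℂ] H₀) (t : ℝ) :
    IsSelfAdjoint (KB E B t) := by
  have h : ContinuousLinearMap.adjoint (E.toFun (Iio t)) = E.toFun (Iio t) :=
    (E.isProj _ measurableSet_Iio).isSelfAdjoint
  rw [IsSelfAdjoint, ContinuousLinearMap.star_eq_adjoint, KB, ContinuousLinearMap.adjoint_comp,
    ContinuousLinearMap.adjoint_comp, ContinuousLinearMap.adjoint_adjoint, h]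
  rfl

/-- K_B(t) is self-adjoint, hence so is its derivative, and the reflected continuation has the same
values on the interval. -/
theorem IsContinuedDerivative.hasDerivAt_contOf (hk : IsContinuedDerivative E B a b D k)
    (l : ℤˣ) {t : ℝ} (ht : t ∈ openIv a b) : HasDerivAt (KB E B) (contOf k l t) t := by
  by_cases hl : l = 1
  · have h1 := (hk.hasDeriv t ht).star
    have h2 : (fun x => star (KB E B x)) = KB E B := funext fun x => isSelfAdjoint_KB E B x
    rw [h2] at h1
    simpa [contOf, hl, ContinuousLinearMap.star_eq_adjoint] using h1
  · simpa [contOf, hl] using hk.hasDeriv t ht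

/-- The bound passes from the domain to the interval by continuity, since the interval lies in the
closure of the domain. Excluding c from the interval keeps |t - c|^p continuous there. -/
theorem IsContinuedDerivative.endBoundOn (hk : IsContinuedDerivative E B a b D k)
    (hD : IsLowerDomain a b D) (l : ℤˣ) {c : ℝ} (hc : c ∉ openIv a b) (h : EndBound D k c) :
    EndBoundOn (domainOf D l ∪ openIvC a b) (contOf k l) c := by
  obtain ⟨C, -, p, hp, ρ, hρ, hb⟩ := h
  have hdom : ∀ μ ∈ domainOf D l, dist μ (c : ℂ) < ρ → ‖contOf k l μ‖ ≤ C * ‖μ - c‖ ^ p := by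
    intro μ hμ hd
    by_cases hl : l = 1
    · have hμ' : conj μ ∈ D := by simpa [domainOf, hl] using hμ
      have e : ‖conj μ - (c : ℂ)‖ = ‖μ - c‖ := by
        rw [← Complex.norm_conj, map_sub, Complex.conj_conj, Complex.conj_ofReal]
      have := hb _ hμ' (by rwa [dist_eq_norm, e, ← dist_eq_norm])
      rw [e] at this
      simpa [contOf, hl] using this
    · have hμ' : μ ∈ D := by simpa [domainOf, hl] using hμ
      simpa [contOf, hl] using hb μ hμ' hd
  refine ⟨C, p, ρ, hp.1, hρ, fun μ hμ hd => ?_⟩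
  rcases hμ with hμ | ⟨t, ht, rfl⟩
  · exact hdom μ hμ hd
  · have hcl := hD.openIvC_subset_closure l ⟨t, ht, rfl⟩
    have hne : (𝓝[domainOf D l] (t : ℂ)).NeBot := mem_closure_iff_nhdsWithin_neBot.mp hcl
    have htc : (t : ℂ) - c ≠ 0 := by
      rw [sub_ne_zero]
      exact_mod_cast fun h : t = c => hc (h ▸ ht)
    have hcont : ContinuousAt (contOf k l) t :=
      (hk.eventually_differentiableAt l (Or.inr ⟨t, ht, rfl⟩)).self_of_nhds.continuousAt
    have hcont' : ContinuousAt (fun z : ℂ => C * ‖z - c‖ ^ p) t := by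
      refine ContinuousAt.mul continuousAt_const (ContinuousAt.rpow_const (by fun_prop) ?_)
      exact Or.inl (norm_ne_zero_iff.mpr htc)
    refine le_of_tendsto_of_tendsto (b := 𝓝[domainOf D l] (t : ℂ)) (hcont.norm.mono_left nhdsWithin_le_nhds)
      (hcont'.mono_left nhdsWithin_le_nhds) ?_
    have h2 : ∀ᶠ z in 𝓝[domainOf D l] (t : ℂ), dist z (c : ℂ) < ρ :=
      nhdsWithin_le_nhds (Metric.isOpen_ball.mem_nhds (x := (t : ℂ)) hd)
    filter_upwards [h2, self_mem_nhdsWithin] with z hz hzD using hdom z hzD hz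

end Continuation

/-! ### Improper integrals as limits along the end filters -/

section Ends

theorem tendsto_intervalIntegral_ends {V : Type*} [NormedAddCommGroup V] [NormedSpace ℝ V]
    {a b : EReal} (hab : a < b) {g : ℝ → V} (hg : IntegrableOn g (openIv a b)) :
    Tendsto (fun q : ℝ × ℝ => ∫ t in q.1..q.2, g t) (leftEnd a ×ˢ rightEnd b)
      (𝓝 (∫ t in openIv a b, g t)) := by
  obtain ⟨m, hm⟩ := openIv_nonempty hab
  have hev : ∀ᶠ q : ℝ × ℝ in leftEnd a ×ˢ rightEnd b,
      (q.1 ∈ openIv a b ∧ q.1 < m) ∧ (q.2 ∈ openIv a b ∧ m < q.2) :=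
    (eventually_leftEnd_lt hm).prod_mk (eventually_rightEnd_gt hm)
  have hcov : AECover (volume.restrict (openIv a b)) (leftEnd a ×ˢ rightEnd b)
      (fun q : ℝ × ℝ => Ioc q.1 q.2) := by
    refine ⟨?_, fun q => measurableSet_Ioc⟩
    filter_upwards [ae_restrict_mem (isOpen_openIv a b).measurableSet] with t ht
    filter_upwards [(eventually_leftEnd_lt ht).prod_mk (eventually_rightEnd_gt ht)] with q hq
    exact ⟨hq.1.2, hq.2.2.le⟩
  refine (hcov.integral_tendsto_of_countably_generated hg).congr' ?_
  filter_upwards [hev] with q hq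
  rw [intervalIntegral.integral_of_le (hq.1.2.trans hq.2.2).le, Measure.restrict_restrict
    measurableSet_Ioc, inter_eq_left.mpr (Ioc_subset_Icc_self.trans
      (Icc_subset_openIv hq.1.1 hq.2.1))]

end Ends

/-! ### Stieltjes integrals against a spectral measure -/

namespace SpectralMeasure

variable {H : Type*} [NormedAddCommGroup H] [InnerProductSpace ℂ H] [CompleteSpace H]
  (E : SpectralMeasure H) {s t : Set ℝ}

theorem toFun_apply_toFun_apply (hs : MeasurableSet s) (ht : MeasurableSet t) (x : H) :
    E.toFun s (E.toFun t x) = E.toFun (s ∩ t) x := by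
  rw [E.map_inter s t hs ht]; rfl

theorem inner_toFun_left (hs : MeasurableSet s) (x y : H) :
    inner ℂ (E.toFun s x) y = inner ℂ x (E.toFun s y) := by
  have ha : ContinuousLinearMap.adjoint (E.toFun s) = E.toFun s := (E.isProj s hs).isSelfAdjoint
  conv_lhs => rw [← ha, ContinuousLinearMap.adjoint_inner_left]

theorem norm_toFun_apply_le (hs : MeasurableSet s) (x : H) : ‖E.toFun s x‖ ≤ ‖x‖ := by
  have h1 := norm_inner_le_norm (𝕜 := ℂ) x (E.toFun s x)
  rw [E.inner_apply hs, Complex.norm_real, Real.norm_of_nonneg (by positivity)] at h1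
  rcases (norm_nonneg (E.toFun s x)).eq_or_lt with h | h
  · rw [← h]; exact norm_nonneg x
  · nlinarith

theorem toFun_union (hs : MeasurableSet s) (ht : MeasurableSet t) (hd : Disjoint s t) (x : H) :
    E.toFun (s ∪ t) x = E.toFun s x + E.toFun t x := by
  have h := E.sigmaAdd (fun n => if n = 0 then s else if n = 1 then t else ∅)
    (fun n => by split_ifs <;> simp [hs, ht]) (by
      intro i j hij
      simp only [Function.onFun]
      split_ifs <;> simp_all [hd.symm]) x
  have hU : (⋃ n : ℕ, if n = 0 then s else if n = 1 then t else ∅) = s ∪ t := by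
    ext y
    simp only [mem_iUnion, mem_union]
    constructor
    · rintro ⟨n, hn⟩
      split_ifs at hn <;> simp_all
    · rintro (h | h)
      · exact ⟨0, by simpa using h⟩
      · exact ⟨1, by simpa using h⟩
  rw [hU] at h
  have h2 := hasSum_sum_of_ne_finset_zero (L := .unconditional ℕ) (f := fun n : ℕ => E.toFun
    (if n = 0 then s else if n = 1 then t else ∅) x) (s := Finset.range 2) (by
      intro n hn
      simp only [Finset.mem_range, not_lt] at hn
      rw [if_neg (by omega), if_neg (by omega), E.empty]
      rfl)
  rw [h.unique h2]
  simp [Finset.sum_range_succ]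

theorem toFun_Iio_sub {u v : ℝ} (huv : u ≤ v) (x : H) :
    E.toFun (Iio v) x - E.toFun (Iio u) x = E.toFun (Ico u v) x := by
  rw [← Iio_union_Ico_eq_Iio huv, E.toFun_union measurableSet_Iio measurableSet_Ico
    (by rw [Set.disjoint_left]; intro y h1 h2; exact absurd h1.out (not_lt.mpr h2.1))]
  abel

instance (x : H) : IsFiniteMeasure (E.scalar x) :=
  ⟨by rw [E.scalar_apply x MeasurableSet.univ]; exact ENNReal.ofReal_lt_top⟩

variable {E}

/-- The scalar measures are finite and do not charge Lebesgue null sets, so the measures of S \ A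
and A \ S tend to 0. These are the squared norms of the two parts of the difference. -/
theorem IsAbsCont.tendsto_toFun (hac : E.IsAbsCont) {ι : Type*} {L : Filter ι}
    [L.IsCountablyGenerated] {S : ι → Set ℝ} {A : Set ℝ} (hS : ∀ i, MeasurableSet (S i))
    (hA : MeasurableSet A) (hSA : ∀ᵐ t : ℝ, ∀ᶠ i in L, (t ∈ S i ↔ t ∈ A)) (x : H) :
    Tendsto (fun i => E.toFun (S i) x) L (𝓝 (E.toFun A x)) := by
  have key : ∀ T : ι → Set ℝ, (∀ i, MeasurableSet (T i)) → (∀ᵐ t : ℝ, ∀ᶠ i in L, t ∉ T i) →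
      Tendsto (fun i => E.toFun (T i) x) L (𝓝 0) := by
    intro T hT hT0
    have h1 := tendsto_measure_of_ae_tendsto_indicator_of_isFiniteMeasure (μ := E.scalar x) L
      MeasurableSet.empty hT (by
        filter_upwards [(hac x).ae_le hT0] with t ht
        filter_upwards [ht] with i hi
        simp [hi])
    simp only [E.scalar_apply x (hT _), measure_empty] at h1
    have h2 : Tendsto (fun i => ‖E.toFun (T i) x‖ ^ 2) L (𝓝 0) := by
      have := (ENNReal.tendsto_toReal ENNReal.zero_ne_top).comp h1
      simpa [Function.comp_def] using this
    have h3 : Tendsto (fun i => ‖E.toFun (T i) x‖) L (𝓝 0) := by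
      have := (Real.continuous_sqrt.tendsto 0).comp h2
      simpa [Function.comp_def, Real.sqrt_sq (norm_nonneg _)] using this
    exact tendsto_zero_iff_norm_tendsto_zero.mpr h3
  have h1 := key (fun i => S i \ A) (fun i => (hS i).diff hA) (by
    filter_upwards [hSA] with t ht
    filter_upwards [ht] with i hi h using h.2 (hi.mp h.1))
  have h2 := key (fun i => A \ S i) (fun i => hA.diff (hS i)) (by
    filter_upwards [hSA] with t ht
    filter_upwards [ht] with i hi h using h.2 (hi.mpr h.1))
  have h3 := (h1.sub h2).add_const (E.toFun A x)
  rw [sub_zero, zero_add] at h3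
  refine h3.congr fun i => ?_
  have e1 := E.toFun_union ((hS i).inter hA) ((hS i).diff hA) disjoint_inf_sdiff x
  have e2 := E.toFun_union (hA.inter (hS i)) (hA.diff (hS i)) disjoint_inf_sdiff x
  rw [inter_union_sdiff] at e1 e2
  rw [e1, e2, inter_comm A]
  abel

/-- A single point is Lebesgue null, so the spectral family has no jumps. The contractivity of the
projections absorbs the variation of φ. -/
theorem IsAbsCont.tendsto_toFun_Iio (hac : E.IsAbsCont) {L : Filter ℝ} [L.IsCountablyGenerated]
    {c : ℝ} (hL : L ≤ 𝓝 c) {φ : ℝ → H} {y : H} (hφ : Tendsto φ L (𝓝 y)) :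
    Tendsto (fun v => E.toFun (Iio v) (φ v)) L (𝓝 (E.toFun (Iio c) y)) := by
  have h1 : Tendsto (fun v => E.toFun (Iio v) y) L (𝓝 (E.toFun (Iio c) y)) := by
    refine hac.tendsto_toFun (fun _ => measurableSet_Iio) measurableSet_Iio ?_ y
    have hne : ∀ᵐ t : ℝ, t ≠ c := by simp [ae_iff]
    filter_upwards [hne] with t ht
    rcases lt_or_gt_of_ne ht with h | h
    · filter_upwards [hL (Ioi_mem_nhds h)] with v hv
      simpa [h] using hv
    · filter_upwards [hL (Iio_mem_nhds h)] with v hv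
      have : ¬ t < v := not_lt.mpr (le_of_lt hv)
      simp [this, not_lt.mpr h.le]
  have h2 : Tendsto (fun v => E.toFun (Iio v) (φ v - y)) L (𝓝 0) := by
    refine squeeze_zero_norm (fun v => E.norm_toFun_apply_le measurableSet_Iio _) ?_
    have := (hφ.sub_const y).norm
    simpa using this
  have := h2.add h1
  rw [zero_add] at this
  refine this.congr fun v => ?_
  rw [map_sub, sub_add_cancel]

theorem IsAbsCont.continuousOn_toFun_Iio (hac : E.IsAbsCont) {φ : ℝ → H} {S : Set ℝ}
    (hφ : ContinuousOn φ S) : ContinuousOn (fun v => E.toFun (Iio v) (φ v)) S :=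
  fun v hv => hac.tendsto_toFun_Iio nhdsWithin_le_nhds (hφ v hv)

variable (E) in
/-- The value of the Riemann-Stieltjes integral `∫_{[u,v)} E(dμ) φ(μ)`, written by means of
integration by parts. -/
def byParts (φ φ' : ℝ → H) (u v : ℝ) : H :=
  E.toFun (Iio v) (φ v) - E.toFun (Iio u) (φ u) - ∫ μ in u..v, E.toFun (Iio μ) (φ' μ)

section ByParts

variable {φ φ' : ℝ → H} {α β u v w : ℝ}

theorem IsAbsCont.intervalIntegrable_toFun_Iio (hac : E.IsAbsCont) (huv : u ≤ v)
    (hφ' : ContinuousOn φ' (Icc u v)) :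
    IntervalIntegrable (fun μ => E.toFun (Iio μ) (φ' μ)) volume u v := by
  apply ContinuousOn.intervalIntegrable
  rw [uIcc_of_le huv]
  exact hac.continuousOn_toFun_Iio hφ'

theorem intervalIntegrable_toFun_apply {s : Set ℝ} (huv : u ≤ v)
    (hφ' : ContinuousOn φ' (Icc u v)) :
    IntervalIntegrable (fun μ => E.toFun s (φ' μ)) volume u v := by
  apply ContinuousOn.intervalIntegrable
  rw [uIcc_of_le huv]
  exact (E.toFun s).continuous.comp_continuousOn hφ'

/-- Replacing (-∞, μ) by [u, μ) costs E((-∞, u)) applied to an increment of φ. The result involves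
only projections onto subsets of [u, v). -/
theorem IsAbsCont.byParts_eq (hac : E.IsAbsCont) (huv : u ≤ v)
    (hφ : ∀ μ ∈ Icc u v, HasDerivAt φ (φ' μ) μ) (hφ' : ContinuousOn φ' (Icc u v)) :
    E.byParts φ φ' u v = E.toFun (Ico u v) (φ v) - ∫ μ in u..v, E.toFun (Ico u μ) (φ' μ) := by
  have hint : IntervalIntegrable φ' volume u v := by
    apply ContinuousOn.intervalIntegrable; rwa [uIcc_of_le huv]
  have h1 : ∫ μ in u..v, E.toFun (Ico u μ) (φ' μ) =
      (∫ μ in u..v, E.toFun (Iio μ) (φ' μ)) - E.toFun (Iio u) (φ v - φ u) := by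
    rw [← intervalIntegral.integral_eq_sub_of_hasDerivAt (by rwa [uIcc_of_le huv]) hint,
      ← ContinuousLinearMap.intervalIntegral_comp_comm _ hint,
      ← intervalIntegral.integral_sub (hac.intervalIntegrable_toFun_Iio huv hφ')
        (intervalIntegrable_toFun_apply huv hφ')]
    refine intervalIntegral.integral_congr fun μ hμ => ?_
    rw [uIcc_of_le huv] at hμ
    exact (E.toFun_Iio_sub hμ.1 _).symm
  rw [h1, ← E.toFun_Iio_sub huv, byParts, map_sub]
  abel

/-- Lying in the range of E([u, v)) makes the contributions of disjoint cells orthogonal. -/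
theorem IsAbsCont.toFun_byParts (hac : E.IsAbsCont) (huv : u ≤ v)
    (hφ : ∀ μ ∈ Icc u v, HasDerivAt φ (φ' μ) μ) (hφ' : ContinuousOn φ' (Icc u v)) :
    E.toFun (Ico u v) (E.byParts φ φ' u v) = E.byParts φ φ' u v := by
  have hint : IntervalIntegrable φ' volume u v := by
    apply ContinuousOn.intervalIntegrable; rwa [uIcc_of_le huv]
  have hint' : IntervalIntegrable (fun μ => E.toFun (Ico u μ) (φ' μ)) volume u v := by
    refine ((hac.intervalIntegrable_toFun_Iio huv hφ').sub
      (intervalIntegrable_toFun_apply (E := E) (s := Iio u) huv hφ')).congr fun μ hμ => ?_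
    rw [uIoc_of_le huv] at hμ
    exact E.toFun_Iio_sub hμ.1.le _
  rw [hac.byParts_eq huv hφ hφ', map_sub, E.toFun_apply_toFun_apply measurableSet_Ico
    measurableSet_Ico, inter_self, ← ContinuousLinearMap.intervalIntegral_comp_comm _ hint']
  congr 1
  refine intervalIntegral.integral_congr fun μ hμ => ?_
  rw [uIcc_of_le huv] at hμ
  rw [E.toFun_apply_toFun_apply measurableSet_Ico measurableSet_Ico, inter_eq_right.mpr
    (Ico_subset_Ico_right hμ.2)]

theorem IsAbsCont.byParts_add (hac : E.IsAbsCont) (huv : u ≤ v) (hvw : v ≤ w)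
    (hφ' : ContinuousOn φ' (Icc u w)) :
    E.byParts φ φ' u v + E.byParts φ φ' v w = E.byParts φ φ' u w := by
  rw [byParts, byParts, byParts, ← intervalIntegral.integral_add_adjacent_intervals
    (hac.intervalIntegrable_toFun_Iio huv (hφ'.mono (Icc_subset_Icc_right hvw)))
    (hac.intervalIntegrable_toFun_Iio hvw (hφ'.mono (Icc_subset_Icc_left huv)))]
  abel

theorem norm_toFun_sub_byParts_le (hac : E.IsAbsCont) (huv : u ≤ v)
    (hφ : ∀ μ ∈ Icc u v, HasDerivAt φ (φ' μ) μ) (hφ' : ContinuousOn φ' (Icc u v)) {L : ℝ}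
    (hL : ∀ μ ∈ Icc u v, ‖φ' μ‖ ≤ L) {ξ : ℝ} (hξ : ξ ∈ Icc u v) :
    ‖E.toFun (Ico u v) (φ ξ) - E.byParts φ φ' u v‖ ≤ 2 * L * (v - u) := by
  have hL0 : 0 ≤ L := (norm_nonneg _).trans (hL u ⟨le_rfl, huv⟩)
  have h1 : ‖φ ξ - φ v‖ ≤ L * (v - u) := by
    have := (convex_Icc u v).norm_image_sub_le_of_norm_hasDerivWithin_le
      (fun μ hμ => (hφ μ hμ).hasDerivWithinAt) hL ⟨huv, le_rfl⟩ hξ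
    refine this.trans ?_
    gcongr
    rw [Real.norm_eq_abs, abs_sub_comm, abs_of_nonneg (by linarith [hξ.2])]
    linarith [hξ.1]
  have h2 : ‖∫ μ in u..v, E.toFun (Ico u μ) (φ' μ)‖ ≤ L * |v - u| := by
    apply intervalIntegral.norm_integral_le_of_norm_le_const
    intro μ hμ
    rw [uIoc_of_le huv] at hμ
    exact (E.norm_toFun_apply_le measurableSet_Ico _).trans (hL μ (Ioc_subset_Icc_self hμ))
  rw [abs_of_nonneg (by linarith)] at h2
  rw [hac.byParts_eq huv hφ hφ', show E.toFun (Ico u v) (φ ξ) - (E.toFun (Ico u v) (φ v) -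
    ∫ μ in u..v, E.toFun (Ico u μ) (φ' μ)) = E.toFun (Ico u v) (φ ξ - φ v) +
    ∫ μ in u..v, E.toFun (Ico u μ) (φ' μ) by rw [map_sub]; abel]
  refine (norm_add_le _ _).trans ?_
  have h3 := E.norm_toFun_apply_le (s := Ico u v) measurableSet_Ico (φ ξ - φ v)
  linarith

variable {n : ℕ} {τ ξ : ℕ → ℝ}

theorem inner_toFun_Ico_eq_zero (hτ : ∀ i < n, τ i ≤ τ (i + 1)) {i j : ℕ} (hi : i < n) (hj : j < n)
    (hij : i ≠ j) (x y : H) : inner ℂ (E.toFun (Ico (τ i) (τ (i + 1))) x)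
      (E.toFun (Ico (τ j) (τ (j + 1))) y) = 0 := by
  have hmono : ∀ p q : ℕ, p ≤ q → q ≤ n → τ p ≤ τ q := by
    intro p q hpq
    induction q, hpq using Nat.le_induction with
    | base => exact fun _ => le_rfl
    | succ q hpq ih => exact fun h => (ih (by omega)).trans (hτ q (by omega))
  have hempty : Ico (τ i) (τ (i + 1)) ∩ Ico (τ j) (τ (j + 1)) = ∅ := by
    ext t
    simp only [mem_inter_iff, mem_Ico, mem_empty_iff_false, iff_false]
    rintro ⟨⟨h1, h2⟩, h3, h4⟩
    rcases lt_or_gt_of_ne hij with h | h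
    · have := hmono (i + 1) j h hj.le; linarith
    · have := hmono (j + 1) i h hi.le; linarith
  rw [E.inner_toFun_left measurableSet_Ico, E.toFun_apply_toFun_apply measurableSet_Ico
    measurableSet_Ico, hempty, E.empty]
  simp

/-- Pythagoras over the disjoint cells. Errors of order the cell length would add up to O(1) by the
triangle inequality, but their squares add up to O(mesh). -/
theorem norm_sq_sum_le (hτ : ∀ i < n, τ i ≤ τ (i + 1)) {x : ℕ → H} {c : ℕ → ℝ}
    (hx : ∀ i < n, E.toFun (Ico (τ i) (τ (i + 1))) (x i) = x i) (hc : ∀ i < n, ‖x i‖ ≤ c i) :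
    ‖∑ i ∈ Finset.range n, x i‖ ^ 2 ≤ ∑ i ∈ Finset.range n, c i ^ 2 := by
  suffices h : ∀ m ≤ n, ‖∑ i ∈ Finset.range m, x i‖ ^ 2 ≤ ∑ i ∈ Finset.range m, c i ^ 2 from
    h n le_rfl
  intro m
  induction m with
  | zero => simp
  | succ m ih =>
    intro hm
    rw [Finset.sum_range_succ, Finset.sum_range_succ]
    have h0 : inner ℂ (∑ i ∈ Finset.range m, x i) (x m) = 0 := by
      rw [sum_inner]
      refine Finset.sum_eq_zero fun i hi => ?_
      rw [Finset.mem_range] at hi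
      rw [← hx i (by omega), ← hx m (by omega)]
      exact inner_toFun_Ico_eq_zero hτ (by omega) (by omega) (by omega) _ _
    have h1 := norm_add_sq (𝕜 := ℂ) (∑ i ∈ Finset.range m, x i) (x m)
    rw [h0] at h1
    rw [h1]
    have h2 := ih (by omega)
    have h3 := hc m (by omega)
    have h4 : ‖x m‖ ^ 2 ≤ c m ^ 2 := by gcongr
    simp only [map_zero, mul_zero, add_zero]
    linarith

/-- The Riemann-Stieltjes sums of a continuously differentiable function converge. -/
theorem IsAbsCont.exists_norm_sum_sub_byParts_lt (hac : E.IsAbsCont) (hαβ : α ≤ β)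
    (hφ : ∀ μ ∈ Icc α β, HasDerivAt φ (φ' μ) μ) (hφ' : ContinuousOn φ' (Icc α β)) {ε : ℝ}
    (hε : 0 < ε) : ∃ δ > 0, ∀ (n : ℕ) (τ ξ : ℕ → ℝ), τ 0 = α → τ n = β →
    (∀ i < n, τ i ≤ τ (i + 1) ∧ τ (i + 1) - τ i < δ ∧ ξ i ∈ Icc (τ i) (τ (i + 1))) →
    ‖∑ i ∈ Finset.range n, E.toFun (Ico (τ i) (τ (i + 1))) (φ (ξ i)) - E.byParts φ φ' α β‖ < ε := by
  obtain ⟨L, hL⟩ := isCompact_Icc.exists_bound_of_continuousOn hφ'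
  -- The cell errors are at most 2L times the cell length, so with mesh below δ their squares sum to
  -- at most (2L)²δ(β - α). The choice δ = ε²/M makes this less than ε², and the added 1 keeps M
  -- positive when L = 0 or α = β.
  set M := (2 * L) ^ 2 * (β - α) + 1
  have hM : 0 < M := by have : 0 ≤ β - α := by linarith
                        positivity
  refine ⟨ε ^ 2 / M, by positivity, fun n τ ξ h0 hn h => ?_⟩
  have hτ : ∀ i < n, τ i ≤ τ (i + 1) := fun i hi => (h i hi).1
  have hmono : ∀ p q : ℕ, p ≤ q → q ≤ n → τ p ≤ τ q := by
    intro p q hpq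
    induction q, hpq using Nat.le_induction with
    | base => exact fun _ => le_rfl
    | succ q hpq ih => exact fun h => (ih (by omega)).trans (hτ q (by omega))
  have hsub : ∀ i < n, Icc (τ i) (τ (i + 1)) ⊆ Icc α β := fun i hi =>
    Icc_subset_Icc (h0 ▸ hmono 0 i (by omega) (by omega)) (hn ▸ hmono (i + 1) n (by omega) le_rfl)
  have htel : ∀ m ≤ n, ∑ i ∈ Finset.range m, E.byParts φ φ' (τ i) (τ (i + 1)) =
      E.byParts φ φ' α (τ m) := by
    intro m
    induction m with
    | zero => intro _; simp [byParts, h0]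
    | succ m ih =>
      intro hm
      rw [Finset.sum_range_succ, ih (by omega)]
      exact hac.byParts_add (h0 ▸ hmono 0 m (by omega) (by omega)) (hτ m (by omega))
        (hφ'.mono (Icc_subset_Icc_right (hn ▸ hmono (m + 1) n hm le_rfl)))
  have htel' : E.byParts φ φ' α β = ∑ i ∈ Finset.range n, E.byParts φ φ' (τ i) (τ (i + 1)) := by
    rw [htel n le_rfl, hn]
  rw [htel', ← Finset.sum_sub_distrib]
  have hsq := norm_sq_sum_le (E := E) hτ (x := fun i => E.toFun (Ico (τ i) (τ (i + 1))) (φ (ξ i)) -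
      E.byParts φ φ' (τ i) (τ (i + 1))) (c := fun i => 2 * L * (τ (i + 1) - τ i))
    (fun i hi => by
      simp only [map_sub]
      rw [hac.toFun_byParts (hτ i hi) (fun μ hμ => hφ μ (hsub i hi hμ)) (hφ'.mono (hsub i hi)),
        E.toFun_apply_toFun_apply measurableSet_Ico measurableSet_Ico, inter_self])
    (fun i hi => norm_toFun_sub_byParts_le hac (hτ i hi) (fun μ hμ => hφ μ (hsub i hi hμ))
      (hφ'.mono (hsub i hi)) (fun μ hμ => hL μ (hsub i hi hμ)) (h i hi).2.2)
  refine lt_of_pow_lt_pow_left₀ 2 hε.le (hsq.trans_lt ?_)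
  have hδ : 0 < ε ^ 2 / M := by positivity
  have h3 : ∑ i ∈ Finset.range n, (2 * L * (τ (i + 1) - τ i)) ^ 2 ≤
      ∑ i ∈ Finset.range n, (2 * L) ^ 2 * (ε ^ 2 / M) * (τ (i + 1) - τ i) := by
    refine Finset.sum_le_sum fun i hi => ?_
    rw [Finset.mem_range] at hi
    obtain ⟨e1, e2, -⟩ := h i hi
    have e3 : 0 ≤ τ (i + 1) - τ i := by linarith
    rw [mul_pow, mul_assoc]
    gcongr
    nlinarith
  refine h3.trans_lt ?_
  rw [← Finset.mul_sum, Finset.sum_range_sub, h0, hn]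
  have : (2 * L) ^ 2 * (ε ^ 2 / M) * (β - α) = ε ^ 2 * (((2 * L) ^ 2 * (β - α)) / M) := by ring
  rw [this]
  have h5 : (2 * L) ^ 2 * (β - α) / M < 1 := by
    rw [div_lt_one hM]; simp only [M]; linarith
  have : 0 < ε ^ 2 := by positivity
  nlinarith

end ByParts

end SpectralMeasure

/-! ### The angular operator -/

section AngularOperator

variable {H₀ H₁ : Type*} [NormedAddCommGroup H₀] [InnerProductSpace ℂ H₀] [CompleteSpace H₀]
  [NormedAddCommGroup H₁] [InnerProductSpace ℂ H₁] [CompleteSpace H₁]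
  {E : SpectralMeasure H₀} {a b : EReal}

/-- The resolvent `(Z - t)⁻¹` at a real point. -/
def realResolvent (Z : H₁ →L[ℂ] H₁) (t : ℝ) : H₁ →L[ℂ] H₁ :=
  Ring.inverse (Z - (t : ℂ) • (1 : H₁ →L[ℂ] H₁))

/-- The map T covers both uses, the resolvent itself (T = id) and the vectors B(Z - t)⁻¹x. -/
theorem hasDerivAt_realResolvent {V : Type*} [NormedAddCommGroup V] [NormedSpace ℂ V]
    {Z : H₁ →L[ℂ] H₁} {t : ℝ} (ht : (t : ℂ) ∉ spectrum ℂ Z) (T : (H₁ →L[ℂ] H₁) →L[ℂ] V) :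
    HasDerivAt (fun t => T (realResolvent Z t)) (T (realResolvent Z t * realResolvent Z t)) t := by
  have h1 := T.hasFDerivAt.comp_hasDerivAt (t : ℂ) (hasDerivAt_inverse_sub_smul_one ht)
  have h2 := h1.scomp t (Complex.ofRealCLM.hasDerivAt (x := t))
  rw [Complex.ofRealCLM_apply, Complex.ofReal_one, one_smul] at h2
  exact h2

/-- The function `t ↦ B (Z - t)⁻¹ x`. -/
def angularIntegrand (B : H₁ →L[ℂ] H₀) (Z : H₁ →L[ℂ] H₁) (x : H₁) (t : ℝ) : H₀ :=
  B (realResolvent Z t x)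

/-- The derivative of `t ↦ B (Z - t)⁻¹ x`. -/
def angularIntegrandDeriv (B : H₁ →L[ℂ] H₀) (Z : H₁ →L[ℂ] H₁) (x : H₁) (t : ℝ) : H₀ :=
  B (realResolvent Z t (realResolvent Z t x))

/-- The integral `∫_{[u,v)} E(dt) B (Z - t)⁻¹ x`. -/
def angularIntegral (E : SpectralMeasure H₀) (B : H₁ →L[ℂ] H₀) (Z : H₁ →L[ℂ] H₁) (x : H₁)
    (q : ℝ × ℝ) : H₀ :=
  E.byParts (angularIntegrand B Z x) (angularIntegrandDeriv B Z x) q.1 q.2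

variable {B : H₁ →L[ℂ] H₀} {Z : H₁ →L[ℂ] H₁} {α β : ℝ}

theorem hasDerivAt_angularIntegrand {t : ℝ} (ht : (t : ℂ) ∉ spectrum ℂ Z) (x : H₁) :
    HasDerivAt (angularIntegrand B Z x) (angularIntegrandDeriv B Z x t) t :=
  hasDerivAt_realResolvent ht (B.comp (ContinuousLinearMap.apply ℂ H₁ x))

theorem continuousAt_realResolvent {t : ℝ} (ht : (t : ℂ) ∉ spectrum ℂ Z) :
    ContinuousAt (realResolvent Z) t :=
  (hasDerivAt_realResolvent ht (ContinuousLinearMap.id ℂ _)).continuousAt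

theorem continuousAt_angularIntegrandDeriv {t : ℝ} (ht : (t : ℂ) ∉ spectrum ℂ Z) (x : H₁) :
    ContinuousAt (angularIntegrandDeriv B Z x) t := by
  have h1 := continuousAt_realResolvent ht
  exact B.continuous.continuousAt.comp (h1.clm_apply (h1.clm_apply continuousAt_const))

theorem hasStieltjes_angularIntegral (hac : E.IsAbsCont) (hαβ : α ≤ β)
    (hZ : ∀ t ∈ Icc α β, (t : ℂ) ∉ spectrum ℂ Z) (x : H₁) :
    HasStieltjes E (fun μ => B.comp (Ring.inverse (Z - (μ : ℂ) • (1 : H₁ →L[ℂ] H₁)))) x α β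
      (angularIntegral E B Z x (α, β)) := by
  intro ε hε
  exact hac.exists_norm_sum_sub_byParts_lt hαβ (fun t ht => hasDerivAt_angularIntegrand (hZ t ht) x)
    (fun t ht => (continuousAt_angularIntegrandDeriv (hZ t ht) x).continuousWithinAt) hε

/-- One sequence of uniform partitions with left tags serves all vectors x at once, so sesquilinear
identities can be checked on the sums. It also yields uniqueness of the integral. -/
theorem tendsto_sum_of_hasStieltjes {F : ℝ → (H₁ →L[ℂ] H₀)} {x : H₁} {v : H₀} (hαβ : α ≤ β)
    (h : HasStieltjes E F x α β v) :
    Tendsto (fun n : ℕ => ∑ i ∈ Finset.range n, E.toFun (Ico (α + (i : ℝ) / n * (β - α))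
      (α + ((i + 1 : ℕ) : ℝ) / n * (β - α))) (F (α + (i : ℝ) / n * (β - α)) x)) atTop (𝓝 v) := by
  rw [Metric.tendsto_atTop]
  intro ε hε
  obtain ⟨δ, hδ, hS⟩ := h ε hε
  obtain ⟨N, hN⟩ := exists_nat_gt ((β - α) / δ)
  refine ⟨N + 1, fun n hn => ?_⟩
  have hn0 : (0 : ℝ) < n := by
    have : 0 < n := by omega
    exact_mod_cast this
  have hNn : (N : ℝ) ≤ n := by exact_mod_cast (by omega : N ≤ n)
  have hlt : (β - α) / n < δ := by
    rw [div_lt_iff₀ hδ] at hN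
    rw [div_lt_iff₀ hn0]
    nlinarith
  have hdiff : ∀ i : ℕ, α + ((i + 1 : ℕ) : ℝ) / n * (β - α) - (α + (i : ℝ) / n * (β - α)) =
      (β - α) / n := by
    intro i; push_cast; ring
  have hd0 : 0 ≤ (β - α) / n := div_nonneg (by linarith) hn0.le
  rw [dist_eq_norm]
  refine hS n (fun i => α + (i : ℝ) / n * (β - α)) (fun i => α + (i : ℝ) / n * (β - α)) ?_ ?_
    fun i _ => ⟨?_, ?_, ?_, ?_⟩
  · simp
  · field_simp; ring
  · linarith [hdiff i]
  · linarith [hdiff i]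
  · exact le_rfl
  · linarith [hdiff i]

theorem HasStieltjes.unique {F : ℝ → (H₁ →L[ℂ] H₀)} {x : H₁} {v w : H₀} (hαβ : α ≤ β)
    (hv : HasStieltjes E F x α β v) (hw : HasStieltjes E F x α β w) : v = w :=
  tendsto_nhds_unique (tendsto_sum_of_hasStieltjes hαβ hv) (tendsto_sum_of_hasStieltjes hαβ hw)

theorem eventually_ends (hab : a < b) : ∀ᶠ q : ℝ × ℝ in leftEnd a ×ˢ rightEnd b,
    q.1 ∈ openIv a b ∧ q.2 ∈ openIv a b ∧ q.1 < q.2 := by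
  obtain ⟨m, hm⟩ := openIv_nonempty hab
  filter_upwards [(eventually_leftEnd_lt hm).prod_mk (eventually_rightEnd_gt hm)] with q hq
  exact ⟨hq.1.1, hq.2.1, hq.1.2.trans hq.2.2⟩

/-- Uniqueness on each [α, β) identifies the arbitrary values S with the by-parts formula, so later
results apply to every Y satisfying the definition. -/
theorem IsAngularOperator.tendsto_angularIntegral {Y : H₁ →L[ℂ] H₀} (hac : E.IsAbsCont)
    (hab : a < b) (hZ : ∀ t ∈ openIv a b, (t : ℂ) ∉ spectrum ℂ Z)
    (hY : IsAngularOperator E B a b Z Y) (x : H₁) :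
    Tendsto (angularIntegral E B Z x) (leftEnd a ×ˢ rightEnd b) (𝓝 (Y x)) := by
  obtain ⟨S, hS, hlim⟩ := hY x
  refine hlim.congr' ?_
  filter_upwards [eventually_ends hab] with q hq
  exact (hS q.1 hq.1 q.2 hq.2.1 hq.2.2).unique hq.2.2.le (hasStieltjes_angularIntegral hac hq.2.2.le
    (fun t ht => hZ t (Icc_subset_openIv hq.1 hq.2.1 ht)) x)

theorem isAngularOperator_of_tendsto {Y : H₁ →L[ℂ] H₀} (hac : E.IsAbsCont)
    (hZ : ∀ t ∈ openIv a b, (t : ℂ) ∉ spectrum ℂ Z)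
    (hY : ∀ x, Tendsto (angularIntegral E B Z x) (leftEnd a ×ˢ rightEnd b) (𝓝 (Y x))) :
    IsAngularOperator E B a b Z Y := fun x =>
  ⟨angularIntegral E B Z x, fun _ hα _ hβ hαβ => hasStieltjes_angularIntegral hac hαβ.le
    (fun t ht => hZ t (Icc_subset_openIv hα hβ ht)) x, hY x⟩

/-! ### Convergence at the ends and boundedness -/

section Limit

variable {C : ℝ}

theorem norm_angularIntegrand_le (hC : ∀ t ∈ openIv a b, ‖realResolvent Z t‖ * (1 + |t|) ≤ C)
    (x : H₁) {t : ℝ} (ht : t ∈ openIv a b) :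
    ‖angularIntegrand B Z x t‖ ≤ ‖B‖ * C * ‖x‖ * (1 + |t|)⁻¹ := by
  have h0 : 0 < 1 + |t| := by positivity
  have h1 : ‖realResolvent Z t‖ ≤ C * (1 + |t|)⁻¹ := by
    rw [← div_eq_mul_inv, le_div_iff₀ h0]; exact hC t ht
  calc ‖angularIntegrand B Z x t‖ ≤ ‖B‖ * (‖realResolvent Z t‖ * ‖x‖) :=
        (B.le_opNorm _).trans (by gcongr; exact ContinuousLinearMap.le_opNorm _ _)
    _ ≤ ‖B‖ * ((C * (1 + |t|)⁻¹) * ‖x‖) := by gcongr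
    _ = _ := by ring

theorem norm_angularIntegrandDeriv_le (hC : ∀ t ∈ openIv a b, ‖realResolvent Z t‖ * (1 + |t|) ≤ C)
    (x : H₁) {t : ℝ} (ht : t ∈ openIv a b) :
    ‖angularIntegrandDeriv B Z x t‖ ≤ ‖B‖ * C ^ 2 * ‖x‖ * (1 + t ^ 2)⁻¹ := by
  have h0 : 0 < 1 + |t| := by positivity
  have h1 : ‖realResolvent Z t‖ ≤ C * (1 + |t|)⁻¹ := by
    rw [← div_eq_mul_inv, le_div_iff₀ h0]; exact hC t ht
  have h3 : 0 ≤ C * (1 + |t|)⁻¹ := (norm_nonneg _).trans h1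
  have h2 : ((1 + |t|) ^ 2)⁻¹ ≤ (1 + t ^ 2)⁻¹ := by
    apply inv_anti₀ (by positivity)
    rw [add_sq, sq_abs]
    nlinarith [abs_nonneg t]
  calc ‖angularIntegrandDeriv B Z x t‖
      ≤ ‖B‖ * (‖realResolvent Z t‖ * (‖realResolvent Z t‖ * ‖x‖)) := by
        refine (B.le_opNorm _).trans ?_
        gcongr
        refine (ContinuousLinearMap.le_opNorm _ _).trans ?_
        gcongr
        exact ContinuousLinearMap.le_opNorm _ _
    _ ≤ ‖B‖ * ((C * (1 + |t|)⁻¹) * ((C * (1 + |t|)⁻¹) * ‖x‖)) := by gcongr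
    _ = ‖B‖ * C ^ 2 * ‖x‖ * ((1 + |t|) ^ 2)⁻¹ := by rw [← inv_pow]; ring
    _ ≤ _ := by gcongr

theorem integrableOn_toFun_angularIntegrandDeriv (hac : E.IsAbsCont)
    (hZ : ∀ t ∈ openIv a b, (t : ℂ) ∉ spectrum ℂ Z)
    (hC : ∀ t ∈ openIv a b, ‖realResolvent Z t‖ * (1 + |t|) ≤ C) (x : H₁) :
    IntegrableOn (fun t => E.toFun (Iio t) (angularIntegrandDeriv B Z x t)) (openIv a b) := by
  have hm : MeasurableSet (openIv a b) := (isOpen_openIv a b).measurableSet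
  refine Integrable.mono' ((integrable_inv_one_add_sq.const_mul (‖B‖ * C ^ 2 * ‖x‖)).integrableOn) ?_ ?_
  · refine (hac.continuousOn_toFun_Iio fun t ht => ?_).aestronglyMeasurable hm
    exact (continuousAt_angularIntegrandDeriv (hZ t ht) x).continuousWithinAt
  · filter_upwards [ae_restrict_mem hm] with t ht
    exact (E.norm_toFun_apply_le measurableSet_Iio _).trans (norm_angularIntegrandDeriv_le hC x ht)

/-- At a finite end the resolvent is still continuous, the end point being outside the spectrum. At
an infinite end the boundary term decays like (1 + |t|)⁻¹. -/
theorem exists_tendsto_toFun_angularIntegrand_left (hac : E.IsAbsCont) (hab : a < b)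
    (hC : ∀ t ∈ openIv a b, ‖realResolvent Z t‖ * (1 + |t|) ≤ C)
    (ha : ∀ c : ℝ, a = c → (c : ℂ) ∉ spectrum ℂ Z) (x : H₁) :
    ∃ y, Tendsto (fun t => E.toFun (Iio t) (angularIntegrand B Z x t)) (leftEnd a) (𝓝 y) := by
  obtain ⟨m, hm⟩ := openIv_nonempty hab
  induction a with
  | top => exact absurd hab not_top_lt
  | coe c =>
    rw [leftEnd_coe]
    exact ⟨_, hac.tendsto_toFun_Iio nhdsWithin_le_nhds
      ((hasDerivAt_angularIntegrand (ha c rfl) x).continuousAt.mono_left nhdsWithin_le_nhds)⟩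
  | bot =>
    refine ⟨0, squeeze_zero_norm' (a := fun t => ‖B‖ * C * ‖x‖ * (1 + |t|)⁻¹) ?_ ?_⟩
    · filter_upwards [eventually_leftEnd_lt hm] with t ht
      exact (E.norm_toFun_apply_le measurableSet_Iio _).trans (norm_angularIntegrand_le hC x ht.1)
    · rw [leftEnd_bot]
      have := (tendsto_inv_atTop_zero.comp (tendsto_atTop_add_const_left _ (1 : ℝ)
        tendsto_abs_atBot_atTop)).const_mul (‖B‖ * C * ‖x‖)
      rwa [mul_zero] at this

theorem exists_tendsto_toFun_angularIntegrand_right (hac : E.IsAbsCont) (hab : a < b)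
    (hC : ∀ t ∈ openIv a b, ‖realResolvent Z t‖ * (1 + |t|) ≤ C)
    (hb : ∀ c : ℝ, b = c → (c : ℂ) ∉ spectrum ℂ Z) (x : H₁) :
    ∃ y, Tendsto (fun t => E.toFun (Iio t) (angularIntegrand B Z x t)) (rightEnd b) (𝓝 y) := by
  obtain ⟨m, hm⟩ := openIv_nonempty hab
  induction b with
  | bot => exact absurd hab not_lt_bot
  | coe c =>
    rw [rightEnd_coe]
    exact ⟨_, hac.tendsto_toFun_Iio nhdsWithin_le_nhds
      ((hasDerivAt_angularIntegrand (hb c rfl) x).continuousAt.mono_left nhdsWithin_le_nhds)⟩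
  | top =>
    refine ⟨0, squeeze_zero_norm' (a := fun t => ‖B‖ * C * ‖x‖ * (1 + |t|)⁻¹) ?_ ?_⟩
    · filter_upwards [eventually_rightEnd_gt hm] with t ht
      exact (E.norm_toFun_apply_le measurableSet_Iio _).trans (norm_angularIntegrand_le hC x ht.1)
    · rw [rightEnd_top]
      have := (tendsto_inv_atTop_zero.comp (tendsto_atTop_add_const_left _ (1 : ℝ)
        tendsto_abs_atTop_atTop)).const_mul (‖B‖ * C * ‖x‖)
      rwa [mul_zero] at this

/-- The bound is uniform in the truncation, so it passes to the limit and shows that Y is bounded.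
-/
theorem norm_angularIntegral_le (hC0 : 0 ≤ C)
    (hC : ∀ t ∈ openIv a b, ‖realResolvent Z t‖ * (1 + |t|) ≤ C) (x : H₁) {q : ℝ × ℝ}
    (hq : q.1 ∈ openIv a b ∧ q.2 ∈ openIv a b ∧ q.1 < q.2) :
    ‖angularIntegral E B Z x q‖ ≤ (2 * (‖B‖ * C) + ‖B‖ * C ^ 2 * ∫ t : ℝ, (1 + t ^ 2)⁻¹) * ‖x‖ := by
  have h1 : ∀ t ∈ openIv a b, ‖E.toFun (Iio t) (angularIntegrand B Z x t)‖ ≤ ‖B‖ * C * ‖x‖ := by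
    intro t ht
    refine (E.norm_toFun_apply_le measurableSet_Iio _).trans ((norm_angularIntegrand_le hC x ht).trans ?_)
    refine mul_le_of_le_one_right (by positivity) (inv_le_one_of_one_le₀ ?_)
    linarith [abs_nonneg t]
  have h2 : ‖∫ t in q.1..q.2, E.toFun (Iio t) (angularIntegrandDeriv B Z x t)‖ ≤
      ‖B‖ * C ^ 2 * ‖x‖ * ∫ t : ℝ, (1 + t ^ 2)⁻¹ := by
    have hi : Integrable (fun t : ℝ => ‖B‖ * C ^ 2 * ‖x‖ * (1 + t ^ 2)⁻¹) :=
      integrable_inv_one_add_sq.const_mul _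
    refine (intervalIntegral.norm_integral_le_of_norm_le hq.2.2.le (ae_of_all _ fun t ht =>
      (E.norm_toFun_apply_le measurableSet_Iio _).trans (norm_angularIntegrandDeriv_le hC x
        (Icc_subset_openIv hq.1 hq.2.1 (Ioc_subset_Icc_self ht)))) hi.intervalIntegrable).trans ?_
    rw [← integral_const_mul, intervalIntegral.integral_of_le hq.2.2.le]
    exact setIntegral_le_integral hi (ae_of_all _ fun t => by positivity)
  rw [angularIntegral, SpectralMeasure.byParts]
  refine (norm_sub_le _ _).trans ((add_le_add (norm_sub_le _ _) h2).trans ?_)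
  linarith [h1 _ hq.1, h1 _ hq.2.1]

theorem angularIntegral_linear (hac : E.IsAbsCont) {q : ℝ × ℝ} (hq : q.1 ≤ q.2)
    (hZ : ∀ t ∈ Icc q.1 q.2, (t : ℂ) ∉ spectrum ℂ Z) (x y : H₁) (c : ℂ) :
    angularIntegral E B Z (c • x + y) q = c • angularIntegral E B Z x q + angularIntegral E B Z y q := by
  have hi : ∀ z : H₁, IntervalIntegrable (fun t => E.toFun (Iio t) (angularIntegrandDeriv B Z z t))
      volume q.1 q.2 := fun z => hac.intervalIntegrable_toFun_Iio hq fun t ht =>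
    (continuousAt_angularIntegrandDeriv (hZ t ht) z).continuousWithinAt
  have h1 : ∀ t, angularIntegrand B Z (c • x + y) t =
      c • angularIntegrand B Z x t + angularIntegrand B Z y t := fun t => by simp [angularIntegrand]
  have h2 : ∀ t, angularIntegrandDeriv B Z (c • x + y) t =
      c • angularIntegrandDeriv B Z x t + angularIntegrandDeriv B Z y t := fun t => by
    simp [angularIntegrandDeriv]
  simp only [angularIntegral, SpectralMeasure.byParts, h1, h2, map_add, map_smul]
  have h3 := intervalIntegral.integral_add (((hi x).smul c)) (hi y)
  simp only [Pi.smul_apply, intervalIntegral.integral_smul] at h3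
  rw [h3]
  module

theorem exists_tendsto_angularIntegral (hac : E.IsAbsCont) (hab : a < b)
    (hZ : ∀ t ∈ openIv a b, (t : ℂ) ∉ spectrum ℂ Z) (hC0 : 0 ≤ C)
    (hC : ∀ t ∈ openIv a b, ‖realResolvent Z t‖ * (1 + |t|) ≤ C)
    (ha : ∀ c : ℝ, a = c → (c : ℂ) ∉ spectrum ℂ Z) (hb : ∀ c : ℝ, b = c → (c : ℂ) ∉ spectrum ℂ Z) :
    ∃ Y : H₁ →L[ℂ] H₀, ∀ x,
      Tendsto (angularIntegral E B Z x) (leftEnd a ×ˢ rightEnd b) (𝓝 (Y x)) := by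
  have hl := leftEnd_neBot hab
  have hr := rightEnd_neBot hab
  have hex : ∀ x, ∃ y, Tendsto (angularIntegral E B Z x) (leftEnd a ×ˢ rightEnd b) (𝓝 y) := by
    intro x
    obtain ⟨y₁, h₁⟩ := exists_tendsto_toFun_angularIntegrand_left (B := B) hac hab hC ha x
    obtain ⟨y₂, h₂⟩ := exists_tendsto_toFun_angularIntegrand_right (B := B) hac hab hC hb x
    exact ⟨_, ((h₂.comp tendsto_snd).sub (h₁.comp tendsto_fst)).sub
      (tendsto_intervalIntegral_ends hab (integrableOn_toFun_angularIntegrandDeriv hac hZ hC x))⟩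
  choose y hy using hex
  have hlin : ∀ (c : ℂ) (x x' : H₁), y (c • x + x') = c • y x + y x' := by
    intro c x x'
    refine tendsto_nhds_unique (hy (c • x + x')) ((((hy x).const_smul c).add (hy x')).congr' ?_)
    filter_upwards [eventually_ends hab] with q hq
    exact (angularIntegral_linear hac hq.2.2.le
      (fun t ht => hZ t (Icc_subset_openIv hq.1 hq.2.1 ht)) x x' c).symm
  have hzero : y 0 = 0 := by
    have := hlin 1 0 0
    simpa using this
  let L : H₁ →ₗ[ℂ] H₀ :=
    { toFun := y
      map_add' := fun x x' => by simpa using hlin 1 x x'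
      map_smul' := fun c x => by simpa [hzero] using hlin c x 0 }
  refine ⟨L.mkContinuous (2 * (‖B‖ * C) + ‖B‖ * C ^ 2 * ∫ t : ℝ, (1 + t ^ 2)⁻¹) fun x => ?_, hy⟩
  exact le_of_tendsto (hy x).norm ((eventually_ends hab).mono fun q hq =>
    norm_angularIntegral_le hC0 hC x hq)

end Limit

/-- Integration by parts is undone in weak form: tested against By, the spectral family becomes K_B,
which is norm differentiable, and (K_B R)' = K_B' R + K_B R² for R = (Z - t)⁻¹. -/
theorem inner_angularIntegral (hac : E.IsAbsCont) (hαβ : α ≤ β)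
    (hZ : ∀ t ∈ Icc α β, (t : ℂ) ∉ spectrum ℂ Z) {k : ℝ → (H₁ →L[ℂ] H₁)}
    (hk : ∀ t ∈ Icc α β, HasDerivAt (KB E B) (k t) t) (hkc : ContinuousOn k (Icc α β)) (x y : H₁) :
    inner ℂ (B y) (angularIntegral E B Z x (α, β)) =
      ∫ t in α..β, inner ℂ y (k t (realResolvent Z t x)) := by
  have hKB : ∀ (t : ℝ) (z : H₁), inner ℂ (B y) (E.toFun (Iio t) (B z)) = inner ℂ y (KB E B t z) := by
    intro t z
    rw [KB, ContinuousLinearMap.comp_apply, ContinuousLinearMap.adjoint_inner_right]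
    rfl
  have hi : IntervalIntegrable (fun t => E.toFun (Iio t) (angularIntegrandDeriv B Z x t))
      volume α β := hac.intervalIntegrable_toFun_Iio hαβ fun t ht =>
    (continuousAt_angularIntegrandDeriv (hZ t ht) x).continuousWithinAt
  have h1 : inner ℂ (B y) (∫ t in α..β, E.toFun (Iio t) (angularIntegrandDeriv B Z x t)) =
      ∫ t in α..β, inner ℂ y (KB E B t (realResolvent Z t (realResolvent Z t x))) := by
    have := ContinuousLinearMap.intervalIntegral_comp_comm (innerSL ℂ (B y)) hi
    simp only [innerSL_apply_apply] at this
    rw [← this]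
    exact intervalIntegral.integral_congr fun t _ => hKB t _
  have hRc : ContinuousOn (realResolvent Z) (Icc α β) := fun t ht =>
    (continuousAt_realResolvent (hZ t ht)).continuousWithinAt
  have hKc : ContinuousOn (KB E B) (Icc α β) := fun t ht =>
    (hk t ht).continuousAt.continuousWithinAt
  have hI1 : IntervalIntegrable (fun t => inner ℂ y (k t (realResolvent Z t x))) volume α β := by
    apply ContinuousOn.intervalIntegrable
    rw [uIcc_of_le hαβ]
    exact continuousOn_const.inner (𝕜 := ℂ) (hkc.clm_apply (hRc.clm_apply continuousOn_const))
  have hI2 : IntervalIntegrable (fun t => inner ℂ y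
      (KB E B t (realResolvent Z t (realResolvent Z t x)))) volume α β := by
    apply ContinuousOn.intervalIntegrable
    rw [uIcc_of_le hαβ]
    exact continuousOn_const.inner (𝕜 := ℂ) (hKc.clm_apply (hRc.clm_apply
      (hRc.clm_apply continuousOn_const)))
  have hder : ∀ t ∈ uIcc α β, HasDerivAt (fun t => inner ℂ y (KB E B t (realResolvent Z t x)))
      (inner ℂ y (k t (realResolvent Z t x)) +
        inner ℂ y (KB E B t (realResolvent Z t (realResolvent Z t x)))) t := by
    intro t ht
    rw [uIcc_of_le hαβ] at ht
    have e1 : HasDerivAt (fun t => KB E B t * realResolvent Z t)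
        (k t * realResolvent Z t + KB E B t * (realResolvent Z t * realResolvent Z t)) t :=
      (hk t ht).mul (hasDerivAt_realResolvent (hZ t ht) (ContinuousLinearMap.id ℂ _))
    have e2 := (((innerSL ℂ y).comp (ContinuousLinearMap.apply ℂ H₁ x)).restrictScalars
      ℝ).hasFDerivAt.comp_hasDerivAt t e1
    exact e2.congr_deriv (by simp [inner_add_right])
  have hFTC := intervalIntegral.integral_eq_sub_of_hasDerivAt hder (hI1.add hI2)
  rw [intervalIntegral.integral_add hI1 hI2] at hFTC
  rw [angularIntegral, SpectralMeasure.byParts, inner_sub_right, inner_sub_right, h1]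
  simp only [angularIntegrand, hKB]
  linear_combination -hFTC

theorem inner_sum_toFun_Ico {n : ℕ} {τ : ℕ → ℝ} (hτ : ∀ i < n, τ i ≤ τ (i + 1)) (x y : ℕ → H₀) :
    inner ℂ (∑ i ∈ Finset.range n, E.toFun (Ico (τ i) (τ (i + 1))) (x i))
      (∑ i ∈ Finset.range n, E.toFun (Ico (τ i) (τ (i + 1))) (y i)) =
    ∑ i ∈ Finset.range n, inner ℂ (x i) (E.toFun (Ico (τ i) (τ (i + 1))) (y i)) := by
  rw [sum_inner]
  refine Finset.sum_congr rfl fun i hi => ?_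
  rw [inner_sum, Finset.sum_eq_single_of_mem i hi]
  · rw [E.inner_toFun_left measurableSet_Ico, E.toFun_apply_toFun_apply measurableSet_Ico
      measurableSet_Ico, inter_self]
  · intro j hj hji
    exact SpectralMeasure.inner_toFun_Ico_eq_zero hτ (Finset.mem_range.mp hi)
      (Finset.mem_range.mp hj) hji.symm _ _

/-- The operator `∫ t E(dt) B (Z - t)⁻¹` is symmetric with respect to the angular operator. -/
theorem inner_angularIntegral_symm (hac : E.IsAbsCont) (hαβ : α ≤ β)
    (hZ : ∀ t ∈ Icc α β, (t : ℂ) ∉ spectrum ℂ Z) (x y : H₁) :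
    inner ℂ (angularIntegral E B Z (Z x) (α, β)) (angularIntegral E B Z y (α, β)) -
        inner ℂ (B x) (angularIntegral E B Z y (α, β)) =
      inner ℂ (angularIntegral E B Z x (α, β)) (angularIntegral E B Z (Z y) (α, β)) -
        inner ℂ (angularIntegral E B Z x (α, β)) (B y) := by
  have hlim := fun z => tendsto_sum_of_hasStieltjes hαβ
    (hasStieltjes_angularIntegral (B := B) hac hαβ hZ z)
  have hL := ((hlim (Z x)).inner (𝕜 := ℂ) (hlim y)).sub
    ((tendsto_const_nhds (x := B x)).inner (𝕜 := ℂ) (hlim y))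
  have hR := ((hlim x).inner (𝕜 := ℂ) (hlim (Z y))).sub
    ((hlim x).inner (𝕜 := ℂ) (tendsto_const_nhds (x := B y)))
  refine tendsto_nhds_unique hL (hR.congr' ?_)
  -- The symmetry holds exactly for each sum with n > 0, since all sums share one partition and its
  -- tags.
  filter_upwards [eventually_gt_atTop 0] with n hn
  have hn0 : (0 : ℝ) < n := by exact_mod_cast hn
  set τ : ℕ → ℝ := fun i => α + (i : ℝ) / n * (β - α)
  have hτ : ∀ i < n, τ i ≤ τ (i + 1) := by
    intro i _
    simp only [τ]
    have h0 : 0 ≤ β - α := by linarith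
    have h1 : (i : ℝ) / n ≤ ((i + 1 : ℕ) : ℝ) / n := by gcongr; simp
    have := mul_le_mul_of_nonneg_right h1 h0
    linarith
  have hmem : ∀ i ∈ Finset.range n, τ i ∈ Icc α β := by
    intro i hi
    have hi' : (i : ℝ) / n ≤ 1 := by
      rw [div_le_one hn0]; exact_mod_cast (Finset.mem_range.mp hi).le
    have hi0 : 0 ≤ (i : ℝ) / n := by positivity
    simp only [τ]
    constructor <;> nlinarith
  set R : ℝ → (H₁ →L[ℂ] H₁) := realResolvent Z
  change inner ℂ (∑ i ∈ Finset.range n, E.toFun (Ico (τ i) (τ (i + 1))) (B (R (τ i) x)))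
      (∑ i ∈ Finset.range n, E.toFun (Ico (τ i) (τ (i + 1))) (B (R (τ i) (Z y)))) -
    inner ℂ (∑ i ∈ Finset.range n, E.toFun (Ico (τ i) (τ (i + 1))) (B (R (τ i) x))) (B y) =
    inner ℂ (∑ i ∈ Finset.range n, E.toFun (Ico (τ i) (τ (i + 1))) (B (R (τ i) (Z x))))
      (∑ i ∈ Finset.range n, E.toFun (Ico (τ i) (τ (i + 1))) (B (R (τ i) y))) -
    inner ℂ (B x) (∑ i ∈ Finset.range n, E.toFun (Ico (τ i) (τ (i + 1))) (B (R (τ i) y)))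
  rw [inner_sum_toFun_Ico hτ, inner_sum_toFun_Ico hτ, sum_inner, inner_sum,
    ← Finset.sum_sub_distrib, ← Finset.sum_sub_distrib]
  refine Finset.sum_congr rfl fun i hi => ?_
  -- From R(τ)Z = τR(τ) + 1, the summand 1 cancels the terms with B, and the term with the real
  -- number τ is symmetric.
  have hRZ : ∀ z : H₁, R (τ i) (Z z) = ((τ i : ℝ) : ℂ) • R (τ i) z + z := by
    intro z
    have h1 : R (τ i) * (Z - ((τ i : ℝ) : ℂ) • (1 : H₁ →L[ℂ] H₁)) = 1 :=
      Ring.inverse_mul_cancel _ (isUnit_sub_smul_one (hZ _ (hmem i hi)))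
    have h2 := congrArg (fun T : H₁ →L[ℂ] H₁ => T z) h1
    simp only [mul_apply_eq_comp, sub_apply, smul_apply, one_apply_eq_self, map_sub, map_smul] at h2
    exact sub_eq_iff_eq_add'.mp h2
  rw [hRZ, hRZ, E.inner_toFun_left measurableSet_Ico]
  simp only [map_add, map_smul, inner_add_left, inner_add_right, inner_smul_left, inner_smul_right,
    Complex.conj_ofReal]
  ring

end AngularOperator

/-! ### Location of the spectrum of Z -/

section Spectrum

variable {H₀ H₁ : Type*} [NormedAddCommGroup H₀] [InnerProductSpace ℂ H₀] [CompleteSpace H₀]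
  [NormedAddCommGroup H₁] [InnerProductSpace ℂ H₁] [CompleteSpace H₁]

/-- An operator which is symmetric with respect to a strictly positive inner product has real
spectrum. -/
theorem im_eq_zero_of_mem_spectrum {Y : H₁ →L[ℂ] H₀} (hY : ‖Y‖ < 1) {Z : H₁ →L[ℂ] H₁}
    (hZ : ∀ x y, inner ℂ (Z x) y - inner ℂ (Y (Z x)) (Y y) =
      inner ℂ x (Z y) - inner ℂ (Y x) (Y (Z y))) {z : ℂ} (hz : z ∈ spectrum ℂ Z) : z.im = 0 := by
  by_contra him
  set S : H₁ →L[ℂ] H₁ := 1 - (ContinuousLinearMap.adjoint Y).comp Y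
  have hS : ∀ x y, inner ℂ (S x) y = inner ℂ x y - inner ℂ (Y x) (Y y) := by
    intro x y
    simp only [S, sub_apply, one_apply_eq_self, ContinuousLinearMap.comp_apply, inner_sub_left,
      ContinuousLinearMap.adjoint_inner_left]
  have hSxx : ∀ x, inner ℂ (S x) x = ((‖x‖ ^ 2 - ‖Y x‖ ^ 2 : ℝ) : ℂ) := by
    intro x
    rw [hS, inner_self_eq_norm_sq_to_K, inner_self_eq_norm_sq_to_K]
    norm_cast
  have hpos : 0 < 1 - ‖Y‖ ^ 2 := by nlinarith [norm_nonneg Y]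
  have hlow : ∀ x, (1 - ‖Y‖ ^ 2) * ‖x‖ ^ 2 ≤ ‖x‖ ^ 2 - ‖Y x‖ ^ 2 := by
    intro x
    have : ‖Y x‖ ^ 2 ≤ (‖Y‖ * ‖x‖) ^ 2 := by gcongr; exact Y.le_opNorm x
    nlinarith
  have hSu : IsUnit S := by
    refine ContinuousLinearMap.isUnit_of_forall_le_norm_inner_map S (c := Real.toNNReal (1 - ‖Y‖ ^ 2))
      (Real.toNNReal_pos.mpr hpos) fun x => ?_
    rw [hSxx, Complex.norm_real, Real.norm_eq_abs, Real.coe_toNNReal _ hpos.le]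
    exact ((mul_comm _ _).le.trans (hlow x)).trans (le_abs_self _)
  -- ⟨SZx, x⟩ is real, so |Im ⟨S(Z - z)x, x⟩| = |Im z|⟨Sx, x⟩ ≥ |Im z|(1 - ‖Y‖²)‖x‖². This
  -- coercivity makes S(Z - z) invertible, and S can be cancelled.
  have hTu : IsUnit (S * (Z - z • (1 : H₁ →L[ℂ] H₁))) := by
    have hc : 0 < |z.im| * (1 - ‖Y‖ ^ 2) := mul_pos (abs_pos.mpr him) hpos
    refine ContinuousLinearMap.isUnit_of_forall_le_norm_inner_map _ 
      (c := Real.toNNReal (|z.im| * (1 - ‖Y‖ ^ 2))) (Real.toNNReal_pos.mpr hc) fun x => ?_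
    rw [Real.coe_toNNReal _ hc.le]
    have h1 : inner ℂ ((S * (Z - z • (1 : H₁ →L[ℂ] H₁))) x) x =
        inner ℂ (S (Z x)) x - conj z * ((‖x‖ ^ 2 - ‖Y x‖ ^ 2 : ℝ) : ℂ) := by
      rw [← hSxx]
      simp only [mul_apply_eq_comp, sub_apply, smul_apply, one_apply_eq_self, map_sub, map_smul,
        inner_sub_left, inner_smul_left]
    have h2 : (inner ℂ (S (Z x)) x).im = 0 := by
      have h3 : conj (inner ℂ (S (Z x)) x) = inner ℂ (S (Z x)) x := by
        rw [hS, map_sub, inner_conj_symm, inner_conj_symm, hZ]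
      exact Complex.conj_eq_iff_im.mp h3
    have h4 := Complex.abs_im_le_norm (inner ℂ ((S * (Z - z • (1 : H₁ →L[ℂ] H₁))) x) x)
    rw [h1, Complex.sub_im, h2, Complex.im_mul_ofReal, Complex.conj_im, zero_sub, neg_mul, neg_neg,
      abs_mul, abs_of_nonneg ((by positivity : (0:ℝ) ≤ (1 - ‖Y‖ ^ 2) * ‖x‖ ^ 2).trans (hlow x)),
      ← h1] at h4
    refine le_trans ?_ h4
    rw [mul_comm, mul_assoc]
    exact mul_le_mul_of_nonneg_left (hlow x) (abs_nonneg _)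
  have hu : IsUnit (Z - z • (1 : H₁ →L[ℂ] H₁)) := hSu.mul_left_iff.mp hTu
  rw [spectrum.mem_iff, Algebra.algebraMap_eq_smul_one] at hz
  exact hz (by simpa using hu.neg)

/-- For self-adjoint A the norm of (A - t)⁻¹ is its spectral radius, attained at some ν, and ν⁻¹ + t
is a spectral point of A at distance ‖(A - t)⁻¹‖⁻¹ from t. If this exceeded ‖X‖, a Neumann series
would invert A + X - t. -/
theorem exists_mem_spectrum_norm_sub_le {A X : H₁ →L[ℂ] H₁} (hA : IsSelfAdjoint A) {t : ℝ}
    (ht : (t : ℂ) ∈ spectrum ℂ (A + X)) : ∃ s ∈ spectrum ℂ A, ‖s - t‖ ≤ ‖X‖ := by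
  by_contra! hcon
  have htA : (t : ℂ) ∉ spectrum ℂ A := fun h => by
    have := hcon _ h
    rw [sub_self, norm_zero] at this
    exact absurd this (not_lt.mpr (norm_nonneg X))
  obtain ⟨u, hu⟩ := isUnit_sub_smul_one htA
  have hnt : Nontrivial (H₁ →L[ℂ] H₁) := by
    by_contra h
    rw [not_nontrivial_iff_subsingleton] at h
    rw [spectrum.of_subsingleton] at ht
    exact ht
  have husa : IsSelfAdjoint (u : H₁ →L[ℂ] H₁) := by
    rw [hu, IsSelfAdjoint, star_sub, hA.star_eq, star_smul, star_one]
    simp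
  have huinv : IsSelfAdjoint ((u⁻¹ : (H₁ →L[ℂ] H₁)ˣ) : H₁ →L[ℂ] H₁) := by
    rw [IsSelfAdjoint, ← Units.coe_star, star_inv]
    congr 2
    exact Units.ext husa
  obtain ⟨ν, hν, hνn⟩ := spectrum.exists_nnnorm_eq_spectralRadius
    ((u⁻¹ : (H₁ →L[ℂ] H₁)ˣ) : H₁ →L[ℂ] H₁)
  rw [huinv.spectralRadius_eq_nnnorm] at hνn
  have hνn' : ‖ν‖ = ‖((u⁻¹ : (H₁ →L[ℂ] H₁)ˣ) : H₁ →L[ℂ] H₁)‖ := by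
    exact congrArg NNReal.toReal (ENNReal.coe_injective hνn)
  have hν' : ν⁻¹ ∈ spectrum ℂ (u : H₁ →L[ℂ] H₁) := by
    rw [← spectrum.map_inv] at hν
    exact hν
  have hs : ν⁻¹ + t ∈ spectrum ℂ A := by
    rw [hu, spectrum.mem_iff, Algebra.algebraMap_eq_smul_one] at hν'
    rw [spectrum.mem_iff, Algebra.algebraMap_eq_smul_one, add_smul]
    convert! hν' using 2
    abel
  have hlt := hcon _ hs
  rw [add_sub_cancel_right, norm_inv, hνn'] at hlt
  have hpos : 0 < ‖((u⁻¹ : (H₁ →L[ℂ] H₁)ˣ) : H₁ →L[ℂ] H₁)‖ := norm_pos_iff.mpr (Units.ne_zero _)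
  have hsmall : ‖-(((u⁻¹ : (H₁ →L[ℂ] H₁)ˣ) : H₁ →L[ℂ] H₁) * X)‖ < 1 := by
    rw [norm_neg]
    refine (norm_mul_le _ _).trans_lt ?_
    calc _ < ‖((u⁻¹ : (H₁ →L[ℂ] H₁)ˣ) : H₁ →L[ℂ] H₁)‖ *
          ‖((u⁻¹ : (H₁ →L[ℂ] H₁)ˣ) : H₁ →L[ℂ] H₁)‖⁻¹ := by gcongr
      _ = 1 := mul_inv_cancel₀ hpos.ne'
  have hunit : IsUnit (1 - -(((u⁻¹ : (H₁ →L[ℂ] H₁)ˣ) : H₁ →L[ℂ] H₁) * X)) :=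
    isUnit_one_sub_of_norm_lt_one hsmall
  have hfin : IsUnit (A + X - (t : ℂ) • (1 : H₁ →L[ℂ] H₁)) := by
    have h1 := u.isUnit.mul hunit
    rw [sub_neg_eq_add, mul_add, mul_one, Units.mul_inv_cancel_left, hu] at h1
    convert! h1 using 1
    abel
  rw [spectrum.mem_iff, Algebra.algebraMap_eq_smul_one] at ht
  exact ht (by simpa using hfin.neg)

end Spectrum

/-! ### The transformed operator and the contour -/

section Contour

variable {H₀ H₁ : Type*} [NormedAddCommGroup H₀] [InnerProductSpace ℂ H₀] [CompleteSpace H₀]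
  [NormedAddCommGroup H₁] [InnerProductSpace ℂ H₁] [CompleteSpace H₁]
  {a b : EReal} {W : Set ℂ} {γ : ℝ → ℂ} {Z : H₁ →L[ℂ] H₁} {k : ℂ → (H₁ →L[ℂ] H₁)}

/-- Finite variation times a bounded resolvent. It allows functionals to be taken inside the
operator-valued integral defining W₁. -/
theorem integrableOn_W1_integrand (hγ : IsAdmissible a b W k γ)
    (hk : ContinuousOn k (W ∪ openIvC a b)) (hZ : ∀ z ∈ closure W, z ∉ spectrum ℂ Z) {C : ℝ}
    (hC : ∀ z ∈ closure W, ‖Ring.inverse (Z - z • (1 : H₁ →L[ℂ] H₁))‖ * (1 + ‖z‖) ≤ C) :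
    IntegrableOn (fun t => deriv γ t • (k (γ t) * Ring.inverse (Z - (γ t) • (1 : H₁ →L[ℂ] H₁))))
      (openIv a b) := by
  have hm : MeasurableSet (openIv a b) := (isOpen_openIv a b).measurableSet
  have hγc : ContinuousOn γ (openIv a b) := hγ.lipschitz.continuousOn
  refine Integrable.mono' (hγ.finiteVariation.mul_const C) ?_ ?_
  · have hd : AEStronglyMeasurable (deriv γ) (volume.restrict (openIv a b)) :=
      aestronglyMeasurable_deriv _ _
    refine hd.smul (ContinuousOn.aestronglyMeasurable ?_ hm)
    refine (hk.comp hγc fun t ht => Or.inl (hγ.mapsTo ht)).mul fun t ht => ?_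
    exact (hasDerivAt_inverse_sub_smul_one (hZ _ (subset_closure
      (hγ.mapsTo ht)))).continuousAt.comp_continuousWithinAt (hγc t ht)
  · filter_upwards [ae_restrict_mem hm] with t ht
    have h1 := hC _ (subset_closure (hγ.mapsTo ht))
    have h2 : ‖Ring.inverse (Z - (γ t) • (1 : H₁ →L[ℂ] H₁))‖ ≤ C := by
      nlinarith [norm_nonneg (γ t), norm_nonneg (Ring.inverse (Z - (γ t) • (1 : H₁ →L[ℂ] H₁)))]
    rw [norm_smul]
    calc ‖deriv γ t‖ * ‖k (γ t) * Ring.inverse (Z - (γ t) • (1 : H₁ →L[ℂ] H₁))‖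
        ≤ ‖deriv γ t‖ * (‖k (γ t)‖ * C) := by
          gcongr
          exact (norm_mul_le _ _).trans (by gcongr)
      _ = _ := by ring

/-- `B* Y = -W₁(Z, Γ)`: the contour can be moved back to the interval. -/
theorem inner_angularOperator_eq {E : SpectralMeasure H₀} {B Y : H₁ →L[ℂ] H₀} {D : Set ℂ}
    {k : ℂ → (H₁ →L[ℂ] H₁)} (hac : E.IsAbsCont) (hab : a < b) (hD : IsLowerDomain a b D)
    (hk : IsContinuedDerivative E B a b D k)
    (hleft : ∀ c : ℝ, a = c → EndBound D k c) (hright : ∀ c : ℝ, b = c → EndBound D k c)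
    (l : ℤˣ) (hγ : IsAdmissible a b (domainOf D l) (contOf k l) γ)
    (hZ : ∀ z ∈ closure (domainOf D l), z ∉ spectrum ℂ Z)
    (hY : ∀ x, Tendsto (angularIntegral E B Z x) (leftEnd a ×ˢ rightEnd b) (𝓝 (Y x)))
    (x y : H₁) : inner ℂ (B y) (Y x) = -inner ℂ y (W1 a b (contOf k l) γ Z x) := by
  set W := domainOf D l
  set R : ℂ → (H₁ →L[ℂ] H₁) := fun z => Ring.inverse (Z - z • (1 : H₁ →L[ℂ] H₁))
  have hIW : openIvC a b ⊆ closure W := hD.openIvC_subset_closure l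
  have hWcl : W ∪ openIvC a b ⊆ closure W := union_subset subset_closure hIW
  obtain ⟨C, hC0, hC⟩ := exists_norm_inverse_sub_smul_one_mul_le isClosed_closure hZ
  have hkc : ContinuousOn (contOf k l) (W ∪ openIvC a b) := fun z hz =>
    (hk.eventually_differentiableAt l hz).self_of_nhds.continuousAt.continuousWithinAt
  -- An open set containing both the domain and the interval, so that local primitives exist along
  -- the whole deformation, including its start on the real line.
  set U : Set ℂ := interior {z | DifferentiableAt ℂ (contOf k l) z} ∩ (spectrum ℂ Z)ᶜ
  have hU : IsOpen U := isOpen_interior.inter (spectrum.isClosed Z).isOpen_compl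
  have hWU : W ∪ openIvC a b ⊆ U := fun z hz =>
    ⟨mem_interior_iff_mem_nhds.mpr (hk.eventually_differentiableAt l hz), hZ z (hWcl hz)⟩
  set T : (H₁ →L[ℂ] H₁) →L[ℂ] ℂ := (innerSL ℂ y).comp (ContinuousLinearMap.apply ℂ H₁ x)
  have hT : ∀ A : H₁ →L[ℂ] H₁, T A = inner ℂ y (A x) := fun A => rfl
  set f : ℂ → ℂ := fun z => T (contOf k l z * R z)
  have hf : DifferentiableOn ℂ f U := by
    intro z hz
    have h0 : z ∈ {z | DifferentiableAt ℂ (contOf k l) z} := interior_subset hz.1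
    have h1 : DifferentiableAt ℂ (contOf k l) z := h0
    have h2 : DifferentiableAt ℂ R z := (hasDerivAt_inverse_sub_smul_one hz.2).differentiableAt
    exact (T.differentiableAt.comp z (h1.mul h2)).differentiableWithinAt
  have hfk : ∀ z ∈ W ∪ openIvC a b, ‖f z‖ * (1 + ‖z‖) ≤ (‖T‖ * C) * ‖contOf k l z‖ := by
    intro z hz
    have h1 := hC z (hWcl hz)
    calc ‖f z‖ * (1 + ‖z‖) ≤ (‖T‖ * (‖contOf k l z‖ * ‖R z‖)) * (1 + ‖z‖) := by
          gcongr
          exact (T.le_opNorm _).trans (by gcongr; exact norm_mul_le _ _)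
      _ = ‖T‖ * ‖contOf k l z‖ * (‖R z‖ * (1 + ‖z‖)) := by ring
      _ ≤ ‖T‖ * ‖contOf k l z‖ * C := by gcongr
      _ = _ := by ring
  have hend_left : ∀ c : ℝ, a = c → EndBoundOn (W ∪ openIvC a b) (contOf k l) c := fun c hc =>
    hk.endBoundOn hD l (fun h => by have := h.1; rw [hc] at this; exact lt_irrefl _ this) (hleft c hc)
  have hend_right : ∀ c : ℝ, b = c → EndBoundOn (W ∪ openIvC a b) (contOf k l) c := fun c hc =>
    hk.endBoundOn hD l (fun h => by have := h.2; rw [hc] at this; exact lt_irrefl _ this) (hright c hc)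
  have hΦ := integrableOn_W1_integrand hγ hkc hZ hC
  have hfγ : ∀ t, f (γ t) * deriv γ t = T (deriv γ t • (contOf k l (γ t) * R (γ t))) := by
    intro t; rw [map_smul, smul_eq_mul, mul_comm]
  have h₁ : Tendsto (fun q : ℝ × ℝ => ∫ t in q.1..q.2, f (γ t) * deriv γ t)
      (leftEnd a ×ˢ rightEnd b) (𝓝 (-inner ℂ y (W1 a b (contOf k l) γ Z x))) := by
    have h2 := tendsto_intervalIntegral_ends hab (T.integrable_comp hΦ)
    have h3 : ∫ t in openIv a b, T (deriv γ t • (contOf k l (γ t) * R (γ t))) =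
        -inner ℂ y (W1 a b (contOf k l) γ Z x) := by
      rw [T.integral_comp_comm hΦ, ← hT, W1, map_neg, neg_neg]
    rw [h3] at h2
    simpa only [hfγ] using h2
  have h₀ : Tendsto (fun q : ℝ × ℝ => ∫ t in q.1..q.2, f t)
      (leftEnd a ×ˢ rightEnd b) (𝓝 (inner ℂ (B y) (Y x))) := by
    have h2 := (tendsto_const_nhds (x := B y)).inner (𝕜 := ℂ) (hY x)
    refine h2.congr' ?_
    filter_upwards [eventually_ends hab] with q hq
    have hI := Icc_subset_openIv hq.1 hq.2.1
    exact inner_angularIntegral hac hq.2.2.le (fun t ht => hZ _ (hIW ⟨t, hI ht, rfl⟩))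
      (k := fun t => contOf k l t) (fun t ht => hk.hasDerivAt_contOf l (hI ht))
      (hkc.comp Complex.continuous_ofReal.continuousOn fun t ht => Or.inr ⟨t, hI ht, rfl⟩) x y
  obtain ⟨H, hH⟩ := hγ.deformation
  exact hH.eq_of_tendsto hab hγ.lipschitz (fun z hz => hD.im_ne_zero l hz) hU hWU hf hkc
    (by positivity) hfk hend_left hend_right h₀ h₁

/-- The deformation fixes finite end points, so its final curve tends to c. Hence c is no closer to
σ₁ than the contour is. -/
theorem left_mem_closure_contour {H : ℝ → ℝ → ℂ} {c : ℝ} (hcb : (c : EReal) < b)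
    (hH : IsDeformation c b W k γ H) : (c : ℂ) ∈ closure (contour c b γ) := by
  have hne := leftEnd_neBot hcb
  obtain ⟨m, hm⟩ := openIv_nonempty hcb
  rw [Metric.mem_closure_iff]
  intro ε hε
  obtain ⟨t, h1, h2⟩ := ((hH.left_finite c rfl ε hε).and (eventually_leftEnd_lt hm)).exists
  refine ⟨γ t, ⟨t, h2.1, rfl⟩, ?_⟩
  rw [dist_comm, ← hH.final t h2.1]
  exact h1 1 (by simp)

theorem right_mem_closure_contour {H : ℝ → ℝ → ℂ} {c : ℝ} (hac : a < (c : EReal))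
    (hH : IsDeformation a c W k γ H) : (c : ℂ) ∈ closure (contour a c γ) := by
  have hne := rightEnd_neBot hac
  obtain ⟨m, hm⟩ := openIv_nonempty hac
  rw [Metric.mem_closure_iff]
  intro ε hε
  obtain ⟨t, h1, h2⟩ := ((hH.right_finite c rfl ε hε).and (eventually_rightEnd_gt hm)).exists
  refine ⟨γ t, ⟨t, h2.1, rfl⟩, ?_⟩
  rw [dist_comm, ← hH.final t h2.1]
  exact h1 1 (by simp)

/-- A real point closer to a point of the interval than the contour lies in the interval. -/
theorem mem_openIv_of_abs_sub_lt {H : ℝ → ℝ → ℂ} (hab : a < b) (hH : IsDeformation a b W k γ H)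
    {σ : Set ℂ} {s t : ℝ} (hs : s ∈ openIv a b) (hsσ : (s : ℂ) ∈ σ)
    (hst : |s - t| < setDist σ (contour a b γ)) : t ∈ openIv a b := by
  constructor
  · by_contra! hta
    induction a with
    | top => exact absurd hab not_top_lt
    | bot => exact absurd hta (not_le.mpr (EReal.bot_lt_coe t))
    | coe c =>
      have h1 := setDist_le_of_mem_closure hsσ (left_mem_closure_contour hab hH)
      rw [Complex.dist_of_im_eq (by simp), Complex.ofReal_re, Complex.ofReal_re, Real.dist_eq] at h1
      have h2 : t ≤ c := EReal.coe_le_coe_iff.mp hta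
      have h3 : c < s := EReal.coe_lt_coe_iff.mp hs.1
      rw [abs_of_pos (by linarith)] at h1 hst
      linarith
  · by_contra! hta
    induction b with
    | bot => exact absurd hab not_lt_bot
    | top => exact absurd hta (not_le.mpr (EReal.coe_lt_top t))
    | coe c =>
      have h1 := setDist_le_of_mem_closure hsσ (right_mem_closure_contour hab hH)
      rw [Complex.dist_of_im_eq (by simp), Complex.ofReal_re, Complex.ofReal_re, Real.dist_eq] at h1
      have h2 : c ≤ t := EReal.coe_le_coe_iff.mp hta
      have h3 : s < c := EReal.coe_lt_coe_iff.mp hs.2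
      rw [abs_of_neg (by linarith)] at h1 hst
      linarith

end Contour

/-! ### The norm bound -/

theorem mainTheorem7
    {H₀ H₁ : Type*}
    [NormedAddCommGroup H₀] [InnerProductSpace ℂ H₀] [CompleteSpace H₀]
    [NormedAddCommGroup H₁] [InnerProductSpace ℂ H₁] [CompleteSpace H₁] [Nontrivial H₁]
    -- the self-adjoint entries, with the spectral measure of the first one, and the coupling
    (A₀ : H₀ →ₗ.[ℂ] H₀) (hA₀ : IsSelfAdjoint A₀)
    (E : SpectralMeasure H₀) (hE : E.IsSpectralMeasureOf A₀)
    (A₁ : H₁ →L[ℂ] H₁) (hA₁ : IsSelfAdjoint A₁)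
    (B : H₁ →L[ℂ] H₀)
    -- the spectral disposition
    (a b : EReal) (hab : a < b)
    (hσ₀ : unboundedSpectrum A₀ = closure (openIvC a b)) (hac : E.IsAbsCont)
    (hσ₁ : spectrum ℂ A₁ ⊆ openIvC a b)
    -- the analytic continuation of the derivative of `K_B`
    (D : Set ℂ) (hD : IsLowerDomain a b D)
    (k : ℂ → (H₁ →L[ℂ] H₁)) (hk : IsContinuedDerivative E B a b D k)
    (hleft : ∀ c : ℝ, a = c → EndBound D k c) (hright : ∀ c : ℝ, b = c → EndBound D k c)
    -- the admissible contour in `D^l`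
    (l : ℤˣ) (γ : ℝ → ℂ) (hγ : IsAdmissible a b (domainOf D l) (contOf k l) γ)
    (d V : ℝ) (hd : d = setDist (spectrum ℂ A₁) (contour a b γ))
    (hV : V = variation a b (contOf k l) γ) (hbest : V < d ^ 2 / 4)
    -- the solution of the basic equation in an admissible ball
    (r : ℝ) (hr : rMin d V ≤ r) (hr' : r < rMax d V)
    (X : H₁ →L[ℂ] H₁) (hXr : ‖X‖ ≤ r) (hX : X = W1 a b (contOf k l) γ (A₁ + X))
    -- separation of the spectrum of `Z = A₁ + X` from `D^l`
    (hZ : 0 < setDist (spectrum ℂ (A₁ + X)) (domainOf D l)) :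
    (∃ Y : H₁ →L[ℂ] H₀, IsAngularOperator E B a b (A₁ + X) Y) ∧
      ∀ Y : H₁ →L[ℂ] H₀, IsAngularOperator E B a b (A₁ + X) Y →
        ‖ContinuousLinearMap.adjoint Y‖ = ‖Y‖ ∧ 1 ≤ ‖Y‖ := by
  set Z := A₁ + X with hZdef
  have hZcl : ∀ z ∈ closure (domainOf D l), z ∉ spectrum ℂ Z := by
    intro z hz hzs
    have := setDist_le_of_mem_closure hzs hz
    rw [dist_self] at this
    linarith
  have hIcl : openIvC a b ⊆ closure (domainOf D l) := hD.openIvC_subset_closure l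
  have hIcl' : closure (openIvC a b) ⊆ closure (domainOf D l) := closure_minimal hIcl isClosed_closure
  have hZI : ∀ t ∈ openIv a b, (t : ℂ) ∉ spectrum ℂ Z := fun t ht => hZcl _ (hIcl ⟨t, ht, rfl⟩)
  constructor
  · obtain ⟨C, hC0, hC⟩ := exists_norm_inverse_sub_smul_one_mul_le isClosed_closure hZcl
    obtain ⟨Y, hY⟩ := exists_tendsto_angularIntegral (B := B) hac hab hZI hC0
      (fun t ht => by simpa [realResolvent] using hC t (hIcl ⟨t, ht, rfl⟩))
      (fun c hc => by subst hc; exact hZcl _ (hIcl' (mem_closure_openIvC_left hab)))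
      (fun c hc => by subst hc; exact hZcl _ (hIcl' (mem_closure_openIvC_right hab)))
    exact ⟨Y, isAngularOperator_of_tendsto hac hZI hY⟩
  · intro Y hYang
    refine ⟨LinearIsometryEquiv.norm_map _ Y, ?_⟩
    by_contra! hYlt
    have hl := leftEnd_neBot hab
    have hr := rightEnd_neBot hab
    have hY := fun x => hYang.tendsto_angularIntegral hac hab hZI x
    -- The contour shift gives B*Y = -W₁(Z, Γ), and the basic equation identifies W₁(Z, Γ) with X.
    have hBY : ∀ x y, inner ℂ (B y) (Y x) = -inner ℂ y (X x) := by
      intro x y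
      rw [inner_angularOperator_eq hac hab hD hk hleft hright l hγ hZcl hY x y, ← hX]
    have hsymm : ∀ x y, inner ℂ (Y (Z x)) (Y y) - inner ℂ (B x) (Y y) =
        inner ℂ (Y x) (Y (Z y)) - inner ℂ (Y x) (B y) := by
      intro x y
      have h1 := ((hY (Z x)).inner (𝕜 := ℂ) (hY y)).sub
        ((tendsto_const_nhds (x := B x)).inner (𝕜 := ℂ) (hY y))
      have h2 := ((hY x).inner (𝕜 := ℂ) (hY (Z y))).sub
        ((hY x).inner (𝕜 := ℂ) (tendsto_const_nhds (x := B y)))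
      refine tendsto_nhds_unique h1 (h2.congr' ?_)
      filter_upwards [eventually_ends hab] with q hq
      exact (inner_angularIntegral_symm hac hq.2.2.le (fun t ht =>
        hZI t (Icc_subset_openIv hq.1 hq.2.1 ht)) x y).symm
    obtain ⟨z, hz⟩ := spectrum.nonempty Z
    -- Since B*Y = -X, the terms with B in `hsymm` are the terms with X in Z = A₁ + X. What remains
    -- is the symmetry of A₁.
    have him := im_eq_zero_of_mem_spectrum hYlt (Z := Z) (fun x y => by
      have e1 : inner ℂ (Z x) y = inner ℂ (A₁ x) y + inner ℂ (X x) y := by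
        rw [hZdef, add_apply, inner_add_left]
      have e2 : inner ℂ x (Z y) = inner ℂ x (A₁ y) + inner ℂ x (X y) := by
        rw [hZdef, add_apply, inner_add_right]
      have e3 : inner ℂ (A₁ x) y = inner ℂ x (A₁ y) := hA₁.isSymmetric x y
      have e4 : inner ℂ (Y x) (B y) = -inner ℂ (X x) y := by
        rw [← inner_conj_symm, hBY, map_neg, inner_conj_symm]
      have e5 := hBY y x
      linear_combination e1 - e2 + e3 - hsymm x y + e4 - e5) hz
    have hzr : z = (z.re : ℂ) := Complex.ext (by simp) (by simp [him])
    rw [hzr] at hz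
    obtain ⟨s, hs, hsn⟩ := exists_mem_spectrum_norm_sub_le hA₁ hz
    obtain ⟨s, hsI, rfl⟩ := hσ₁ hs
    obtain ⟨H, hH⟩ := hγ.deformation
    -- The spectral point is within ‖X‖ ≤ r < d - √V ≤ d of a point of σ₁, too close to lie outside
    -- Δ₀.
    refine hZI z.re (mem_openIv_of_abs_sub_lt hab hH hsI hs ?_) hz
    rw [← hd]
    have h1 : |s - z.re| ≤ ‖X‖ := by
      rwa [← Complex.ofReal_sub, Complex.norm_real, Real.norm_eq_abs] at hsn
    have h2 := Real.sqrt_nonneg V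
    rw [rMax] at hr'
    linarith

end
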